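/- Let $G$ be a discrete group and $\mathcal F$ a family of finite subgroups of $G$ that is closed under conjugation and finite intersections. A $(G,\mathcal F)$-CW-complex is a $G$-space $X$ with a $G$-invariant filtration $\emptyset=X_{(-1)}\subseteq X_{(0)}\subseteq X_{(1)}\subseteq\cdots$ with union $X$, such that $X$ carries the colimit topology and, for each $n\ge 0$, $X_{(n)}$ arises from $X_{(n-1)}$ by a $G$-pushout attaching a family of equivariant cells $G/H_i\times D^n$ along $G/H_i\times S^{n-1}$, with $H_i\in\mathcal F$. A $G$-map is cellular if it preserves the filtrations. Let $\mathrm{Orb}_{\mathcal F}(G)$ be the category whose objects are the subgroups $H\in\mathcal F$ and whose morphisms $H\to K$ are the $G$-maps $G/H\to G/K$. The fundamental functor $\Pi_1(X;G,\mathcal F)\colon \mathrm{Orb}_{\mathcal F}(G)^{op}\to \mathrm{Groupoids}$ sends $H$ to the fundamental groupoid of the fixed point space $X^H$ restricted to the objects in $X^H\cap X_{(0)}$, and sends the $G$-map $G/H\to G/K$, $H\mapsto aK$, to the morphism of groupoids induced by $X^K\to X^H$, $x\mapsto ax$. A cellular $G$-map $\varphi\colon Y\to X$ induces a natural transformation $\varphi_\#\colon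 \Pi_1(Y;G,\mathcal F)\to\Pi_1(X;G,\mathcal F)$. Let $X$ be a $(G,\mathcal F)$-CW-complex. Then there exists a $(G,\mathcal F)$-CW-complex obtained from the $2$-skeleton $X_{(2)}$ by attaching equivariant cells $G/H\times D^k$ with $H\in\mathcal F$ and $k\ge 3$, all of whose fixed point spaces for subgroups $H\in\mathcal F$ have trivial homotopy groups $\pi_m$, $m\geq 2$, at all base points. Let $B=B\Pi_1(X;G,\mathcal F)$ be any such complex. The inclusions $i\colon X_{(2)}\to X$ and $j\colon X_{(2)}\to B$ induce isomorphisms $i_\#$ and $j_\#$ of fundamental functors, and we identify $\Pi_1(B;G,\mathcal F)$ with $\Pi_1(X;G,\mathcal F)$ by $i_\#\circ j_\#^{-1}$. Then for every $(G,\mathcal F)$-CW-complex $Y$ and every natural transformation $\Phi\colon \Pi_1(Y;G,\mathcal F)\to\Pi_1(X;G,\mathcal F)$ there exists a $G$-equivariant cellular map $\varphi\colon Y\to B$ with $\varphi_\#=\Phi$ (that is, $i_\#\circ j_\#^{-1}\circ\varphi_\#=\Phi$), and any two $G$-equivariant cellular maps $Y\to B$ with this property are $G$-homotopic. -/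

import Mathlib

open CategoryTheory Topology

universe u

namespace EquivariantCW

/-- A family of finite subgroups of `G` that is closed under conjugation and under finite
(that is, binary) intersections. -/
structure IsFamily {G : Type u} [Group G] (F : Set (Subgroup G)) : Prop where
  finite_mem : ∀ H ∈ F, Finite H
  conj_mem : ∀ H ∈ F, ∀ g : G, H.map (MulAut.conj g).toMonoidHom ∈ F
  inter_mem : ∀ H ∈ F, ∀ K ∈ F, H ⊓ K ∈ F

/-! ### The orbit category -/

/-- The objects of the orbit category: the subgroups that belong to the family. -/
structure OrbitCat {G : Type u} [Group G] (F : Set (Subgroup G)) : Type u where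
  grp : Subgroup G
  mem : grp ∈ F

/-- The morphisms `H ⟶ K` of the orbit category are the `G`-maps `G ⧸ H → G ⧸ K`. Such a map is
`x H ↦ x a K` for an element `a`, unique modulo `K`, with `a⁻¹ H a ≤ K`: it is the composite of a
conjugation and an inclusion. -/
instance OrbitCat.category {G : Type u} [Group G] (F : Set (Subgroup G)) :
    Category.{u} (OrbitCat F) where
  Hom H K := (G ⧸ H.grp) →[G] (G ⧸ K.grp)
  id H := MulActionHom.id G
  comp f g := g.comp f

/-- The coset `H` in `G ⧸ H`. -/
abbrev baseCoset {G : Type u} [Group G] (H : Subgroup G) : G ⧸ H := ((1 : G) : G ⧸ H)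

lemma smul_baseCoset {G : Type u} [Group G] (H : Subgroup G) (h : H) : h.1 • baseCoset H = baseCoset H := by
  change ((h.1 * 1 : G) : G ⧸ H) = ((1 : G) : G ⧸ H)
  rw [QuotientGroup.eq]
  simp

/-! ### The fundamental groupoid on a set of base points -/

/-- A topological space with a set of base points. -/
structure BasedSpace : Type (u + 1) where
  carrier : Type u
  [top : TopologicalSpace carrier]
  pts : Set carrier

attribute [instance] BasedSpace.top

/-- Continuous maps that send base points to base points. -/
@[ext]
structure BasedSpace.Hom (P Q : BasedSpace.{u}) : Type u where
  toMap : C(P.carrier, Q.carrier)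
  mapsTo : ∀ x ∈ P.pts, toMap x ∈ Q.pts

instance BasedSpace.category : Category.{u} BasedSpace.{u} where
  Hom P Q := BasedSpace.Hom P Q
  id P := ⟨ContinuousMap.id _, fun _ h => h⟩
  comp f g := ⟨g.toMap.comp f.toMap, fun x h => g.mapsTo _ (f.mapsTo x h)⟩

/-- The fundamental groupoid of a space restricted to the set of base points: the objects are the
base points, the morphisms all homotopy classes (rel endpoints) of paths in the space. -/
abbrev BasedSpace.Grpoid (P : BasedSpace.{u}) : Type u :=
  InducedCategory (FundamentalGroupoid P.carrier)
    (fun x : P.pts => (⟨x.1⟩ : FundamentalGroupoid P.carrier))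

/-- The morphism of groupoids induced by a map of spaces with base points. -/
noncomputable def BasedSpace.Hom.grpoidMap {P Q : BasedSpace.{u}} (f : BasedSpace.Hom P Q) :
    P.Grpoid ⥤ Q.Grpoid where
  obj x := (⟨f.toMap x.1, f.mapsTo x.1 x.2⟩ : Q.pts)
  map p := InducedCategory.homMk ((FundamentalGroupoid.map f.toMap).map p.hom)
  map_id x := by
    apply InducedCategory.hom_ext
    exact (FundamentalGroupoid.map f.toMap).map_id _
  map_comp p q := by
    apply InducedCategory.hom_ext
    exact (FundamentalGroupoid.map f.toMap).map_comp _ _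

/-- The fundamental groupoid on the set of base points, as a functor to groupoids. -/
noncomputable def restrictedFundamentalGroupoid : BasedSpace.{u} ⥤ Grpd.{u, u} where
  obj P := Grpd.of P.Grpoid
  map f := f.grpoidMap
  map_id P := by
    refine CategoryTheory.Functor.hext (fun _ => rfl) ?_
    rintro x y ⟨p⟩
    induction p using Quotient.ind
    rfl
  map_comp f g := by
    refine CategoryTheory.Functor.hext (fun _ => rfl) ?_
    rintro x y ⟨p⟩
    induction p using Quotient.ind
    rfl

/-! ### Filtered `G`-spaces and `(G, F)`-CW-complexes -/

/-- A `G`-space with an increasing exhaustive filtration by `G`-invariant subspaces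
`skel 0 ⊆ skel 1 ⊆ ...`. -/
structure FilteredGSpace (G : Type u) [Group G] [TopologicalSpace G] : Type (u + 1) where
  carrier : Type u
  [top : TopologicalSpace carrier]
  [act : MulAction G carrier]
  [cont : ContinuousSMul G carrier]
  skel : ℕ → Set carrier
  smul_mem : ∀ (n : ℕ) (g : G), ∀ x ∈ skel n, g • x ∈ skel n
  mono : Monotone skel
  exhaust : ∀ x, ∃ n, x ∈ skel n

attribute [instance] FilteredGSpace.top FilteredGSpace.act FilteredGSpace.cont

section

variable {G : Type u} [Group G] [TopologicalSpace G]

/-- The stage of the filtration that precedes `skel n`; it is empty for `n = 0`. -/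
def FilteredGSpace.skelBelow (X : FilteredGSpace G) : ℕ → Set X.carrier
  | 0 => ∅
  | n + 1 => X.skel n

lemma FilteredGSpace.skelBelow_subset (X : FilteredGSpace G) :
    ∀ n, X.skelBelow n ⊆ X.skel n
  | 0 => Set.empty_subset _
  | n + 1 => X.mono (Nat.le_succ n)

/-- The closed unit disk of dimension `n`. -/
abbrev Disk (n : ℕ) : Type := Metric.closedBall (0 : EuclideanSpace ℝ (Fin n)) 1

/-- The disjoint union of the equivariant disks `G ⧸ H i × Disk n`. -/
abbrev Cells {ι : Type u} (H : ι → Subgroup G) (n : ℕ) : Type u :=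
  Σ i : ι, (G ⧸ H i) × Disk n

/-- The pairs that lie on the boundary `G ⧸ H i × sphere` of the equivariant disks. -/
def Cells.boundary {ι : Type u} (H : ι → Subgroup G) (n : ℕ) : Set (Cells H n) :=
  {z | ‖(z.2.2 : EuclideanSpace ℝ (Fin n))‖ = 1}

/-- `q` is the lower map of a `G`-pushout that exhibits `X.skel n` as obtained from the preceding
stage of the filtration by attaching the equivariant disks `G ⧸ H i × Disk n` along their
boundaries. That the square (with upper map the restriction of `q` to the boundary) is a pushout
means: `q` sends the boundary to the preceding stage, is a bijection from the rest onto the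
complement of that stage in `X.skel n`, and `X.skel n` has the quotient topology of the disjoint
union of the preceding stage and the equivariant disks. -/
structure IsAttachingMap (X : FilteredGSpace G) (n : ℕ) {ι : Type u} (H : ι → Subgroup G)
    (q : Cells H n → X.carrier) : Prop where
  equivariant : ∀ (g : G) (i : ι) (c : G ⧸ H i) (d : Disk n), q ⟨i, g • c, d⟩ = g • q ⟨i, c, d⟩
  boundary_mem : Set.MapsTo q (Cells.boundary H n) (X.skelBelow n)
  bijOn : Set.BijOn q (Cells.boundary H n)ᶜ (X.skel n \ X.skelBelow n)
  mem : ∀ z, q z ∈ X.skel n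
  quotient : IsQuotientMap (Sum.elim (Set.inclusion (X.skelBelow_subset n))
    (fun z => (⟨q z, mem z⟩ : X.skel n)))

/-- `X` is a `(G, F)`-CW-complex: it carries the colimit topology of its filtration, and each stage
is obtained from the preceding one by attaching equivariant cells with isotropy in `F`. -/
structure FilteredGSpace.IsCWComplex (X : FilteredGSpace G) (F : Set (Subgroup G)) : Prop where
  isClosed_iff : ∀ C : Set X.carrier,
    IsClosed C ↔ ∀ n, IsClosed ((Subtype.val : X.skel n → X.carrier) ⁻¹' C)
  attach : ∀ n : ℕ, ∃ (ι : Type u) (H : ι → Subgroup G) (q : Cells H n → X.carrier),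
    (∀ i, H i ∈ F) ∧ IsAttachingMap X n H q

/-- A cellular `G`-map: continuous, equivariant and filtration preserving. -/
@[ext]
structure CellularMap (X Y : FilteredGSpace G) : Type u where
  toMap : C(X.carrier, Y.carrier)
  map_smul : ∀ (g : G) (x : X.carrier), toMap (g • x) = g • toMap x
  map_skel : ∀ n, ∀ x ∈ X.skel n, toMap x ∈ Y.skel n

/-- The category of filtered `G`-spaces and cellular `G`-maps. -/
instance FilteredGSpace.category : Category.{u} (FilteredGSpace G) where
  Hom X Y := CellularMap X Y
  id X := ⟨ContinuousMap.id _, fun _ _ => rfl, fun _ _ h => h⟩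
  comp f g := ⟨g.toMap.comp f.toMap,
    fun a x => by simp [f.map_smul, g.map_smul],
    fun n x h => g.map_skel n _ (f.map_skel n x h)⟩

/-- Two cellular `G`-maps are `G`-homotopic if there is a homotopy between them through
`G`-maps (not required to be cellular). -/
def GHomotopic {X Y : FilteredGSpace G} (f g : X ⟶ Y) : Prop :=
  ∃ h : ContinuousMap.Homotopy (CellularMap.toMap f) (CellularMap.toMap g),
    ∀ (t : unitInterval) (a : G) (x : X.carrier), h (t, a • x) = a • h (t, x)

/-- The action on an invariant subspace of the filtration. -/
instance FilteredGSpace.skelAction (X : FilteredGSpace G) (k : ℕ) : MulAction G (X.skel k) where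
  smul g x := ⟨g • x.1, X.smul_mem k g x.1 x.2⟩
  one_smul x := Subtype.ext (one_smul G x.1)
  mul_smul a b x := Subtype.ext (mul_smul a b x.1)

/-- The `k`-skeleton, as a filtered `G`-space. -/
def FilteredGSpace.skeleton (X : FilteredGSpace G) (k : ℕ) : FilteredGSpace G where
  carrier := X.skel k
  cont := ⟨(continuous_fst.smul (continuous_subtype_val.comp continuous_snd)).subtype_mk _⟩
  skel n := Subtype.val ⁻¹' X.skel n
  smul_mem n g x hx := X.smul_mem n g x.1 hx
  mono _ _ hmn _ hx := X.mono hmn hx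
  exhaust x := X.exhaust x.1

/-- The inclusion of the `k`-skeleton. -/
def FilteredGSpace.skeletonIncl (X : FilteredGSpace G) (k : ℕ) : X.skeleton k ⟶ X :=
  CellularMap.mk (X := X.skeleton k) (Y := X) ⟨Subtype.val, continuous_subtype_val⟩
    (fun _ _ => rfl) (fun _ _ h => h)

/-! ### The fundamental functor -/

/-- The fixed point space `X^H`. -/
abbrev FilteredGSpace.fix (X : FilteredGSpace G) (H : Subgroup G) : Set X.carrier :=
  MulAction.fixedPoints H X.carrier

/-- The `G`-map `G ⧸ K → X`, `a K ↦ a • x`, given by a `K`-fixed point `x`. -/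
def orbitMap (X : FilteredGSpace G) (K : Subgroup G) (x : X.fix K) : G ⧸ K → X.carrier :=
  Quotient.lift (fun a : G => a • x.1) (by
    intro a b hab
    have h := x.2 ⟨a⁻¹ * b, QuotientGroup.leftRel_apply.1 hab⟩
    change (a⁻¹ * b) • x.1 = x.1 at h
    change a • x.1 = b • x.1
    rw [mul_smul, inv_smul_eq_iff] at h
    exact h.symm)

lemma orbitMap_smul (X : FilteredGSpace G) (K : Subgroup G) (x : X.fix K) (g : G) (c : G ⧸ K) :
    orbitMap X K x (g • c) = g • orbitMap X K x c := by
  induction c using Quotient.ind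
  exact mul_smul g _ x.1

lemma continuous_orbitMap (X : FilteredGSpace G) (K : Subgroup G) (c : G ⧸ K) :
    Continuous (fun x : X.fix K => orbitMap X K x c) := by
  induction c using Quotient.ind
  exact continuous_subtype_val.const_smul _

lemma orbitMap_mem_skel (X : FilteredGSpace G) (K : Subgroup G) (n : ℕ) (x : X.fix K)
    (hx : x.1 ∈ X.skel n) (c : G ⧸ K) : orbitMap X K x c ∈ X.skel n := by
  induction c using Quotient.ind
  exact X.smul_mem n _ _ hx

/-- The fixed point space `X^H` together with its `0`-skeleton. -/
abbrev fixedPair (X : FilteredGSpace G) (H : Subgroup G) : BasedSpace.{u} where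
  carrier := X.fix H
  pts := {x | x.1 ∈ X.skel 0}

/-- The map `X^K → X^H` induced by a `G`-map `f : G ⧸ H → G ⧸ K`: if `f H = a K`, then it sends
`x` to `a • x`. -/
def fixedPairMap (X : FilteredGSpace G) {H K : Subgroup G} (f : (G ⧸ H) →[G] (G ⧸ K)) :
    BasedSpace.Hom (fixedPair X K) (fixedPair X H) where
  toMap := ⟨fun x => ⟨orbitMap X K x (f (baseCoset H)), fun h => by
      change h.1 • orbitMap X K x (f (baseCoset H)) = _
      rw [← orbitMap_smul, ← map_smul, smul_baseCoset]⟩,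
    (continuous_orbitMap X K _).subtype_mk _⟩
  mapsTo x hx := orbitMap_mem_skel X K 0 x hx _

lemma orbitMap_comp (X : FilteredGSpace G) {H K : Subgroup G} (f : (G ⧸ H) →[G] (G ⧸ K))
    (x : X.fix K) (c : G ⧸ H) :
    orbitMap X H ((fixedPairMap X f).toMap x) c = orbitMap X K x (f c) := by
  induction c using Quotient.ind with
  | _ a =>
    change a • orbitMap X K x (f (baseCoset H)) = orbitMap X K x (f (a : G ⧸ H))
    rw [← orbitMap_smul, ← map_smul]
    congr 2
    change ((a * 1 : G) : G ⧸ H) = _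
    rw [mul_one]

/-- The contravariant functor `H ↦ (X^H, 0-skeleton of X^H)` on the orbit category. -/
def fixedPointFunctor (F : Set (Subgroup G)) (X : FilteredGSpace G) :
    (OrbitCat F)ᵒᵖ ⥤ BasedSpace.{u} where
  obj H := fixedPair X H.unop.grp
  map f := fixedPairMap X f.unop
  map_id H := by
    apply BasedSpace.Hom.ext
    ext x
    exact one_smul G x.1
  map_comp {H K L} f g := by
    apply BasedSpace.Hom.ext
    ext x
    exact (orbitMap_comp X f.unop x
      ((show (G ⧸ L.unop.grp) →[G] (G ⧸ K.unop.grp) from g.unop) (baseCoset L.unop.grp))).symm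

/-- The restriction `X^H → Y^H` of a cellular `G`-map `X → Y`. -/
def fixMap {X Y : FilteredGSpace G} (f : CellularMap X Y) (H : Subgroup G) :
    BasedSpace.Hom (fixedPair X H) (fixedPair Y H) where
  toMap := ⟨fun x => ⟨f.toMap x.1, fun h => by
      change h.1 • f.toMap x.1 = f.toMap x.1
      rw [← f.map_smul]
      exact congrArg _ (x.2 h)⟩,
    (f.toMap.continuous.comp continuous_subtype_val).subtype_mk _⟩
  mapsTo x hx := f.map_skel 0 x.1 hx

lemma orbitMap_fixMap {X Y : FilteredGSpace G} (f : CellularMap X Y) (H : Subgroup G)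
    (x : X.fix H) (c : G ⧸ H) :
    f.toMap (orbitMap X H x c) = orbitMap Y H ((fixMap f H).toMap x) c := by
  induction c using Quotient.ind
  exact f.map_smul _ x.1

/-- The restrictions `X^H → Y^H` of a cellular `G`-map `X → Y`, as a natural transformation. -/
def fixedPointMap (F : Set (Subgroup G)) {X Y : FilteredGSpace G} (f : X ⟶ Y) :
    fixedPointFunctor F X ⟶ fixedPointFunctor F Y where
  app H := fixMap f H.unop.grp
  naturality {H K} k := by
    apply BasedSpace.Hom.ext
    ext x
    apply Subtype.ext
    exact orbitMap_fixMap f H.unop.grp x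
      ((show (G ⧸ K.unop.grp) →[G] (G ⧸ H.unop.grp) from k.unop) (baseCoset K.unop.grp))

/-- The fundamental functor `Π₁(X; G, F) : Orb_F(G)ᵒᵖ ⥤ Groupoids`, sending `H` to the fundamental
groupoid of `X^H` restricted to the `0`-skeleton of `X^H`. -/
noncomputable def fundamentalFunctor (F : Set (Subgroup G)) (X : FilteredGSpace G) :
    (OrbitCat F)ᵒᵖ ⥤ Grpd.{u, u} :=
  fixedPointFunctor F X ⋙ restrictedFundamentalGroupoid

/-- The natural transformation of fundamental functors induced by a cellular `G`-map. -/
noncomputable def inducedTransf (F : Set (Subgroup G)) {X Y : FilteredGSpace G} (f : X ⟶ Y) :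
    fundamentalFunctor F X ⟶ fundamentalFunctor F Y :=
  Functor.whiskerRight (fixedPointMap F f) restrictedFundamentalGroupoid

/-! ### The universal space -/

/-- The result `B` of the construction of `BΠ₁(X; G, F)`: a `(G, F)`-CW-complex obtained from the
`2`-skeleton of `X` by attaching equivariant cells of dimension at least `3` (so that its
`2`-skeleton is that of `X`), such that for all `H` in `F` the homotopy groups of `B^H` in degrees
at least `2` are trivial, for all base points. -/
structure UniversalSpace (F : Set (Subgroup G)) (X : FilteredGSpace G) : Type (u + 1) where
  space : FilteredGSpace G
  isCWComplex : space.IsCWComplex F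
  twoSkeleton : X.skeleton 2 ≅ space.skeleton 2
  homotopy_trivial : ∀ H ∈ F, ∀ m : ℕ, 2 ≤ m → ∀ x : space.fix H, Subsingleton (π_ m (space.fix H) x)

/-- The inclusion of the `2`-skeleton of `X` into the universal space. -/
def UniversalSpace.incl {F : Set (Subgroup G)} {X : FilteredGSpace G} (B : UniversalSpace F X) :
    X.skeleton 2 ⟶ B.space :=
  B.twoSkeleton.hom ≫ B.space.skeletonIncl 2

end

end EquivariantCW

/-!
The argument is obstruction theory, organized around the fixed point spaces: a `G`-map out of an
equivariant cell `G ⧸ H × Dⁿ` is the same as a map from `Dⁿ` to the subspace fixed by `H`.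

*Cellular approximation.* A map from a compact space of dimension less than `n` to a space with
`n`-cells can be pushed off the cells, relative to the points that are mapped to the complement of
the cells already (`CellAttach.push`): take the coordinates in the cells, perturb them to a map that
avoids the origin, and expand radially. Going down the skeleta gives `IsCellFiltration.approx`; a
compact set lies in some skeleton, so that the descent starts. The fixed point spaces
of a `(G, F)`-CW-complex carry such filtrations, since `G` is discrete. For paths and homotopies of
paths the conclusion is that the inclusion of the `2`-skeleton is bijective on homotopy classes of
paths, whence the two identifications of fundamental functors, `isIso_inducedTransf_skeletonIncl`
and `isIso_inducedTransf_incl`. For paths and the `1`-skeleton it is that every class is a composite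
of edges and their inverses (`IsCellFiltration.edge_induction`), so that a transformation of
fundamental functors is determined by its values on the equivariant `0`-cells and `1`-cells
(`transf_ext`).

*Extension over cells.* The vanishing of `π_m` at all base points says that maps from the `m`-sphere
extend to the disk (`diskExtends_of_homotopyGroup`, via a map from the cube to the sphere that
collapses the boundary), and a loop extends over the `2`-disk if its class is trivial
(`exists_loop_extends`). `IsPartialGMap.exists_extend_all` extends a `G`-map over the cells one
dimension at a time, provided that this is possible for each cell, and allows a condition on the
values that is used to keep the map cellular or to prescribe end points of paths.

*Existence and uniqueness.* To realize a transformation `Ψ` (`exists_inducedTransf_eq`), the values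
of `Ψ` on objects give the map on the `0`-cells, its values on edges give paths, which may be chosen
in the `1`-skeleton, the functoriality of `Ψ` makes the image of the boundary of a `2`-cell
contractible, and the vanishing of the homotopy groups takes care of the higher cells. Two cellular
maps that induce the same transformation (`gHomotopic_of_inducedTransf_eq`) agree on the
`0`-skeleton and have homotopic effect on edges; a `G`-homotopy between them is a `G`-map to the
space of paths, again constructed cell by cell. Over the `0`-cells and `1`-cells this uses the
equality of transformations, and over a cell of dimension `n ≥ 2` the problem is to fill in a map on
the boundary of the prism `[0, 1] × Dⁿ`, a sphere of dimension `n` (`DiskExtends.prism`).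

*Construction of the universal space.* Attaching, for all `H ∈ F`, cells along all maps from the
`m`-sphere to the subspace fixed by `H` (`exists_attach_all`) kills `π_m` of the fixed point spaces
for `m ≥ 2` and leaves the `m`-skeleton alone. `nonempty_universalSpace` is the colimit `towerSpace`
of the iteration, starting from the `2`-skeleton. It has the right homotopy groups because, by
cellular approximation, a sphere in the colimit can be deformed to a skeleton, which is contained in
a term of the sequence.
-/

open Opposite

namespace EquivariantCW

/-! ### Attaching cells to a subspace -/

/-- The subset `Z` of `W` arises from the closed subset `A` by attaching `n`-cells along the
characteristic maps `q j`. Everything takes place inside a fixed ambient space: the field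
`isClosed_of` expresses that `Z` carries the quotient topology of `A` and the disks, in terms of
subsets that are closed in `W`. -/
structure CellAttach {W : Type*} [TopologicalSpace W] (A Z : Set W) {J : Type*} {n : ℕ}
    (q : J → Disk n → W) : Prop where
  subset : A ⊆ Z
  isClosed : IsClosed A
  cont : ∀ j, Continuous (q j)
  boundary_mem : ∀ j d, ‖d.1‖ = 1 → q j d ∈ A
  interior_mem : ∀ j d, ‖d.1‖ < 1 → q j d ∈ Z \ A
  inj : ∀ j j' d d', ‖d.1‖ < 1 → ‖d'.1‖ < 1 → q j d = q j' d' → j = j' ∧ d = d'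
  surj : ∀ z ∈ Z, z ∉ A → ∃ j d, ‖d.1‖ < 1 ∧ q j d = z
  isClosed_of : ∀ C ⊆ Z, IsClosed (C ∩ A) → (∀ j, IsClosed (q j ⁻¹' C)) → IsClosed C

lemma Disk.norm_le {n : ℕ} (d : Disk n) : ‖d.1‖ ≤ 1 :=
  mem_closedBall_zero_iff.1 d.2

lemma Disk.norm_lt_or_eq {n : ℕ} (d : Disk n) : ‖d.1‖ < 1 ∨ ‖d.1‖ = 1 := d.norm_le.lt_or_eq

namespace CellAttach

variable {W T : Type*} [TopologicalSpace W] [TopologicalSpace T] {A Z : Set W} {J : Type*} {n : ℕ}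
  {q : J → Disk n → W}

lemma mem (h : CellAttach A Z q) (j : J) (d : Disk n) : q j d ∈ Z := by
  rcases d.norm_lt_or_eq with hd | hd
  · exact (h.interior_mem j d hd).1
  · exact h.subset (h.boundary_mem j d hd)

/-- A map on `A` and maps on the disks that agree with it along the attaching maps fit together to
a map on `Z`. -/
theorem exists_extend (h : CellAttach A Z q) (gA : W → T) (hgA : ContinuousOn gA A)
    (g : J → Disk n → T) (hg : ∀ j, Continuous (g j))
    (hb : ∀ j d, ‖d.1‖ = 1 → g j d = gA (q j d)) :
    ∃ G : W → T, Set.EqOn G gA A ∧ (∀ j d, G (q j d) = g j d) ∧ ContinuousOn G Z := by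
  classical
  let G : W → T := fun w =>
    if hw : w ∉ A ∧ ∃ jd : J × Disk n, ‖jd.2.1‖ < 1 ∧ q jd.1 jd.2 = w then
      g hw.2.choose.1 hw.2.choose.2 else gA w
  have hGA : Set.EqOn G gA A := fun w hw => dif_neg fun h' => h'.1 hw
  have hGq : ∀ j d, G (q j d) = g j d := by
    intro j d
    rcases d.norm_lt_or_eq with hd | hd
    · have hw : q j d ∉ A ∧ ∃ jd : J × Disk n, ‖jd.2.1‖ < 1 ∧ q jd.1 jd.2 = q j d :=
        ⟨(h.interior_mem j d hd).2, (j, d), hd, rfl⟩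
      obtain ⟨h1, h2⟩ := h.inj _ _ _ _ hw.2.choose_spec.1 hd hw.2.choose_spec.2
      change (if hw : _ then _ else _) = _
      rw [dif_pos hw, h1, h2]
    · rw [hGA (h.boundary_mem j d hd), hb j d hd]
  refine ⟨G, hGA, hGq, continuousOn_iff_isClosed.2 fun t ht => ⟨G ⁻¹' t ∩ Z, ?_, by simp⟩⟩
  refine h.isClosed_of _ Set.inter_subset_right ?_ fun j => ?_
  · convert hgA.preimage_isClosed_of_isClosed h.isClosed ht using 1
    ext w
    constructor
    · rintro ⟨⟨h1, -⟩, h2⟩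
      exact ⟨h2, by rw [Set.mem_preimage, ← hGA h2]; exact h1⟩
    · rintro ⟨h1, h2⟩
      exact ⟨⟨by rw [Set.mem_preimage, hGA h1]; exact h2, h.subset h1⟩, h1⟩
  · convert ht.preimage (hg j) using 1
    ext d
    simp [hGq, h.mem]

/-- A family of self-maps of the disk that fix the boundary induces a family of self-maps
of `Z` that fix `A`. -/
theorem exists_motion (h : CellAttach A Z q) {K : Type*} [TopologicalSpace K]
    (Θ : C(K × Disk n, Disk n)) (hΘ : ∀ k d, ‖d.1‖ = 1 → Θ (k, d) = d) :
    ∃ M : W → C(K, W), ContinuousOn M Z ∧ (∀ a ∈ A, ∀ k, M a k = a) ∧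
      ∀ j d k, M (q j d) k = q j (Θ (k, d)) := by
  have hc : ∀ j, Continuous fun p : Disk n × K => q j (Θ (p.2, p.1)) := fun j =>
    (h.cont j).comp (Θ.continuous.comp continuous_swap)
  obtain ⟨M, hA, hq, hM⟩ := h.exists_extend (fun w => ContinuousMap.const K w)
    ContinuousMap.continuous_const'.continuousOn
    (fun j => ContinuousMap.curry ⟨_, hc j⟩) (fun j => ContinuousMap.continuous _)
    (fun j d hd => by ext k; simp [hΘ k d hd])
  refine ⟨M, hM, fun a ha k => ?_, fun j d k => ?_⟩
  · rw [hA ha]; rfl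
  · rw [hq]; rfl

end CellAttach

/-! ### Pushing maps off the cells -/

/-- The translation by `t • u`, damped so that it is complete for `‖d‖ ≤ 1 / 4` and trivial for
`1 / 2 ≤ ‖d‖`. -/
noncomputable def pushVec {n : ℕ} (u : EuclideanSpace ℝ (Fin n)) (t : ℝ)
    (d : EuclideanSpace ℝ (Fin n)) : EuclideanSpace ℝ (Fin n) :=
  d + (t * max 0 (min 1 (2 - 4 * ‖d‖))) • u

lemma one_sub_mul_one_sub_pos (t : unitInterval) {δ : ℝ} (hδ : 0 < δ) :
    0 < 1 - (t : ℝ) * (1 - δ) := by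
  rcases t.2.1.eq_or_lt with h | h
  · rw [← h]
    norm_num
  · nlinarith [mul_pos h hδ, t.2.2]

/-- The motion of the disk, parametrized by the time `t` and a vector `u`, that pushes maps to the
boundary. The damped translation by `u` moves them off the centre, and the radial expansion by the
inverse of a radius that shrinks from `1` to `δ`, cut off at the boundary, moves everything outside
the ball of radius `δ` to the boundary. -/
noncomputable def pushMotion (n : ℕ) (δ : ℝ) (hδ : 0 < δ) :
    C((unitInterval × EuclideanSpace ℝ (Fin n)) × Disk n, Disk n) where
  toFun x := ⟨(max ‖pushVec x.1.2 x.1.1 x.2.1‖ (1 - x.1.1 * (1 - δ)))⁻¹ •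
      pushVec x.1.2 x.1.1 x.2.1, by
    have h0 := one_sub_mul_one_sub_pos x.1.1 hδ
    have h1 := lt_of_lt_of_le h0 (le_max_right ‖pushVec x.1.2 x.1.1 x.2.1‖ _)
    rw [mem_closedBall_zero_iff, norm_smul, norm_inv, Real.norm_of_nonneg h1.le,
      inv_mul_le_iff₀ h1, mul_one]
    exact le_max_left _ _⟩
  continuous_toFun := by
    have hv : Continuous fun x : (unitInterval × EuclideanSpace ℝ (Fin n)) × Disk n =>
        pushVec x.1.2 x.1.1 x.2.1 := by
      unfold pushVec; fun_prop
    have hm : Continuous fun x : (unitInterval × EuclideanSpace ℝ (Fin n)) × Disk n =>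
        max ‖pushVec x.1.2 x.1.1 x.2.1‖ (1 - x.1.1 * (1 - δ)) := hv.norm.max (by fun_prop)
    refine Continuous.subtype_mk (Continuous.smul (hm.inv₀ fun x => ?_) hv) _
    exact (lt_of_lt_of_le (one_sub_mul_one_sub_pos x.1.1 hδ) (le_max_right _ _)).ne'

lemma pushMotion_val {n : ℕ} {δ : ℝ} (hδ : 0 < δ) (t : unitInterval)
    (u : EuclideanSpace ℝ (Fin n)) (d : Disk n) :
    (pushMotion n δ hδ ((t, u), d)).1 =
      (max ‖pushVec u t d.1‖ (1 - t * (1 - δ)))⁻¹ • pushVec u t d.1 := rfl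

lemma pushMotion_zero {n : ℕ} {δ : ℝ} (hδ : 0 < δ) (u : EuclideanSpace ℝ (Fin n)) (d : Disk n) :
    pushMotion n δ hδ ((0, u), d) = d := by
  apply Subtype.ext
  rw [pushMotion_val]
  simp [pushVec, max_eq_right d.norm_le]

lemma pushMotion_boundary {n : ℕ} {δ : ℝ} (hδ : 0 < δ) (hδ1 : δ ≤ 1)
    (k : unitInterval × EuclideanSpace ℝ (Fin n)) (d : Disk n) (hd : ‖d.1‖ = 1) :
    pushMotion n δ hδ (k, d) = d := by
  obtain ⟨t, u⟩ := k
  apply Subtype.ext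
  rw [pushMotion_val]
  have : pushVec u t d.1 = d.1 := by
    simp only [pushVec, hd]
    norm_num
  rw [this, hd, max_eq_left, inv_one, one_smul]
  nlinarith [t.2.1, t.2.2]

lemma norm_pushMotion_one {n : ℕ} {δ : ℝ} (hδ : 0 < δ) (u : EuclideanSpace ℝ (Fin n)) (d : Disk n)
    (h : δ ≤ ‖pushVec u 1 d.1‖) : ‖(pushMotion n δ hδ ((1, u), d)).1‖ = 1 := by
  rw [pushMotion_val]
  simp only [Set.Icc.coe_one, one_mul, sub_sub_cancel]
  rw [max_eq_left h, norm_smul, norm_inv, norm_norm, inv_mul_cancel₀ (hδ.trans_le h).ne']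

/-- Every map from `P` to `n`-dimensional Euclidean space can be approximated by maps that stay
away from the origin. This holds for compact `P` of dimension less than `n`. -/
def AvoidsZero (P : Type*) [TopologicalSpace P] (n : ℕ) : Prop :=
  ∀ w : C(P, EuclideanSpace ℝ (Fin n)), ∀ ε > 0, ∃ p : C(P, EuclideanSpace ℝ (Fin n)),
    (∀ x, ‖p x - w x‖ < ε) ∧ ∃ δ > 0, ∀ x, δ ≤ ‖p x‖

/-- A map from a space of dimension less than `n` to a space with `n`-cells attached can be
deformed off the cells, relative to the points that are mapped to the subspace already. The vector
by which a point is translated is the difference between the coordinate of the map in the cells and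
an approximation to it that avoids the origin. -/
theorem CellAttach.push {W P : Type*} [TopologicalSpace W] [TopologicalSpace P] {A Z : Set W}
    {J : Type*} {n : ℕ} {q : J → Disk n → W} (h : CellAttach A Z q) (hP : AvoidsZero P n)
    (f : C(P, W)) (hf : ∀ x, f x ∈ Z) :
    ∃ f' : C(P, W), f.HomotopicRel f' (f ⁻¹' A) ∧ ∀ x, f' x ∈ A := by
  -- the coordinate in the cells, damped near their boundaries so that it extends by zero
  obtain ⟨V, hVA, hVq, hV⟩ := h.exists_extend (T := EuclideanSpace ℝ (Fin n)) (fun _ => 0)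
    continuousOn_const (fun _ d => min 1 (2 * (1 - ‖d.1‖)) • d.1) (fun _ => by fun_prop)
    (fun j d hd => by simp [hd])
  obtain ⟨p, hpw, δ, hδ, hpδ⟩ := hP ⟨fun x => V (f x), hV.comp_continuous f.continuous hf⟩ (1 / 8)
    (by norm_num)
  simp only [ContinuousMap.coe_mk] at hpw
  have hδ' : 0 < min δ (1 / 8) := lt_min hδ (by norm_num)
  have hδ1 : min δ (1 / 8) ≤ 1 := (min_le_right _ _).trans (by norm_num)
  obtain ⟨M, hM, hMA, hMq⟩ := h.exists_motion (pushMotion n _ hδ') (pushMotion_boundary hδ' hδ1)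
  have hMf : Continuous fun x => M (f x) := hM.comp_continuous f.continuous hf
  have hVf : Continuous fun x => V (f x) := hV.comp_continuous f.continuous hf
  have hH : Continuous fun x : unitInterval × P => M (f x.2) (x.1, p x.2 - V (f x.2)) :=
    (hMf.comp continuous_snd).eval (continuous_fst.prodMk
      ((p.continuous.comp continuous_snd).sub (hVf.comp continuous_snd)))
  refine ⟨⟨fun x => M (f x) (1, p x - V (f x)),
      hMf.eval (continuous_const.prodMk (p.continuous.sub hVf))⟩,
    ⟨⟨⟨⟨_, hH⟩, fun x => ?_, fun x => rfl⟩, fun t x hx => hMA _ hx _⟩⟩, fun x => ?_⟩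
  · by_cases hx : f x ∈ A
    · exact hMA _ hx _
    · obtain ⟨j, d, hd, hjd⟩ := h.surj _ (hf x) hx
      change M (f x) (0, _) = f x
      rw [← hjd, hMq, pushMotion_zero]
  · change M (f x) (1, _) ∈ A
    by_cases hx : f x ∈ A
    · rw [hMA _ hx]
      exact hx
    · obtain ⟨j, d, hd, hjd⟩ := h.surj _ (hf x) hx
      have hw := hpw x
      rw [← hjd, hMq]
      refine h.boundary_mem _ _ (norm_pushMotion_one hδ' _ d ?_)
      rw [← hjd, hVq] at hw
      rw [hVq]
      set v : EuclideanSpace ℝ (Fin n) := min 1 (2 * (1 - ‖d.1‖)) • d.1 with hv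
      -- near the centre the coordinate is replaced by `p x`, elsewhere it moves by at most `1 / 8`
      rcases le_total ‖d.1‖ (1 / 4) with h4 | h4
      · have h1 : v = d.1 := by rw [hv, min_eq_left (by linarith), one_smul]
        have h2 : pushVec (p x - v) 1 d.1 = p x := by
          rw [pushVec, min_eq_left (by linarith), max_eq_right zero_le_one, h1]
          simp
        rw [h2]
        exact (min_le_left _ _).trans (hpδ x)
      · refine (min_le_right _ _).trans ?_
        have hc : ‖(1 * max 0 (min 1 (2 - 4 * ‖d.1‖))) • (p x - v)‖ ≤ 1 / 8 := by
          rw [norm_smul, one_mul, Real.norm_of_nonneg (le_max_left _ _)]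
          have : max 0 (min 1 (2 - 4 * ‖d.1‖)) ≤ 1 := max_le zero_le_one (min_le_left _ _)
          calc _ ≤ 1 * ‖p x - v‖ := by gcongr
            _ ≤ _ := by linarith
        have := norm_sub_le_norm_add d.1 ((1 * max 0 (min 1 (2 - 4 * ‖d.1‖))) • (p x - v))
        rw [pushVec]
        linarith

/-! ### Cellular filtrations and cellular approximation -/

/-- The stage of a filtration that precedes a given one; it is empty for the stage `0`. -/
def stageBelow {W : Type*} (S : ℕ → Set W) : ℕ → Set W
  | 0 => ∅
  | n + 1 => S n

/-- A filtration of a space such that every stage arises from the preceding one by attaching cells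
of the respective dimension, and such that compact subsets lie in a finite stage. -/
structure IsCellFiltration {W : Type u} [TopologicalSpace W] (S : ℕ → Set W) : Prop where
  mono : Monotone S
  compact : ∀ K : Set W, IsCompact K → ∃ n, K ⊆ S n
  attach : ∀ n, ∃ (J : Type u) (q : J → Disk n → W), CellAttach (stageBelow S n) (S n) q

/-- `P` is compact and behaves like a space of dimension at most `m`, see `AvoidsZero`. -/
structure LowDim (P : Type*) [TopologicalSpace P] (m : ℕ) : Prop where
  compact : CompactSpace P
  avoids : ∀ n, m < n → AvoidsZero P n

lemma LowDim.mono {P : Type*} [TopologicalSpace P] {m n : ℕ} (hP : LowDim P m) (h : m ≤ n) :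
    LowDim P n :=
  ⟨hP.compact, fun _ hk => hP.avoids _ (h.trans_lt hk)⟩

/-- Cellular approximation: a map from a compact space of dimension at most `m` can be deformed
into the `m`-th stage, relative to the points that are mapped there already. -/
theorem IsCellFiltration.approx {W : Type u} [TopologicalSpace W] {S : ℕ → Set W}
    (hS : IsCellFiltration S) {P : Type*} [TopologicalSpace P] {m : ℕ} (hP : LowDim P m)
    (f : C(P, W)) :
    ∃ f' : C(P, W), f.HomotopicRel f' (f ⁻¹' S m) ∧ ∀ x, f' x ∈ S m := by
  have := hP.compact
  obtain ⟨N, hN⟩ := hS.compact _ (isCompact_range f.continuous)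
  have key : ∀ k, ∀ g : C(P, W), (∀ x, g x ∈ S (m + k)) →
      ∃ g' : C(P, W), g.HomotopicRel g' (g ⁻¹' S m) ∧ ∀ x, g' x ∈ S m := by
    intro k
    induction k with
    | zero => exact fun g hg => ⟨g, .refl g, hg⟩
    | succ k ih =>
      intro g hg
      obtain ⟨J, q, hq⟩ := hS.attach (m + (k + 1))
      obtain ⟨g₁, ⟨h₁⟩, hg₁⟩ := hq.push (hP.avoids _ (by omega)) g hg
      obtain ⟨g₂, ⟨h₂⟩, hg₂⟩ := ih g₁ hg₁
      have hsub : ∀ x ∈ g ⁻¹' S m, g x ∈ S (m + k) := fun x hx => hS.mono (by omega) hx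
      have heq : ∀ x ∈ g ⁻¹' S m, g₁ x = g x := fun x hx => (h₁.fst_eq_snd (hsub x hx)).symm
      exact ⟨g₂, ⟨(⟨h₁.toHomotopy, fun t x hx => h₁.prop t x (hsub x hx)⟩ :
        g.HomotopyRel g₁ (g ⁻¹' S m)).trans ⟨h₂.toHomotopy, fun t x hx => h₂.prop t x (by
          rw [Set.mem_preimage, heq x hx]; exact hx) |>.trans (heq x hx)⟩⟩, hg₂⟩
  exact key N f fun x => hS.mono (by omega) (hN ⟨x, rfl⟩)

end EquivariantCW

namespace EquivariantCW

/-! ### Spaces of low dimension -/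

/-- A compact subspace of Hausdorff dimension at most `m` of a Euclidean space has low dimension: a
map to a space of dimension greater than `m` is approximated by a smooth map, whose image has
measure zero, so that an arbitrarily small translation moves the image off the origin. -/
theorem LowDim.of_injective {P E : Type*} [TopologicalSpace P] [CompactSpace P]
    [NormedAddCommGroup E] [NormedSpace ℝ E] [FiniteDimensional ℝ E] (j : C(P, E))
    (hj : Function.Injective j) {m : ℕ} (hm : dimH (Set.range j) ≤ m) : LowDim P m := by
  refine ⟨inferInstance, fun n hn w ε hε => ?_⟩
  have hcl : IsClosedEmbedding j := j.continuous.isClosedEmbedding hj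
  obtain ⟨w', hw'⟩ := w.exists_extension hcl
  obtain ⟨g, hg, hgw, -⟩ := w'.continuous.exists_contDiff_approx 1 (ε := fun _ => ε / 2)
    continuous_const (fun _ => half_pos hε)
  have hdense : Dense (g '' Set.range j)ᶜ :=
    (hg.contDiffOn (s := Set.univ)).dense_compl_image_of_dimH_lt_finrank convex_univ
      (Set.subset_univ _) (hm.trans_lt (by simpa using hn))
  obtain ⟨a, ha, ha'⟩ := hdense.exists_dist_lt 0 (half_pos hε)
  rw [dist_zero_left] at ha'
  have hc : Continuous fun x => g (j x) - a :=
    (hg.continuous.comp j.continuous).sub continuous_const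
  refine ⟨⟨_, hc⟩, fun x => ?_, ?_⟩
  · have h1 := hgw (j x)
    rw [dist_eq_norm, show w' (j x) = w x from DFunLike.congr_fun hw' x] at h1
    change ‖g (j x) - a - w x‖ < ε
    calc ‖g (j x) - a - w x‖ = ‖(g (j x) - w x) - a‖ := by congr 1; abel
      _ ≤ ‖g (j x) - w x‖ + ‖a‖ := norm_sub_le _ _
      _ < ε := by linarith
  · rcases isEmpty_or_nonempty P with _ | _
    · exact ⟨1, one_pos, fun x => isEmptyElim x⟩
    · obtain ⟨x₀, -, hx₀⟩ := isCompact_univ.exists_isMinOn Set.univ_nonempty hc.norm.continuousOn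
      refine ⟨‖g (j x₀) - a‖, norm_pos_iff.2 fun h => ha ?_, fun x => hx₀ (Set.mem_univ x)⟩
      exact ⟨j x₀, ⟨x₀, rfl⟩, sub_eq_zero.1 h⟩

theorem LowDim.of_finrank {P E : Type*} [TopologicalSpace P] [CompactSpace P]
    [NormedAddCommGroup E] [NormedSpace ℝ E] [FiniteDimensional ℝ E] (j : C(P, E))
    (hj : Function.Injective j) : LowDim P (Module.finrank ℝ E) := by
  refine LowDim.of_injective j hj ?_
  rw [← Real.dimH_univ_eq_finrank E]
  exact dimH_mono (Set.subset_univ _)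

lemma lowDim_unitInterval : LowDim unitInterval 1 := by
  simpa using LowDim.of_finrank (⟨Subtype.val, continuous_subtype_val⟩ : C(unitInterval, ℝ))
    Subtype.val_injective

lemma lowDim_square : LowDim (unitInterval × unitInterval) 2 := by
  simpa using LowDim.of_finrank (E := ℝ × ℝ)
    (⟨fun x => (x.1.1, x.2.1), by fun_prop⟩ : C(unitInterval × unitInterval, ℝ × ℝ))
    (fun x y h => Prod.ext (Subtype.ext (congrArg Prod.fst h)) (Subtype.ext (congrArg Prod.snd h)))

instance (n : ℕ) : CompactSpace (Disk n) := isCompact_iff_compactSpace.1 (isCompact_closedBall _ _)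

instance (n : ℕ) : ContractibleSpace (Disk n) :=
  (convex_closedBall (0 : EuclideanSpace ℝ (Fin n)) 1).contractibleSpace ⟨0, by simp⟩

lemma lowDim_disk (n : ℕ) : LowDim (Disk n) n := by
  simpa using LowDim.of_finrank
    (⟨Subtype.val, continuous_subtype_val⟩ : C(Disk n, EuclideanSpace ℝ (Fin n)))
    Subtype.val_injective

/-- The unit sphere of dimension `n - 1`, the boundary of `Disk n`. -/
abbrev Sph (n : ℕ) : Type := Metric.sphere (0 : EuclideanSpace ℝ (Fin n)) 1

/-- The inclusion of the boundary sphere. -/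
def Sph.toDisk (n : ℕ) : C(Sph n, Disk n) :=
  ⟨fun s => ⟨s.1, Metric.sphere_subset_closedBall s.2⟩, by fun_prop⟩

lemma Sph.norm_eq {n : ℕ} (s : Sph n) : ‖s.1‖ = 1 := mem_sphere_zero_iff_norm.1 s.2

lemma Sph.norm_toDisk {n : ℕ} (s : Sph n) : ‖(Sph.toDisk n s).1‖ = 1 := s.norm_eq

lemma lowDim_sphere (n : ℕ) : LowDim (Sph (n + 1)) n := by
  obtain ⟨v, hv⟩ : ∃ v : EuclideanSpace ℝ (Fin (n + 1)), ‖v‖ = 1 :=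
    ⟨EuclideanSpace.single 0 1, by simp⟩
  refine LowDim.of_injective
    (⟨Subtype.val, continuous_subtype_val⟩ : C(Sph (n + 1), EuclideanSpace ℝ (Fin (n + 1))))
    Subtype.val_injective ?_
  -- away from the pole the sphere is the image of a hyperplane under a smooth map
  have hsub : Set.range (Subtype.val : Sph (n + 1) → EuclideanSpace ℝ (Fin (n + 1))) ⊆
      {v} ∪ Set.range fun w : (Submodule.span ℝ {v})ᗮ => stereoInvFunAux v w.1 := by
    rintro _ ⟨x, rfl⟩
    by_cases hx : x.1 = v
    · exact Or.inl hx
    · exact Or.inr ⟨_, congrArg Subtype.val (stereo_left_inv hv hx)⟩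
  refine (dimH_mono hsub).trans ?_
  rw [dimH_union, dimH_singleton, max_eq_right zero_le]
  have hd : ContDiff ℝ 1 fun w : (Submodule.span ℝ {v})ᗮ => stereoInvFunAux v w.1 :=
    contDiff_stereoInvFunAux.comp (Submodule.span ℝ {v})ᗮ.subtypeL.contDiff
  refine hd.dimH_range_le.trans ?_
  have : Fact (Module.finrank ℝ (EuclideanSpace ℝ (Fin (n + 1))) = n + 1) := ⟨by simp⟩
  rw [Submodule.finrank_orthogonal_span_singleton (n := n) (by rintro rfl; simp at hv)]

/-! ### Extending maps from spheres to disks -/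

/-- Every map from the boundary sphere of the `n`-dimensional disk to `W` extends to the disk. -/
def DiskExtends (W : Type*) [TopologicalSpace W] (n : ℕ) : Prop :=
  ∀ u : C(Sph n, W), ∃ U : C(Disk n, W), U.comp (Sph.toDisk n) = u

section

variable {W : Type*} [TopologicalSpace W]

/-- A null homotopy defines a map on the cone over the sphere, which is the disk. -/
theorem extends_of_nullhomotopic {n : ℕ} (u : C(Sph (n + 1), W)) (hu : u.Nullhomotopic) :
    ∃ U : C(Disk (n + 1), W), U.comp (Sph.toDisk (n + 1)) = u := by
  obtain ⟨y, ⟨h⟩⟩ := hu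
  -- the disk is the quotient of the cylinder by one of its ends
  let c : unitInterval × Sph (n + 1) → Disk (n + 1) := fun x => ⟨(1 - x.1.1) • x.2.1, by
    rw [mem_closedBall_zero_iff, norm_smul, x.2.norm_eq, mul_one,
      Real.norm_of_nonneg (by linarith [x.1.2.2])]
    linarith [x.1.2.1]⟩
  have hcn : ∀ x, ‖(c x).1‖ = 1 - x.1.1 := fun x => by
    change ‖(1 - x.1.1) • x.2.1‖ = _
    rw [norm_smul, x.2.norm_eq, mul_one, Real.norm_of_nonneg (by linarith [x.1.2.2])]
  have hc : Continuous c := by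
    refine Continuous.subtype_mk ?_ _
    fun_prop
  have hsurj : Function.Surjective c := by
    intro d
    by_cases hd : d.1 = 0
    · refine ⟨(1, ⟨EuclideanSpace.single 0 1, by simp⟩), Subtype.ext ?_⟩
      simp [c, hd]
    · refine ⟨(⟨1 - ‖d.1‖, by linarith [d.norm_le], by linarith [norm_nonneg d.1]⟩,
        ⟨‖d.1‖⁻¹ • d.1, ?_⟩), Subtype.ext ?_⟩
      · rw [mem_sphere_zero_iff_norm, norm_smul, norm_inv, norm_norm,
          inv_mul_cancel₀ (norm_ne_zero_iff.2 hd)]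
      · simp [c, smul_smul, mul_inv_cancel₀ (norm_ne_zero_iff.2 hd)]
  have hq : IsQuotientMap (⟨c, hc⟩ : C(_, _)) := hc.isClosedMap.isQuotientMap hc hsurj
  have hfac : Function.FactorsThrough h.toContinuousMap (⟨c, hc⟩ : C(_, _)) := by
    rintro ⟨t, s⟩ ⟨t', s'⟩ hts
    have hts' : (1 - t.1) • s.1 = (1 - t'.1) • s'.1 := congrArg Subtype.val hts
    have ht : t = t' := by
      have h1 := hcn (t, s)
      rw [show c (t, s) = c (t', s') from hts, hcn] at h1
      exact Subtype.ext (by simpa using h1.symm)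
    subst ht
    by_cases ht1 : t = 1
    · subst ht1
      exact (h.apply_one s).trans (h.apply_one s').symm
    · have hne : 1 - t.1 ≠ 0 := fun h0 => ht1 (Subtype.ext (sub_eq_zero.1 h0).symm)
      rw [Subtype.ext (smul_right_injective _ hne hts')]
  refine ⟨hq.lift h.toContinuousMap hfac, ContinuousMap.ext fun s => ?_⟩
  have h2 := DFunLike.congr_fun (hq.lift_comp h.toContinuousMap hfac) (0, s)
  have h3 : c (0, s) = Sph.toDisk (n + 1) s := Subtype.ext (by simp [c, Sph.toDisk])
  calc _ = hq.lift h.toContinuousMap hfac (c (0, s)) := by rw [h3]; rfl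
    _ = h (0, s) := h2
    _ = u s := h.apply_zero s

theorem nullhomotopic_of_extends {n : ℕ} (U : C(Disk n, W)) :
    (U.comp (Sph.toDisk n)).Nullhomotopic := by
  have h := ((id_nullhomotopic (Disk n)).comp_right U).comp_left (Sph.toDisk n)
  exact h

/-- Whether a map from a sphere extends to the disk depends on its homotopy class only. -/
theorem extends_of_homotopic {n : ℕ} {u : C(Sph (n + 1), W)} {U : C(Disk (n + 1), W)}
    (h : u.Homotopic (U.comp (Sph.toDisk (n + 1)))) :
    ∃ U' : C(Disk (n + 1), W), U'.comp (Sph.toDisk (n + 1)) = u := by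
  obtain ⟨y, hy⟩ := nullhomotopic_of_extends U
  exact extends_of_nullhomotopic u ⟨y, h.trans hy⟩

/-! ### Convex bodies as disks -/

/-- A convex body is homeomorphic to a disk, with the boundary corresponding to the sphere. -/
theorem exists_homeomorph_disk {E : Type*} [NormedAddCommGroup E] [NormedSpace ℝ E]
    [FiniteDimensional ℝ E] {n : ℕ} (hn : Module.finrank ℝ E = n) {s : Set E} (hs : Convex ℝ s)
    (hne : (interior s).Nonempty) (hb : Bornology.IsBounded s) (hcl : IsClosed s) :
    ∃ θ : s ≃ₜ Disk n, ∀ x, ‖(θ x).1‖ = 1 ↔ x.1 ∉ interior s := by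
  let e : E ≃L[ℝ] EuclideanSpace ℝ (Fin n) := ContinuousLinearEquiv.ofFinrankEq (by simpa using hn)
  have hcl' : IsClosed (e '' s) := e.toHomeomorph.isClosed_image.2 hcl
  have hint : interior (e '' s) = e '' interior s := (e.toHomeomorph.image_interior s).symm
  obtain ⟨f, hf1, hf2, hf3⟩ := exists_homeomorph_image_interior_closure_frontier_eq_unitBall
    (hs.linear_image e.toLinearMap) (s := e '' s) (by rw [hint]; exact hne.image _)
    (e.lipschitz.isBounded_image hb)
  rw [hcl'.closure_eq] at hf2
  let g : E ≃ₜ EuclideanSpace ℝ (Fin n) := e.toHomeomorph.trans f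
  have hg : g '' s = Metric.closedBall 0 1 := by rw [← hf2, Set.image_image]; rfl
  have hg' : g '' interior s = Metric.ball 0 1 := by rw [← hf1, hint, Set.image_image]; rfl
  refine ⟨(g.image s).trans (Homeomorph.setCongr hg), fun x => ?_⟩
  change ‖g x.1‖ = 1 ↔ _
  have h1 : g x.1 ∈ Metric.closedBall (0 : EuclideanSpace ℝ (Fin n)) 1 := hg ▸ ⟨x.1, x.2, rfl⟩
  rw [mem_closedBall_zero_iff] at h1
  have h2 : x.1 ∈ interior s ↔ ‖g x.1‖ < 1 := by
    rw [← mem_ball_zero_iff, ← hg', g.injective.mem_set_image]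
  rw [h2, not_lt]
  exact ⟨fun h => h.ge, fun h => le_antisymm h1 h⟩

theorem exists_homeomorph_cube (m : ℕ) :
    ∃ θ : (Fin m → unitInterval) ≃ₜ Disk m, ∀ y, ‖(θ y).1‖ = 1 ↔ y ∈ Cube.boundary (Fin m) := by
  have hint : interior (Set.univ.pi fun _ : Fin m => Set.Icc (0 : ℝ) 1) =
      Set.univ.pi fun _ : Fin m => Set.Ioo (0 : ℝ) 1 := by
    rw [interior_pi_set Set.finite_univ]
    simp
  obtain ⟨θ, hθ⟩ := exists_homeomorph_disk (n := m) (by simp)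
    (convex_pi fun (_ : Fin m) _ => convex_Icc (0 : ℝ) 1)
    (by rw [hint]; exact ⟨fun _ => 1 / 2, fun _ _ => by norm_num⟩)
    (Bornology.IsBounded.pi fun _ => Metric.isBounded_Icc 0 1)
    (isClosed_set_pi fun _ _ => isClosed_Icc)
  let c : (Fin m → unitInterval) ≃ₜ (Set.univ.pi fun _ : Fin m => Set.Icc (0 : ℝ) 1) :=
    { toFun := fun y => ⟨fun i => (y i).1, fun i _ => (y i).2⟩
      invFun := fun y i => ⟨y.1 i, y.2 i trivial⟩
      left_inv := fun _ => rfl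
      right_inv := fun _ => rfl
      continuous_toFun := by fun_prop
      continuous_invFun := continuous_pi fun i =>
        ((continuous_apply i).comp continuous_subtype_val).subtype_mk _ }
  refine ⟨c.trans θ, fun y => ?_⟩
  rw [Homeomorph.trans_apply, hθ, hint]
  simp only [Set.mem_univ_pi, Set.mem_Ioo, not_forall, Cube.boundary, Set.mem_ofPred_eq]
  refine exists_congr fun i => ?_
  change ¬ (0 < (y i).1 ∧ (y i).1 < 1) ↔ _
  rw [not_and_or, not_lt, not_lt, Subtype.ext_iff, Subtype.ext_iff]
  exact or_congr ⟨fun h => le_antisymm h (y i).2.1, fun h => h.le⟩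
    ⟨fun h => le_antisymm (y i).2.2 h, fun h => h.ge⟩

theorem exists_homeomorph_prism (n : ℕ) :
    ∃ θ : unitInterval × Disk n ≃ₜ Disk (n + 1),
      ∀ x, ‖(θ x).1‖ = 1 ↔ x.1 = 0 ∨ x.1 = 1 ∨ ‖x.2.1‖ = 1 := by
  have hint : interior (Set.Icc (0 : ℝ) 1 ×ˢ Metric.closedBall (0 : EuclideanSpace ℝ (Fin n)) 1) =
      Set.Ioo (0 : ℝ) 1 ×ˢ Metric.ball (0 : EuclideanSpace ℝ (Fin n)) 1 := by
    rw [interior_prod_eq, interior_Icc, interior_closedBall _ one_ne_zero]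
  obtain ⟨θ, hθ⟩ := exists_homeomorph_disk (n := n + 1) (by simp [add_comm])
    ((convex_Icc (0 : ℝ) 1).prod (convex_closedBall (0 : EuclideanSpace ℝ (Fin n)) 1))
    (by rw [hint]; exact ⟨(1 / 2, 0), by norm_num, by simp⟩)
    ((Metric.isBounded_Icc 0 1).prod Metric.isBounded_closedBall)
    (isClosed_Icc.prod Metric.isClosed_closedBall)
  refine ⟨(Homeomorph.Set.prod _ _).symm.trans θ, fun x => ?_⟩
  rw [Homeomorph.trans_apply, hθ, hint]
  change ¬ ((0 < x.1.1 ∧ x.1.1 < 1) ∧ x.2.1 ∈ Metric.ball 0 1) ↔ _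
  rw [not_and_or, not_and_or, not_lt, not_lt, mem_ball_zero_iff, not_lt, or_assoc, Subtype.ext_iff,
    Subtype.ext_iff]
  exact or_congr ⟨fun h => le_antisymm h x.1.2.1, fun h => h.le⟩ (or_congr
    ⟨fun h => le_antisymm x.1.2.2 h, fun h => h.ge⟩
    ⟨fun h => le_antisymm x.2.norm_le h, fun h => h.ge⟩)

/-- If maps from the `n`-sphere extend to the disk then maps from the boundary of a prism over the
`n`-dimensional disk extend to the prism. -/
theorem DiskExtends.prism {n : ℕ} (hW : DiskExtends W (n + 1)) (g : unitInterval × Disk n → W)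
    (hg : ContinuousOn g {x | x.1 = 0 ∨ x.1 = 1 ∨ ‖x.2.1‖ = 1}) :
    ∃ G : C(unitInterval × Disk n, W), ∀ x, (x.1 = 0 ∨ x.1 = 1 ∨ ‖x.2.1‖ = 1) → G x = g x := by
  obtain ⟨θ, hθ⟩ := exists_homeomorph_prism n
  have hmem : ∀ s : Sph (n + 1), θ.symm (Sph.toDisk _ s) ∈
      {x : unitInterval × Disk n | x.1 = 0 ∨ x.1 = 1 ∨ ‖x.2.1‖ = 1} := fun s =>
    (hθ _).1 (by rw [θ.apply_symm_apply]; exact s.norm_toDisk)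
  obtain ⟨U, hU⟩ := hW ⟨fun s => g (θ.symm (Sph.toDisk _ s)),
    hg.comp_continuous (θ.symm.continuous.comp (Sph.toDisk _).continuous) hmem⟩
  refine ⟨U.comp θ, fun x hx => ?_⟩
  have h1 := (hθ x).2 hx
  have h2 := DFunLike.congr_fun hU ⟨(θ x).1, mem_sphere_zero_iff_norm.2 h1⟩
  have h3 : Sph.toDisk (n + 1) ⟨(θ x).1, mem_sphere_zero_iff_norm.2 h1⟩ = θ x := rfl
  change U (Sph.toDisk _ _) = g (θ.symm (Sph.toDisk _ _)) at h2
  rw [h3, θ.symm_apply_apply] at h2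
  exact h2

/-! ### Cubes and spheres -/

/-- The sphere is the quotient of the cube by its boundary. In terms of the disk, the point `v` is
mapped to the point of the sphere with height `2 ‖v‖ ^ 2 - 1` in the direction of `v`. -/
theorem exists_cube_collapse (m : ℕ) (hm : m ≠ 0) :
    ∃ (κ : C(Fin m → unitInterval, Sph (m + 1))) (e : Sph (m + 1)), Function.Surjective κ ∧
      (∀ y ∈ Cube.boundary (Fin m), κ y = e) ∧
      ∀ y y', κ y = κ y' → y = y' ∨ y ∈ Cube.boundary (Fin m) ∧ y' ∈ Cube.boundary (Fin m) := by
  obtain ⟨θ, hθ⟩ := exists_homeomorph_cube m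
  let E := WithLp 2 (EuclideanSpace ℝ (Fin m) × ℝ)
  let L : E ≃ₗᵢ[ℝ] EuclideanSpace ℝ (Fin (m + 1)) :=
    ((stdOrthonormalBasis ℝ E).reindex (finCongr (by
      rw [(WithLp.linearEquiv 2 ℝ (EuclideanSpace ℝ (Fin m) × ℝ)).finrank_eq]; simp))).repr
  let c : EuclideanSpace ℝ (Fin m) → E := fun v =>
    WithLp.toLp 2 ((2 * √(1 - ‖v‖ ^ 2)) • v, 2 * ‖v‖ ^ 2 - 1)
  have hcn : ∀ v : Disk m, ‖L (c v.1)‖ = 1 := fun v => by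
    have h1 : 0 ≤ 1 - ‖v.1‖ ^ 2 := by nlinarith [v.norm_le, norm_nonneg v.1]
    rw [L.norm_map, ← sq_eq_sq₀ (norm_nonneg _) zero_le_one, WithLp.prod_norm_sq_eq_of_L2]
    change ‖(2 * √(1 - ‖v.1‖ ^ 2)) • v.1‖ ^ 2 + ‖2 * ‖v.1‖ ^ 2 - 1‖ ^ 2 = 1 ^ 2
    simp only [norm_smul, Real.norm_eq_abs, mul_pow, sq_abs, Real.sq_sqrt h1]
    ring
  have hcc : Continuous c := (WithLp.prod_continuous_toLp 2 _ _).comp (by fun_prop)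
  have hθb : ∀ y, ‖(θ y).1‖ ^ 2 = 1 ↔ y ∈ Cube.boundary (Fin m) := fun y => by
    rw [← hθ, pow_eq_one_iff_of_nonneg (norm_nonneg _) two_ne_zero]
  let e : Sph (m + 1) := ⟨L (WithLp.toLp 2 (0, 1)), by
    rw [mem_sphere_zero_iff_norm, L.norm_map, ← sq_eq_sq₀ (norm_nonneg _) zero_le_one,
      WithLp.prod_norm_sq_eq_of_L2]
    simp⟩
  let κ : C(Fin m → unitInterval, Sph (m + 1)) :=
    ⟨fun y => ⟨L (c (θ y).1), mem_sphere_zero_iff_norm.2 (hcn _)⟩, by fun_prop⟩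
  have hκe : ∀ y ∈ Cube.boundary (Fin m), κ y = e := fun y hy => by
    refine Subtype.ext (congrArg L ?_)
    simp only [c, (hθb y).2 hy]
    norm_num
  refine ⟨κ, e, fun s => ?_, hκe, fun y y' h => ?_⟩
  · obtain ⟨⟨a, t⟩, hat⟩ : ∃ p : EuclideanSpace ℝ (Fin m) × ℝ, L (WithLp.toLp 2 p) = s.1 :=
      ⟨WithLp.ofLp (L.symm s.1), L.apply_symm_apply _⟩
    have hn : ‖a‖ ^ 2 + t ^ 2 = 1 := by
      have h1 := WithLp.prod_norm_sq_eq_of_L2 (WithLp.toLp 2 (a, t))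
      rw [← L.norm_map, hat, s.norm_eq] at h1
      simpa using h1.symm
    by_cases ht : t = 1
    · have ha : a = 0 := by
        rw [ht] at hn
        simpa using hn
      obtain ⟨v, hv⟩ : ∃ v : Disk m, ‖v.1‖ = 1 :=
        ⟨⟨EuclideanSpace.single ⟨0, Nat.pos_of_ne_zero hm⟩ 1, by simp⟩, by simp⟩
      refine ⟨θ.symm v, ?_⟩
      rw [hκe _ ((hθ _).1 (by rw [θ.apply_symm_apply]; exact hv))]
      exact Subtype.ext (by rw [← hat, ha, ht])
    · have ht1 : t < 1 := lt_of_le_of_ne (by nlinarith [sq_nonneg ‖a‖]) ht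
      have ht2 : 0 < (1 - t) / 2 := by linarith
      have hs : 0 < 2 * √((1 - t) / 2) := by positivity
      have hv : ‖(2 * √((1 - t) / 2))⁻¹ • a‖ ^ 2 = (1 + t) / 2 := by
        rw [norm_smul, norm_inv, Real.norm_of_nonneg hs.le, mul_pow, inv_pow, mul_pow,
          Real.sq_sqrt ht2.le, show ‖a‖ ^ 2 = (1 - t) * (1 + t) by linarith]
        have : 1 - t ≠ 0 := by linarith
        field_simp
      have hv1 : ‖(2 * √((1 - t) / 2))⁻¹ • a‖ ≤ 1 := by
        rw [← sq_le_one_iff₀ (norm_nonneg _), hv]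
        linarith
      refine ⟨θ.symm ⟨_, mem_closedBall_zero_iff.2 hv1⟩, Subtype.ext ?_⟩
      change L (c (θ (θ.symm _)).1) = s.1
      rw [θ.apply_symm_apply, ← hat]
      simp only [c, hv]
      rw [show 1 - (1 + t) / 2 = (1 - t) / 2 by ring, smul_smul, mul_inv_cancel₀ hs.ne', one_smul,
        show 2 * ((1 + t) / 2) - 1 = t by ring]
  · have h1 : c (θ y).1 = c (θ y').1 := L.injective (congrArg Subtype.val h)
    have h2 : 2 * ‖(θ y).1‖ ^ 2 - 1 = 2 * ‖(θ y').1‖ ^ 2 - 1 :=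
      congrArg (fun p : E => p.snd) h1
    have h3 : (2 * √(1 - ‖(θ y).1‖ ^ 2)) • (θ y).1 = (2 * √(1 - ‖(θ y').1‖ ^ 2)) • (θ y').1 :=
      congrArg (fun p : E => p.fst) h1
    have h4 : ‖(θ y).1‖ ^ 2 = ‖(θ y').1‖ ^ 2 := by linarith
    by_cases hy : ‖(θ y).1‖ ^ 2 = 1
    · exact Or.inr ⟨(hθb y).1 hy, (hθb y').1 (h4 ▸ hy)⟩
    · refine Or.inl (θ.injective (Subtype.ext ?_))
      rw [← h4] at h3
      have h5 : 0 < 1 - ‖(θ y).1‖ ^ 2 := by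
        have : ‖(θ y).1‖ ^ 2 ≤ 1 := (sq_le_one_iff₀ (norm_nonneg _)).2 (θ y).norm_le
        exact sub_pos.2 (lt_of_le_of_ne this hy)
      exact smul_right_injective _ (by positivity) h3

/-- A map from the sphere is nullhomotopic if the map on the cube that it induces is homotopic to
a constant map relative to the boundary. -/
theorem nullhomotopic_of_cube {m : ℕ} {κ : C(Fin m → unitInterval, Sph (m + 1))}
    (hκ : Function.Surjective κ)
    (hκ' : ∀ y y', κ y = κ y' → y = y' ∨ y ∈ Cube.boundary (Fin m) ∧ y' ∈ Cube.boundary (Fin m))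
    (u : C(Sph (m + 1), W)) (w : W)
    (h : (u.comp κ).HomotopicRel (ContinuousMap.const _ w) (Cube.boundary (Fin m))) :
    u.Nullhomotopic := by
  obtain ⟨h⟩ := h
  let c : C(unitInterval × (Fin m → unitInterval), unitInterval × Sph (m + 1)) :=
    (ContinuousMap.id _).prodMap κ
  have hq : IsQuotientMap c := c.continuous.isClosedMap.isQuotientMap c.continuous
    (Function.surjective_id.prodMap hκ)
  have hfac : Function.FactorsThrough h.toContinuousMap c := by
    rintro ⟨t, y⟩ ⟨t', y'⟩ hty
    have h1 : t = t' := congrArg Prod.fst hty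
    subst h1
    rcases hκ' y y' (congrArg Prod.snd hty) with rfl | ⟨hy, hy'⟩
    · rfl
    · exact (h.eq_snd t hy).trans (h.eq_snd t hy').symm
  have key : ∀ t y, hq.lift h.toContinuousMap hfac (t, κ y) = h (t, y) := fun t y =>
    DFunLike.congr_fun (hq.lift_comp h.toContinuousMap hfac) (t, y)
  refine ⟨w, ⟨⟨hq.lift h.toContinuousMap hfac, fun s => ?_, fun s => ?_⟩⟩⟩
  · obtain ⟨y, rfl⟩ := hκ s
    exact (key 0 y).trans (h.apply_zero y)
  · obtain ⟨y, rfl⟩ := hκ s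
    exact (key 1 y).trans (h.apply_one y)

/-- Triviality of the homotopy groups for all base points gives extensions from spheres to disks. -/
theorem diskExtends_of_homotopyGroup {m : ℕ} (hm : m ≠ 0)
    (h : ∀ w : W, Subsingleton (π_ m W w)) : DiskExtends W (m + 1) := by
  obtain ⟨κ, e, hκ, hκe, hκ'⟩ := exists_cube_collapse m hm
  intro u
  refine extends_of_nullhomotopic u (nullhomotopic_of_cube hκ hκ' u (u e) ?_)
  have : Subsingleton (_root_.Quotient (GenLoop.Homotopic.setoid (Fin m) (u e))) := h (u e)
  exact Quotient.exact (Subsingleton.elim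
    (Quotient.mk (GenLoop.Homotopic.setoid (Fin m) (u e))
      ⟨u.comp κ, fun y hy => congrArg u (hκe y hy)⟩)
    (Quotient.mk (GenLoop.Homotopic.setoid (Fin m) (u e)) GenLoop.const))

theorem homotopyGroup_of_diskExtends {m : ℕ} (hm : m ≠ 0) (h : DiskExtends W (m + 1)) (w : W) :
    Subsingleton (π_ m W w) := by
  obtain ⟨κ, e, hκ, hκe, hκ'⟩ := exists_cube_collapse m hm
  have key : ∀ γ : GenLoop (Fin m) W w, GenLoop.Homotopic γ GenLoop.const := by
    intro γ
    have hq : IsQuotientMap κ := κ.continuous.isClosedMap.isQuotientMap κ.continuous hκ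
    have hfac : Function.FactorsThrough γ.1 κ := by
      intro y y' hy
      rcases hκ' y y' hy with rfl | ⟨h1, h2⟩
      · rfl
      · exact (γ.2 y h1).trans (γ.2 y' h2).symm
    obtain ⟨U, hU⟩ := h (hq.lift γ.1 hfac)
    have hUκ : ∀ y, U (Sph.toDisk _ (κ y)) = γ y := fun y =>
      (DFunLike.congr_fun hU (κ y)).trans (DFunLike.congr_fun (hq.lift_comp γ.1 hfac) y)
    -- contract the disk along straight lines to the base point on its boundary
    have hc : ∀ x : unitInterval × (Fin m → unitInterval),
        (1 - x.1.1) • (κ x.2).1 + x.1.1 • e.1 ∈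
          Metric.closedBall (0 : EuclideanSpace ℝ (Fin (m + 1))) 1 := fun x =>
      convex_closedBall 0 1 (Sph.toDisk _ (κ x.2)).2 (Sph.toDisk _ e).2
        (by linarith [x.1.2.2]) x.1.2.1 (by ring)
    have hUe : ∀ y ∈ Cube.boundary (Fin m), U (Sph.toDisk _ e) = γ y := fun y hy => by
      rw [← hκe y hy, hUκ]
    have hw : U (Sph.toDisk _ e) = w := by
      have hy : (fun _ => 0 : Fin m → unitInterval) ∈ Cube.boundary (Fin m) :=
        ⟨⟨0, Nat.pos_of_ne_zero hm⟩, Or.inl rfl⟩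
      rw [hUe _ hy]
      exact γ.2 _ hy
    refine ⟨⟨⟨⟨fun x => U ⟨_, hc x⟩, ?_⟩, fun y => ?_, fun y => ?_⟩, fun t y hy => ?_⟩⟩
    · refine U.continuous.comp (Continuous.subtype_mk ?_ _)
      fun_prop
    · refine Eq.trans (congrArg U (Subtype.ext ?_)) (hUκ y)
      simp [Sph.toDisk]
    · refine Eq.trans (congrArg U (Subtype.ext ?_)) hw
      simp [Sph.toDisk]
    · refine Eq.trans (congrArg U (Subtype.ext ?_)) (hUe y hy)
      simp [Sph.toDisk, hκe y hy, ← add_smul]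
  refine ⟨fun a b => ?_⟩
  induction a using Quotient.ind
  induction b using Quotient.ind
  exact Quotient.sound ((key _).trans (key _).symm)

/-- A map from the circle extends to the disk if the corresponding loop is nullhomotopic. The loop
`ℓ` depends on neither the map nor its target. -/
theorem exists_loop_extends :
    ∃ (e : Sph 2) (ℓ : Path e e), ∀ {W : Type u} [TopologicalSpace W] (u : C(Sph 2, W)),
      (ℓ.map u.continuous).Homotopic (Path.refl (u e)) →
        ∃ U : C(Disk 2, W), U.comp (Sph.toDisk 2) = u := by
  obtain ⟨κ, e, hκ, hκe, hκ'⟩ := exists_cube_collapse 1 one_ne_zero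
  have hb : ∀ t : unitInterval, t = 0 ∨ t = 1 → (fun _ => t) ∈ Cube.boundary (Fin 1) :=
    fun t ht => ⟨0, ht⟩
  refine ⟨e, ⟨⟨fun t => κ fun _ => t, by fun_prop⟩, hκe _ (hb 0 (Or.inl rfl)),
    hκe _ (hb 1 (Or.inr rfl))⟩, fun {W} _ u h => ?_⟩
  obtain ⟨h⟩ := h
  refine extends_of_nullhomotopic u (nullhomotopic_of_cube hκ hκ' u (u e)
    ⟨⟨⟨⟨fun x => h (x.1, x.2 0), by fun_prop⟩, fun y => ?_, fun y => ?_⟩, fun t y hy => ?_⟩⟩)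
  · refine (h.apply_zero (y 0)).trans ?_
    change u (κ fun _ => y 0) = u (κ y)
    congr 2
    ext i
    rw [Subsingleton.elim i 0]
  · exact h.apply_one (y 0)
  · have hy0 : y 0 = 0 ∨ y 0 = 1 := by
      obtain ⟨i, hi⟩ := hy
      rwa [Subsingleton.elim i 0] at hi
    change h (t, y 0) = u (κ y)
    rw [hκe y hy]
    rcases hy0 with h0 | h0 <;> rw [h0]
    · exact h.source t
    · exact h.target t

end

end EquivariantCW

namespace EquivariantCW

/-! ### The point-set topology of `(G, F)`-CW-complexes -/

variable {G : Type u} [Group G] [TopologicalSpace G]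

instance [DiscreteTopology G] (H : Subgroup G) : DiscreteTopology (G ⧸ H) :=
  QuotientGroup.discreteTopology (isOpen_discrete _)

lemma FilteredGSpace.skelBelow_mono (X : FilteredGSpace G) {k n : ℕ} (h : k < n) :
    X.skel k ⊆ X.skelBelow n := by
  cases n with
  | zero => omega
  | succ n => exact X.mono (by omega)

lemma FilteredGSpace.smul_mem_iff (X : FilteredGSpace G) {n : ℕ} {g : G} {x : X.carrier} :
    g • x ∈ X.skel n ↔ x ∈ X.skel n :=
  ⟨fun h => by simpa using X.smul_mem n g⁻¹ _ h, X.smul_mem n g x⟩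

lemma FilteredGSpace.smul_mem_skelBelow (X : FilteredGSpace G) {n : ℕ} {g : G} {x : X.carrier}
    (h : x ∈ X.skelBelow n) : g • x ∈ X.skelBelow n := by
  cases n with
  | zero => exact h
  | succ n => exact X.smul_mem n g x h

lemma FilteredGSpace.stageBelow_eq (X : FilteredGSpace G) (K : Subgroup G) (n : ℕ) :
    stageBelow (fun n => {x : X.fix K | x.1 ∈ X.skel n}) n = {x | x.1 ∈ X.skelBelow n} := by
  cases n <;> rfl

lemma isClosed_of_mem_iff {T : Type*} [TopologicalSpace T] {s t : Set T} (h : IsClosed s)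
    (e : ∀ x, x ∈ t ↔ x ∈ s) : IsClosed t := by
  rwa [Set.ext e]

namespace IsAttachingMap

variable {X : FilteredGSpace G} {n : ℕ} {ι : Type u} {H : ι → Subgroup G}
  {q : Cells H n → X.carrier}

lemma continuous (h : IsAttachingMap X n H q) : Continuous q :=
  continuous_subtype_val.comp (h.quotient.continuous.comp continuous_inr)

lemma continuous_cell (h : IsAttachingMap X n H q) (i : ι) (c : G ⧸ H i) :
    Continuous fun d : Disk n => q ⟨i, c, d⟩ :=
  h.continuous.comp (continuous_sigmaMk.comp (by fun_prop))

lemma interior_mem (h : IsAttachingMap X n H q) {i : ι} {c : G ⧸ H i} {d : Disk n}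
    (hd : ‖d.1‖ < 1) : q ⟨i, c, d⟩ ∈ X.skel n \ X.skelBelow n :=
  h.bijOn.mapsTo (show ¬ ‖d.1‖ = 1 from hd.ne)

lemma mem_skelBelow (h : IsAttachingMap X n H q) {i : ι} {c : G ⧸ H i} {d : Disk n}
    (hd : ‖d.1‖ = 1) : q ⟨i, c, d⟩ ∈ X.skelBelow n :=
  h.boundary_mem (show ‖d.1‖ = 1 from hd)

lemma surj (h : IsAttachingMap X n H q) {x : X.carrier} (hx : x ∈ X.skel n)
    (hx' : x ∉ X.skelBelow n) :
    ∃ (i : ι) (c : G ⧸ H i) (d : Disk n), ‖d.1‖ < 1 ∧ q ⟨i, c, d⟩ = x := by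
  obtain ⟨⟨i, c, d⟩, hd, rfl⟩ := h.bijOn.surjOn ⟨hx, hx'⟩
  exact ⟨i, c, d, d.norm_lt_or_eq.resolve_right hd, rfl⟩

lemma inj (h : IsAttachingMap X n H q) {z z' : Cells H n} (hz : ‖z.2.2.1‖ < 1)
    (hz' : ‖z'.2.2.1‖ < 1) (e : q z = q z') : z = z' :=
  h.bijOn.injOn (show ¬ ‖z.2.2.1‖ = 1 from hz.ne) (show ¬ ‖z'.2.2.1‖ = 1 from hz'.ne) e

/-- Closedness in a stage of the filtration can be tested on the preceding stage and the cells. -/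
lemma isClosed_preimage [DiscreteTopology G] (h : IsAttachingMap X n H q) (C : Set X.carrier)
    (h₁ : IsClosed ((Subtype.val : X.skelBelow n → X.carrier) ⁻¹' C))
    (h₂ : ∀ i c, IsClosed {d : Disk n | q ⟨i, c, d⟩ ∈ C}) :
    IsClosed ((Subtype.val : X.skel n → X.carrier) ⁻¹' C) := by
  rw [← h.quotient.isClosed_preimage, isClosed_sum_iff]
  refine ⟨h₁, isClosed_sigma_iff.2 fun i => ?_⟩
  rw [← isOpen_compl_iff, isOpen_iff_continuous_mem]
  refine continuous_prod_of_discrete_left.2 fun c => ?_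
  have := (h₂ i c).isOpen_compl
  rw [isOpen_iff_continuous_mem] at this
  exact this

/-- The part of a closed subset of the preceding stage that is seen by the boundary of a cell. -/
lemma isClosed_boundary (h : IsAttachingMap X n H q) {C : Set X.carrier}
    (h₁ : IsClosed ((Subtype.val : X.skelBelow n → X.carrier) ⁻¹' C)) (i : ι) (c : G ⧸ H i) :
    IsClosed {d : Disk n | ‖d.1‖ = 1 ∧ q ⟨i, c, d⟩ ∈ C} := by
  have hb : IsClosed {d : Disk n | ‖d.1‖ = 1} :=
    isClosed_eq continuous_subtype_val.norm continuous_const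
  let r : {d : Disk n | ‖d.1‖ = 1} → X.skelBelow n :=
    fun d => ⟨q ⟨i, c, d.1⟩, h.boundary_mem (show _ = _ from d.2)⟩
  have hr : Continuous r := ((h.continuous_cell i c).comp continuous_subtype_val).subtype_mk _
  convert hb.isClosedEmbedding_subtypeVal.isClosedMap _ (h₁.preimage hr) using 1
  ext d
  constructor
  · rintro ⟨hd, hd'⟩
    exact ⟨⟨d, hd⟩, hd', rfl⟩
  · rintro ⟨d, hd, rfl⟩
    exact ⟨d.2, hd⟩

lemma fixed_iff (h : IsAttachingMap X n H q) (K : Subgroup G) {i : ι} {c : G ⧸ H i} {d : Disk n}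
    (hd : ‖d.1‖ < 1) : q ⟨i, c, d⟩ ∈ X.fix K ↔ ∀ k ∈ K, k • c = c := by
  constructor
  · intro hq k hk
    have h1 := hq ⟨k, hk⟩
    change k • q ⟨i, c, d⟩ = _ at h1
    rw [← h.equivariant] at h1
    have h2 := h.inj (z := ⟨i, k • c, d⟩) (z' := ⟨i, c, d⟩) hd hd h1
    simpa using h2
  · intro hc k
    change k.1 • q ⟨i, c, d⟩ = _
    rw [← h.equivariant, hc k.1 k.2]

lemma fixed_of (h : IsAttachingMap X n H q) (K : Subgroup G) {i : ι} {c : G ⧸ H i}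
    (hc : ∀ k ∈ K, k • c = c) (d : Disk n) : q ⟨i, c, d⟩ ∈ X.fix K := by
  intro k
  change k.1 • q ⟨i, c, d⟩ = _
  rw [← h.equivariant, hc k.1 k.2]

end IsAttachingMap

namespace FilteredGSpace.IsCWComplex

variable {X : FilteredGSpace G} {F : Set (Subgroup G)} [DiscreteTopology G]

/-- Closedness can be tested on the cells, inductively over the skeleta. -/
lemma isClosed_of (hX : X.IsCWComplex F) (C : Set X.carrier)
    (step : ∀ (n : ℕ) (ι : Type u) (H : ι → Subgroup G) (q : Cells H n → X.carrier),
      IsAttachingMap X n H q → (∀ i c, IsClosed {d : Disk n | ‖d.1‖ = 1 ∧ q ⟨i, c, d⟩ ∈ C}) →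
      ∀ i c, IsClosed {d : Disk n | q ⟨i, c, d⟩ ∈ C}) : IsClosed C := by
  refine (hX.isClosed_iff C).2 fun n => ?_
  have key : ∀ n, IsClosed ((Subtype.val : X.skelBelow n → X.carrier) ⁻¹' C) →
      IsClosed ((Subtype.val : X.skel n → X.carrier) ⁻¹' C) := fun n h₁ => by
    obtain ⟨ι, H, q, -, hq⟩ := hX.attach n
    exact hq.isClosed_preimage C h₁ (step n ι H q hq (hq.isClosed_boundary h₁))
  induction n with
  | zero =>
    refine key 0 ?_
    have : IsEmpty (X.skelBelow 0) := ⟨fun x => x.2⟩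
    exact isClosed_discrete _
  | succ n ih => exact key _ ih

lemma isClosed_skel (hX : X.IsCWComplex F) (m : ℕ) : IsClosed (X.skel m) := by
  refine hX.isClosed_of _ fun n ι H q hq hb i c => ?_
  rcases le_or_gt n m with hn | hn
  · exact isClosed_of_mem_iff isClosed_univ fun d =>
      iff_of_true (X.mono hn (hq.mem ⟨i, c, d⟩)) trivial
  · refine isClosed_of_mem_iff (hb i c) fun d =>
      ⟨fun h => ⟨d.norm_lt_or_eq.resolve_left fun hd => ?_, h⟩, fun h => h.2⟩
    exact (hq.interior_mem hd).2 (X.skelBelow_mono hn h)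

lemma isClosed_skelBelow (hX : X.IsCWComplex F) : ∀ n, IsClosed (X.skelBelow n)
  | 0 => isClosed_empty
  | n + 1 => hX.isClosed_skel n

lemma t1Space (hX : X.IsCWComplex F) : T1Space X.carrier := by
  refine ⟨fun x => hX.isClosed_of _ fun n ι H q hq hb i c => ?_⟩
  have : {d : Disk n | q ⟨i, c, d⟩ ∈ ({x} : Set X.carrier)} =
      {d : Disk n | ‖d.1‖ = 1 ∧ q ⟨i, c, d⟩ ∈ ({x} : Set X.carrier)} ∪
      {d : Disk n | ‖d.1‖ < 1 ∧ q ⟨i, c, d⟩ ∈ ({x} : Set X.carrier)} := by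
    ext d
    have := d.norm_lt_or_eq
    simp only [Set.mem_union, Set.mem_ofPred_eq]
    tauto
  rw [this]
  refine (hb i c).union (Set.Subsingleton.isClosed ?_)
  rintro d ⟨hd, h1⟩ d' ⟨hd', h1'⟩
  have h2 := hq.inj (z := ⟨i, c, d⟩) (z' := ⟨i, c, d'⟩) hd hd' (h1.trans h1'.symm)
  simpa using h2

lemma isClosed_fix (hX : X.IsCWComplex F) (K : Subgroup G) : IsClosed (X.fix K) := by
  refine hX.isClosed_of _ fun n ι H q hq hb i c => ?_
  by_cases hc : ∀ k ∈ K, k • c = c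
  · exact isClosed_of_mem_iff isClosed_univ fun d => iff_of_true (hq.fixed_of K hc d) trivial
  · refine isClosed_of_mem_iff (hb i c) fun d =>
      ⟨fun h => ⟨d.norm_lt_or_eq.resolve_left fun hd => ?_, h⟩, fun h => h.2⟩
    exact hc ((hq.fixed_iff K hd).1 h)

/-- A compact subset lies in a finite skeleton: otherwise it contains a sequence of points that
leave every skeleton, and the tails of such a sequence are closed. -/
lemma exists_subset_skel (hX : X.IsCWComplex F) (K : Set X.carrier) (hK : IsCompact K) :
    ∃ n, K ⊆ X.skel n := by
  have := hX.t1Space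
  by_contra! h
  choose x hxK hx using fun n => Set.not_subset.1 (h n)
  have hcl : ∀ n, IsClosed (x '' Set.Ici n) := fun n => by
    refine (hX.isClosed_iff _).2 fun m => ?_
    have hfin : (X.skel m ∩ x '' Set.Ici n).Finite := by
      refine ((Set.finite_lt_nat m).image x).subset ?_
      rintro _ ⟨h1, k, -, rfl⟩
      exact ⟨k, not_le.1 fun hk => hx k (X.mono hk h1), rfl⟩
    convert hfin.isClosed.preimage (continuous_subtype_val (p := (· ∈ X.skel m))) using 1
    ext y
    exact ⟨fun h => ⟨y.2, h⟩, fun h => h.2⟩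
  obtain ⟨n, hn⟩ := hK.elim_directed_cover (fun n => (x '' Set.Ici n)ᶜ)
    (fun n => (hcl n).isOpen_compl) (fun y _ => by
      obtain ⟨m, hm⟩ := X.exhaust y
      refine Set.mem_iUnion.2 ⟨m, ?_⟩
      rintro ⟨k, hk, rfl⟩
      exact hx k (X.mono hk hm))
    (directed_of_isDirected_le fun a b hab =>
      Set.compl_subset_compl.2 (Set.image_mono (Set.Ici_subset_Ici.2 hab)))
  exact hn (hxK n) ⟨n, Set.self_mem_Ici, rfl⟩

lemma isClosed_of_subset_skel (hX : X.IsCWComplex F) {n : ℕ} {ι : Type u} {H : ι → Subgroup G}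
    {q : Cells H n → X.carrier} (hq : IsAttachingMap X n H q) (C : Set X.carrier)
    (hC : C ⊆ X.skel n) (h₁ : IsClosed (C ∩ X.skelBelow n))
    (h₂ : ∀ i c, IsClosed {d : Disk n | q ⟨i, c, d⟩ ∈ C}) : IsClosed C := by
  have h₃ : IsClosed ((Subtype.val : X.skelBelow n → X.carrier) ⁻¹' C) := by
    convert h₁.preimage (continuous_subtype_val (p := (· ∈ X.skelBelow n))) using 1
    ext y
    exact ⟨fun h => ⟨h, y.2⟩, fun h => h.1⟩
  convert (hX.isClosed_skel n).isClosedEmbedding_subtypeVal.isClosedMap _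
    (hq.isClosed_preimage C h₃ h₂) using 1
  rw [Subtype.image_preimage_coe, Set.inter_eq_right.2 hC]

/-- The skeleta of a `(G, F)`-CW-complex arise by attaching cells if the action is ignored. -/
lemma cellAttach (hX : X.IsCWComplex F) {n : ℕ} {ι : Type u} {H : ι → Subgroup G}
    {q : Cells H n → X.carrier} (hq : IsAttachingMap X n H q) :
    CellAttach (X.skelBelow n) (X.skel n)
      (fun (j : Σ i, G ⧸ H i) (d : Disk n) => q ⟨j.1, j.2, d⟩) where
  subset := X.skelBelow_subset n
  isClosed := hX.isClosed_skelBelow n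
  cont j := hq.continuous_cell j.1 j.2
  boundary_mem j d hd := hq.boundary_mem (show _ = _ from hd)
  interior_mem j d hd := hq.interior_mem hd
  inj := by
    rintro ⟨i, c⟩ ⟨i', c'⟩ d d' hd hd' h
    have h1 := hq.inj (z := ⟨i, c, d⟩) (z' := ⟨i', c', d'⟩) hd hd' h
    obtain ⟨rfl, h2⟩ := Sigma.mk.inj h1
    obtain ⟨rfl, rfl⟩ := Prod.mk.inj (eq_of_heq h2)
    exact ⟨rfl, rfl⟩
  surj z hz hz' := by
    obtain ⟨i, c, d, hd, h⟩ := hq.surj hz hz'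
    exact ⟨⟨i, c⟩, d, hd, h⟩
  isClosed_of C hC h₁ h₂ := hX.isClosed_of_subset_skel hq C hC h₁ fun i c => h₂ ⟨i, c⟩

/-- The fixed cells exhibit a stage of the filtration of a fixed point space as obtained from the
preceding stage by attaching cells. -/
lemma cellAttach_fix (hX : X.IsCWComplex F) (K : Subgroup G) {n : ℕ} {ι : Type u}
    {H : ι → Subgroup G} {q : Cells H n → X.carrier} (hq : IsAttachingMap X n H q) :
    CellAttach (W := X.fix K) {x | x.1 ∈ X.skelBelow n} {x | x.1 ∈ X.skel n}
      (fun (j : {j : Σ i, G ⧸ H i // ∀ k ∈ K, k • j.2 = j.2}) (d : Disk n) =>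
        ⟨q ⟨j.1.1, j.1.2, d⟩, hq.fixed_of K j.2 d⟩) where
  subset x hx := X.skelBelow_subset n hx
  isClosed := (hX.isClosed_skelBelow n).preimage continuous_subtype_val
  cont j := (hq.continuous_cell j.1.1 j.1.2).subtype_mk _
  boundary_mem j d hd := (hX.cellAttach hq).boundary_mem j.1 d hd
  interior_mem j d hd := (hX.cellAttach hq).interior_mem j.1 d hd
  inj j j' d d' hd hd' h := by
    obtain ⟨h1, h2⟩ := (hX.cellAttach hq).inj j.1 j'.1 d d' hd hd' (congrArg Subtype.val h)
    exact ⟨Subtype.ext h1, h2⟩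
  surj z hz hz' := by
    obtain ⟨⟨i, c⟩, d, hd, h⟩ := (hX.cellAttach hq).surj z.1 hz hz'
    exact ⟨⟨⟨i, c⟩, (hq.fixed_iff K hd).1 (by rw [h]; exact z.2)⟩, d, hd, Subtype.ext h⟩
  isClosed_of C hC h₁ h₂ := by
    have hcl := (hX.isClosed_fix K).isClosedEmbedding_subtypeVal
    rw [hcl.isClosed_iff_image_isClosed] at h₁ ⊢
    have h₁' : IsClosed (Subtype.val '' C ∩ X.skelBelow n) := by
      convert h₁ using 1
      rw [← Set.image_inter_preimage]
      rfl
    refine hX.isClosed_of_subset_skel hq _ ?_ h₁' fun i c => ?_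
    · rintro _ ⟨x, hx, rfl⟩
      exact hC hx
    · by_cases hc : ∀ k ∈ K, k • c = c
      · convert h₂ ⟨⟨i, c⟩, hc⟩ using 1
        ext d
        refine ⟨fun ⟨x, hx, h⟩ => ?_, fun h => ⟨_, h, rfl⟩⟩
        have : x = ⟨q ⟨i, c, d⟩, hq.fixed_of K hc d⟩ := Subtype.ext h
        rw [Set.mem_preimage, ← this]
        exact hx
      · have hd' : ∀ d : Disk n, q ⟨i, c, d⟩ ∈ Subtype.val '' C → ‖d.1‖ = 1 := by
          rintro d ⟨x, hx, h⟩
          refine d.norm_lt_or_eq.resolve_left fun hd => hc ((hq.fixed_iff K hd).1 ?_)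
          rw [← h]
          exact x.2
        exact isClosed_of_mem_iff (hq.isClosed_boundary (h₁'.preimage
          (continuous_subtype_val (p := (· ∈ X.skelBelow n)))) i c) fun d => ⟨fun h => ⟨hd' d h, h,
          hq.boundary_mem (show _ = _ from hd' d h)⟩, fun h => h.2.1⟩

theorem isCellFiltration (hX : X.IsCWComplex F) (K : Subgroup G) :
    IsCellFiltration (W := X.fix K) (fun n => {x | x.1 ∈ X.skel n}) where
  mono _ _ h _ hx := X.mono h hx
  compact C hC := by
    obtain ⟨n, hn⟩ := hX.exists_subset_skel _ (hC.image continuous_subtype_val)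
    exact ⟨n, fun x hx => hn ⟨x, hx, rfl⟩⟩
  attach n := by
    obtain ⟨ι, H, q, -, hq⟩ := hX.attach n
    rw [X.stageBelow_eq]
    exact ⟨_, _, hX.cellAttach_fix K hq⟩

end FilteredGSpace.IsCWComplex

end EquivariantCW

namespace EquivariantCW

/-! ### The fundamental groupoid of a skeleton -/

lemma exists_lift_of_isEmbedding {P V W : Type*} [TopologicalSpace P] [TopologicalSpace V]
    [TopologicalSpace W] {e : V → W} (he : IsEmbedding e) (f : C(P, W))
    (hf : ∀ x, f x ∈ Set.range e) : ∃ g : C(P, V), ∀ x, e (g x) = f x := by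
  choose g hg using hf
  exact ⟨⟨g, he.continuous_iff.2 (by rw [show e ∘ g = f from funext hg]; exact f.continuous)⟩, hg⟩

/-- The inclusion of the second stage of a cellular filtration is bijective on homotopy classes of
paths. -/
theorem IsCellFiltration.bijective_map {V W : Type u} [TopologicalSpace V] [TopologicalSpace W]
    {S : ℕ → Set W} (hS : IsCellFiltration S) (e : C(V, W)) (he : IsEmbedding e)
    (hr : Set.range e = S 2) (x y : V) :
    Function.Bijective fun p : Path.Homotopic.Quotient x y => p.map e := by
  constructor
  · intro p p' h
    obtain ⟨p, rfl⟩ := Path.Homotopic.Quotient.mk_surjective p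
    obtain ⟨p', rfl⟩ := Path.Homotopic.Quotient.mk_surjective p'
    obtain ⟨h⟩ := Path.Homotopic.Quotient.exact (p := p.map e.continuous)
      (q := p'.map e.continuous) h
    obtain ⟨k, ⟨hk⟩, hk'⟩ := hS.approx lowDim_square h.toContinuousMap
    obtain ⟨g, hg⟩ := exists_lift_of_isEmbedding he k (by rwa [hr])
    -- on the boundary of the square nothing has been changed
    have hb : ∀ x v, h x = e v → g x = v := fun x v hx => he.injective <| by
      rw [hg, ← hx]
      refine (hk.fst_eq_snd ?_).symm
      change h x ∈ S 2
      rw [hx, ← hr]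
      exact ⟨v, rfl⟩
    refine Path.Homotopic.Quotient.eq.2 ⟨⟨⟨g, fun t => ?_, fun t => ?_⟩, fun t s hs => ?_⟩⟩
    · exact hb _ _ (h.apply_zero t)
    · exact hb _ _ (h.apply_one t)
    · refine hb _ _ ?_
      exact h.prop t s hs
  · intro p
    obtain ⟨p, rfl⟩ := Path.Homotopic.Quotient.mk_surjective p
    obtain ⟨k, ⟨hk⟩, hk'⟩ := hS.approx (lowDim_unitInterval.mono one_le_two) p.toContinuousMap
    obtain ⟨g, hg⟩ := exists_lift_of_isEmbedding he k (by rwa [hr])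
    have hb : ∀ t v, p t = e v → g t = v ∧ t ∈ p.toContinuousMap ⁻¹' S 2 := fun t v ht => by
      have h1 : p t ∈ S 2 := by
        rw [ht, ← hr]
        exact ⟨v, rfl⟩
      refine ⟨he.injective ?_, h1⟩
      rw [hg, ← ht]
      exact (hk.fst_eq_snd h1).symm
    refine ⟨Path.Homotopic.Quotient.mk ⟨g, (hb _ _ p.source).1, (hb _ _ p.target).1⟩,
      Path.Homotopic.Quotient.eq.2 ⟨⟨⟨hk.symm.toContinuousMap, fun t => ?_, fun t => ?_⟩,
        fun t s hs => ?_⟩⟩⟩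
    · exact (hk.symm.apply_zero t).trans (hg t).symm
    · exact hk.symm.apply_one t
    · have hs' : s ∈ p.toContinuousMap ⁻¹' S 2 := by
        rcases hs with rfl | rfl
        · exact (hb _ _ p.source).2
        · exact (hb _ _ p.target).2
      exact (hk.symm.prop t s hs').trans (hg s).symm

/-- A functor that is bijective on objects and on morphisms has a strict inverse. -/
theorem exists_inverse_of_bijective {C D : Type u} [Category.{u} C] [Category.{u} D] (f : C ⥤ D)
    (hobj : Function.Bijective f.obj)
    (hmap : ∀ x y : C, Function.Bijective fun p : x ⟶ y => f.map p) :
    ∃ g : D ⥤ C, f ⋙ g = 𝟭 C ∧ g ⋙ f = 𝟭 D := by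
  choose b hb using hobj.2
  have hb' : ∀ x, b (f.obj x) = x := fun x => hobj.1 (hb _)
  choose m hm using fun x y => (hmap x y).2
  replace hm : ∀ x y p, f.map (m x y p) = p := hm
  let g : D ⥤ C :=
    { obj := b
      map := fun {x y} p => m _ _ (eqToHom (hb x) ≫ p ≫ eqToHom (hb y).symm)
      map_id := fun x => (hmap _ _).1 (by
        dsimp only
        rw [hm]
        simp)
      map_comp := fun p q => (hmap _ _).1 (by
        dsimp only
        rw [f.map_comp, hm, hm, hm]
        simp) }
  refine ⟨g, ?_, ?_⟩
  · refine CategoryTheory.Functor.ext (fun x => hb' x) fun x y p => (hmap _ _).1 ?_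
    change f.map (m _ _ _) = f.map (eqToHom _ ≫ p ≫ eqToHom _)
    rw [hm, f.map_comp, f.map_comp, eqToHom_map, eqToHom_map]
  · exact CategoryTheory.Functor.ext (fun x => hb x) fun x y p => hm _ _ _

theorem isIso_of_bijective {C D : Type u} [Groupoid.{u} C] [Groupoid.{u} D] (f : C ⥤ D)
    (hobj : Function.Bijective f.obj)
    (hmap : ∀ x y : C, Function.Bijective fun p : x ⟶ y => f.map p) :
    IsIso (show Grpd.of C ⟶ Grpd.of D from f) := by
  obtain ⟨g, h₁, h₂⟩ := exists_inverse_of_bijective f hobj hmap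
  exact ⟨⟨g, h₁, h₂⟩⟩

variable {G : Type u} [Group G] [TopologicalSpace G]

/-- The inclusion of the two-skeleton induces an isomorphism of fundamental functors, by cellular
approximation of paths and of homotopies between paths. -/
theorem isIso_inducedTransf_skeletonIncl [DiscreteTopology G] {F : Set (Subgroup G)}
    {X : FilteredGSpace G} (hX : X.IsCWComplex F) : IsIso (inducedTransf F (X.skeletonIncl 2)) := by
  have : ∀ H, IsIso ((inducedTransf F (X.skeletonIncl 2)).app H) := fun H => by
    let e : C((X.skeleton 2).fix H.unop.grp, X.fix H.unop.grp) :=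
      (fixMap (X.skeletonIncl 2) H.unop.grp).toMap
    have he : IsEmbedding e := by
      refine IsEmbedding.of_comp e.continuous continuous_subtype_val ?_
      exact (IsEmbedding.subtypeVal (p := (· ∈ X.skel 2))).comp
        (IsEmbedding.subtypeVal (p := (· ∈ (X.skeleton 2).fix H.unop.grp)))
    have hr : Set.range e = {x | x.1 ∈ X.skel 2} := by
      ext x
      constructor
      · rintro ⟨y, rfl⟩
        exact y.1.2
      · intro hx
        exact ⟨⟨⟨x.1, hx⟩, fun h => Subtype.ext (x.2 h)⟩, rfl⟩
    refine isIso_of_bijective (fixMap (X.skeletonIncl 2) H.unop.grp).grpoidMap ⟨?_, ?_⟩ ?_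
    · intro x y h
      exact Subtype.ext (he.injective (congrArg Subtype.val h))
    · intro y
      obtain ⟨x, hx⟩ : y.1 ∈ Set.range e := by
        rw [hr]
        exact X.mono (Nat.zero_le 2) y.2
      refine ⟨⟨x, ?_⟩, Subtype.ext hx⟩
      have h1 := y.2
      rw [← hx] at h1
      exact h1
    · intro x y
      have hb := (hX.isCellFiltration H.unop.grp).bijective_map e he hr x.1 y.1
      constructor
      · intro p p' h
        exact InducedCategory.hom_ext (hb.1 (congrArg (fun k => k.hom) h))
      · intro p
        obtain ⟨k, hk⟩ := hb.2 p.hom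
        exact ⟨InducedCategory.homMk k, InducedCategory.hom_ext hk⟩
  exact NatIso.isIso_of_isIso_app _

lemma inducedTransf_comp (F : Set (Subgroup G)) {X Y Z : FilteredGSpace G} (f : X ⟶ Y)
    (g : Y ⟶ Z) : inducedTransf F (f ≫ g) = inducedTransf F f ≫ inducedTransf F g := by
  refine NatTrans.ext (funext fun H => ?_)
  exact restrictedFundamentalGroupoid.map_comp (fixMap f H.unop.grp) (fixMap g H.unop.grp)

lemma inducedTransf_id (F : Set (Subgroup G)) (X : FilteredGSpace G) :
    inducedTransf F (𝟙 X) = 𝟙 _ := by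
  refine NatTrans.ext (funext fun H => ?_)
  exact restrictedFundamentalGroupoid.map_id (fixedPair X H.unop.grp)

lemma isIso_inducedTransf (F : Set (Subgroup G)) {X Y : FilteredGSpace G} (f : X ≅ Y) :
    IsIso (inducedTransf F f.hom) :=
  ⟨⟨inducedTransf F f.inv, by rw [← inducedTransf_comp, f.hom_inv_id, inducedTransf_id],
    by rw [← inducedTransf_comp, f.inv_hom_id, inducedTransf_id]⟩⟩

theorem isIso_inducedTransf_incl [DiscreteTopology G] {F : Set (Subgroup G)} {X : FilteredGSpace G}
    (B : UniversalSpace F X) : IsIso (inducedTransf F B.incl) := by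
  have := isIso_inducedTransf F B.twoSkeleton
  have := isIso_inducedTransf_skeletonIncl B.isCWComplex
  rw [UniversalSpace.incl, inducedTransf_comp]
  infer_instance

end EquivariantCW

namespace EquivariantCW

/-! ### Edges generate the fundamental groupoid -/

/-- The class of a path as a morphism of the fundamental groupoid. -/
abbrev pathClass {W : Type*} [TopologicalSpace W] {x y : W} (p : Path x y) :
    (⟨x⟩ : FundamentalGroupoid W) ⟶ ⟨y⟩ := Path.Homotopic.Quotient.mk p

section

variable {W : Type*} [TopologicalSpace W]

lemma pathClass_refl (x : W) : pathClass (Path.refl x) = 𝟙 _ := rfl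

/-- Paths that agree as functions have the same class, up to the identification of end points. -/
lemma pathClass_eq_of_apply {x y x' y' : W} (p : Path x y) (p' : Path x' y')
    (h : ∀ t, p t = p' t) : ∃ (hx : (⟨x⟩ : FundamentalGroupoid W) = ⟨x'⟩)
      (hy : (⟨y'⟩ : FundamentalGroupoid W) = ⟨y⟩),
      pathClass p = eqToHom hx ≫ pathClass p' ≫ eqToHom hy := by
  obtain rfl : x = x' := by rw [← p.source, h, p'.source]
  obtain rfl : y = y' := by rw [← p.target, h, p'.target]
  obtain rfl : p = p' := Path.ext (funext h)
  exact ⟨rfl, rfl, by simp⟩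

lemma exists_eqToHom_of_const {x y : W} (p : Path x y) (h : ∀ t, p t = x) :
    ∃ hx : (⟨x⟩ : FundamentalGroupoid W) = ⟨y⟩, pathClass p = eqToHom hx := by
  obtain ⟨hx, hy, e⟩ := pathClass_eq_of_apply p (Path.refl x) h
  exact ⟨hy, by rw [e, pathClass_refl]; simp⟩

end

/-- The point of the one-dimensional disk with coordinate `2 t - 1`. -/
noncomputable def segmentPoint (t : unitInterval) : Disk 1 :=
  ⟨EuclideanSpace.single 0 (2 * t.1 - 1), by
    rw [mem_closedBall_zero_iff, PiLp.norm_single, Real.norm_eq_abs, abs_le]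
    constructor <;> linarith [t.2.1, t.2.2]⟩

lemma norm_segmentPoint_zero : ‖(segmentPoint 0).1‖ = 1 := by simp [segmentPoint]

lemma norm_segmentPoint_one : ‖(segmentPoint 1).1‖ = 1 := by
  simp [segmentPoint]
  norm_num

/-- The path that runs through the one-dimensional disk from one end to the other. -/
noncomputable def segmentPath : Path (segmentPoint 0) (segmentPoint 1) where
  toFun := segmentPoint
  continuous_toFun := by
    refine Continuous.subtype_mk ?_ _
    have : Continuous fun t : unitInterval =>
        WithLp.toLp 2 (Pi.single (M := fun _ : Fin 1 => ℝ) 0 (2 * t.1 - 1)) := by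
      refine (PiLp.continuous_toLp 2 _).comp ?_
      exact (continuous_single (A := fun _ : Fin 1 => ℝ) 0).comp (by fun_prop)
    exact this
  source' := rfl
  target' := rfl

lemma eq_segmentPoint_of_norm {d : Disk 1} (hd : ‖d.1‖ = 1) :
    d = segmentPoint 0 ∨ d = segmentPoint 1 := by
  have h1 : |d.1 0| = 1 := by
    rw [EuclideanSpace.norm_eq] at hd
    simpa [Real.sqrt_sq_eq_abs] using hd
  rcases eq_or_eq_neg_of_abs_eq h1 with h | h
  · right
    ext i
    rw [Subsingleton.elim i 0, h]
    simp [segmentPoint]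
    norm_num
  · left
    ext i
    rw [Subsingleton.elim i 0, h]
    simp [segmentPoint]

section

variable {W : Type u} [TopologicalSpace W]

/-- A property of path classes that is closed under composition and inversion, that is satisfied
by the identities at the points of `A` and by the one-cells `q j`. -/
structure IsEdgeClosed (A : Set W) {J : Type u} (q : J → C(Disk 1, W))
    (Q : ∀ ⦃x y : FundamentalGroupoid W⦄, (x ⟶ y) → Prop) : Prop where
  id : ∀ x : FundamentalGroupoid W, x.as ∈ A → Q (𝟙 x)
  comp : ∀ {x y z : FundamentalGroupoid W} (p : x ⟶ y) (p' : y ⟶ z), Q p → Q p' → Q (p ≫ p')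
  inv : ∀ {x y : FundamentalGroupoid W} (p : x ⟶ y), Q p → Q (Groupoid.inv p)
  edge : ∀ j, Q (pathClass (segmentPath.map (q j).continuous))

/-- A class of paths from a point of `A` to a point `z`, to serve as standard connection of `z`
with `A`: the constant path if `z` is in `A`, a path inside a cell otherwise. -/
def IsTail (A : Set W) {J : Type u} (q : J → C(Disk 1, W)) {a z : FundamentalGroupoid W}
    (m : a ⟶ z) : Prop :=
  (∃ h : a = z, z.as ∈ A ∧ m = eqToHom h) ∨
  ∃ (j : J) (x d : FundamentalGroupoid (Disk 1)) (ha : a = (FundamentalGroupoid.map (q j)).obj x)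
    (hz : (FundamentalGroupoid.map (q j)).obj d = z) (n : x ⟶ d), ‖x.as.1‖ = 1 ∧ ‖d.as.1‖ < 1 ∧
      m = eqToHom ha ≫ (FundamentalGroupoid.map (q j)).map n ≫ eqToHom hz

lemma conj_eqToHom_of {C : Type*} [Category C] {Q : ∀ ⦃x y : C⦄, (x ⟶ y) → Prop} {x y x' y' : C}
    (h : x' = x) (h' : y = y') (p : x ⟶ y) (hp : Q p) : Q (eqToHom h ≫ p ≫ eqToHom h') := by
  subst h h'
  simpa using hp

lemma functor_map_groupoidInv {C D : Type*} [Groupoid C] [Groupoid D] (f : C ⥤ D) {x y : C}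
    (p : x ⟶ y) : f.map (Groupoid.inv p) = Groupoid.inv (f.map p) := by
  simp [Groupoid.inv_eq_inv]

namespace IsEdgeClosed

variable {A Z : Set W} {J : Type u} {q : J → C(Disk 1, W)}
  {Q : ∀ ⦃x y : FundamentalGroupoid W⦄, (x ⟶ y) → Prop}

lemma eqToHom (hQ : IsEdgeClosed A q Q) {x y : FundamentalGroupoid W} (h : x = y)
    (hx : x.as ∈ A) : Q (eqToHom h) := by
  subst h
  exact hQ.id x hx

/-- Paths inside a cell between boundary points. -/
lemma cell (hQ : IsEdgeClosed A q Q) (hA : ∀ j d, ‖d.1‖ = 1 → q j d ∈ A) (j : J)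
    {x y : FundamentalGroupoid (Disk 1)} (hx : ‖x.as.1‖ = 1) (hy : ‖y.as.1‖ = 1) (p : x ⟶ y) :
    Q ((FundamentalGroupoid.map (q j)).map p) := by
  have hsub : ∀ {x y : FundamentalGroupoid (Disk 1)} (p p' : x ⟶ y), p = p' := fun p p' =>
    @Subsingleton.elim (Path.Homotopic.Quotient _ _) _ p p'
  obtain ⟨x⟩ := x
  obtain ⟨y⟩ := y
  have hid : ∀ (x : Disk 1), ‖x.1‖ = 1 → ∀ p : (⟨x⟩ : FundamentalGroupoid (Disk 1)) ⟶ ⟨x⟩,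
      Q ((FundamentalGroupoid.map (q j)).map p) := fun x hx p => by
    rw [hsub p (𝟙 _), CategoryTheory.Functor.map_id]
    exact hQ.id _ (hA j x hx)
  rcases eq_segmentPoint_of_norm hx with rfl | rfl <;>
    rcases eq_segmentPoint_of_norm hy with rfl | rfl
  · exact hid _ hx p
  · rw [hsub p (pathClass segmentPath)]
    exact hQ.edge j
  · rw [hsub p (Groupoid.inv (pathClass segmentPath)), Groupoid.inv_eq_inv, Functor.map_inv,
      ← Groupoid.inv_eq_inv]
    exact hQ.inv _ (hQ.edge j)
  · exact hid _ hx p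

/-- A morphism between arbitrary points whose composites with standard connections of the end points
to `A` have the property `Q`. -/
def Good (A : Set W) (q : J → C(Disk 1, W))
    (Q : ∀ ⦃x y : FundamentalGroupoid W⦄, (x ⟶ y) → Prop) {z z' : FundamentalGroupoid W}
    (p : z ⟶ z') : Prop :=
  ∀ ⦃a a' : FundamentalGroupoid W⦄ (m : a ⟶ z) (m' : a' ⟶ z'), IsTail A q m → IsTail A q m' →
    Q (m ≫ p ≫ Groupoid.inv m')

lemma exists_isTail (h : CellAttach A Z fun j => q j) {z : W} (hz : z ∈ Z) :
    ∃ (a : FundamentalGroupoid W) (m : a ⟶ ⟨z⟩), IsTail A q m := by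
  by_cases hzA : z ∈ A
  · exact ⟨⟨z⟩, 𝟙 _, Or.inl ⟨rfl, hzA, rfl⟩⟩
  · obtain ⟨j, d, hd, rfl⟩ := h.surj z hz hzA
    obtain ⟨n⟩ : Nonempty (Path (segmentPoint 0) d) := PathConnectedSpace.joined _ _
    exact ⟨_, (FundamentalGroupoid.map (q j)).map (pathClass n), Or.inr ⟨j, ⟨segmentPoint 0⟩, ⟨d⟩,
      rfl, rfl, pathClass n, norm_segmentPoint_zero, hd,
      ((Category.id_comp _).trans (Category.comp_id _)).symm⟩⟩

lemma good_comp (hQ : IsEdgeClosed A q Q) (h : CellAttach A Z fun j => q j)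
    {x y z : FundamentalGroupoid W} {p : x ⟶ y} {p' : y ⟶ z} (hy : y.as ∈ Z) (hp : Good A q Q p)
    (hp' : Good A q Q p') : Good A q Q (p ≫ p') := by
  intro a a'' m m'' hm hm''
  obtain ⟨a', m', hm'⟩ := exists_isTail h hy
  have := hQ.comp _ _ (hp m m' hm hm') (hp' m' m'' hm' hm'')
  simpa [Groupoid.inv_eq_inv] using this

/-- The standard connection of a point in the interior of a cell. -/
lemma isTail_cell (h : CellAttach A Z fun j => q j) {j : J} {d : Disk 1} (hd : ‖d.1‖ < 1)
    {a : FundamentalGroupoid W} {m : a ⟶ ⟨q j d⟩} (hm : IsTail A q m) :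
    ∃ (x : FundamentalGroupoid (Disk 1)) (ha : a = (FundamentalGroupoid.map (q j)).obj x)
      (n : x ⟶ ⟨d⟩), ‖x.as.1‖ = 1 ∧
        m = CategoryTheory.eqToHom ha ≫ (FundamentalGroupoid.map (q j)).map n := by
  rcases hm with ⟨-, hA, -⟩ | ⟨j', x, ⟨d'⟩, ha, hz, n, hx, hd', e⟩
  · exact absurd hA (h.interior_mem j d hd).2
  · obtain ⟨rfl, rfl⟩ := h.inj _ _ _ _ hd' hd (congrArg FundamentalGroupoid.as hz)
    exact ⟨x, ha, n, hx, e.trans (congrArg (_ ≫ ·) (Category.comp_id _))⟩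

lemma isTail_of_mem (h : CellAttach A Z fun j => q j) {z : W} (hz : z ∈ A)
    {a : FundamentalGroupoid W} {m : a ⟶ ⟨z⟩} (hm : IsTail A q m) :
    ∃ e : a = ⟨z⟩, m = CategoryTheory.eqToHom e := by
  rcases hm with ⟨e, -, he⟩ | ⟨j', x, d', ha, hz', n, hx, hd', e⟩
  · exact ⟨e, he⟩
  · have h1 : q j' d'.as = z := congrArg FundamentalGroupoid.as hz'
    exact absurd hz (h1 ▸ (h.interior_mem j' d'.as hd').2)

/-- Paths in the interior of a cell are good. -/
lemma good_cell (hQ : IsEdgeClosed A q Q) (h : CellAttach A Z fun j => q j) (j : J)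
    {d d' : Disk 1} (hd : ‖d.1‖ < 1) (hd' : ‖d'.1‖ < 1) (p : Path d d') :
    Good A q Q (pathClass (p.map (q j).continuous)) := by
  intro a a' m m' hm hm'
  obtain ⟨x, rfl, n, hx, rfl⟩ := isTail_cell h hd hm
  obtain ⟨x', rfl, n', hx', rfl⟩ := isTail_cell h hd' hm'
  have := hQ.cell h.boundary_mem j hx hx' (n ≫ pathClass p ≫ Groupoid.inv n')
  simp only [Functor.map_comp, functor_map_groupoidInv] at this
  simp only [eqToHom_refl, Category.id_comp]
  exact this

/-- Paths that avoid the centres of the cells are good: the radial motion pushes them to `A`. -/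
lemma good_radial (hQ : IsEdgeClosed A q Q) (h : CellAttach A Z fun j => q j)
    (hA : ∀ C ⊆ A, IsClosed C) {z z' : W} (p : Path z z')
    (hp : ∀ t, p t ∈ A ∨ ∃ j d, 1 / 4 ≤ ‖d.1‖ ∧ ‖d.1‖ < 1 ∧ q j d = p t) :
    Good A q Q (pathClass p) := by
  have hδ : (0 : ℝ) < 1 / 4 := by norm_num
  obtain ⟨M, hM, hMA, hMq⟩ := h.exists_motion (pushMotion 1 (1 / 4) hδ)
    (pushMotion_boundary hδ (by norm_num))
  let V : Set W := {w | w ∈ A ∨ ∃ j d, 1 / 4 ≤ ‖d.1‖ ∧ ‖d.1‖ < 1 ∧ q j d = w}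
  have hVZ : V ⊆ Z := by
    rintro w (hw | ⟨j, d, -, -, rfl⟩)
    · exact h.subset hw
    · exact h.mem j d
  have hM0 : ∀ w ∈ V, M w (0, 0) = w := by
    rintro w (hw | ⟨j, d, -, -, rfl⟩)
    · exact hMA w hw _
    · rw [hMq, pushMotion_zero]
  have hone : ∀ d : Disk 1, 1 / 4 ≤ ‖d.1‖ → ‖(pushMotion 1 (1 / 4) hδ ((1, 0), d)).1‖ = 1 :=
    fun d hd => norm_pushMotion_one hδ 0 d (by simpa [pushVec] using hd)
  have hM1 : ∀ w ∈ V, M w (1, 0) ∈ A := by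
    rintro w (hw | ⟨j, d, hd, -, rfl⟩)
    · rwa [hMA w hw _]
    · rw [hMq]
      exact h.boundary_mem _ _ (hone d hd)
  have hMV : Continuous fun w : V => M w.1 :=
    hM.comp_continuous continuous_subtype_val fun w => hVZ w.2
  let f : C(V, W) := ⟨Subtype.val, continuous_subtype_val⟩
  let g : C(V, W) := ⟨fun w => M w.1 (1, 0), hMV.eval continuous_const⟩
  let H : f.Homotopy g :=
    { toFun := fun x => M x.2.1 (x.1, 0)
      continuous_toFun := (hMV.comp continuous_snd).eval (by fun_prop)
      map_zero_left := fun w => hM0 w.1 w.2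
      map_one_left := fun w => rfl }
  -- the standard connections followed by the radial paths
  have hray : ∀ (w : V) (a : FundamentalGroupoid W) (m : a ⟶ ⟨w.1⟩), IsTail A q m →
      Q (m ≫ pathClass (H.evalAt w)) := by
    rintro ⟨w, hw | ⟨j, d, hd, hd', rfl⟩⟩ a m hm
    · obtain ⟨rfl, rfl⟩ := isTail_of_mem h hw hm
      obtain ⟨e, he⟩ := exists_eqToHom_of_const (H.evalAt ⟨w, Or.inl hw⟩) fun t => hMA w hw _
      have he' : pathClass (H.evalAt ⟨w, Or.inl hw⟩) = CategoryTheory.eqToHom e := he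
      simp only [eqToHom_refl]
      rw [he']
      exact hQ.comp _ _ (hQ.id _ hw) (hQ.eqToHom e hw)
    · obtain ⟨x, rfl, n, hx, rfl⟩ := isTail_cell h hd' hm
      let r : Path d (pushMotion 1 (1 / 4) hδ ((1, 0), d)) :=
        { toFun := fun t => pushMotion 1 (1 / 4) hδ ((t, 0), d)
          continuous_toFun := by fun_prop
          source' := pushMotion_zero hδ 0 d
          target' := rfl }
      obtain ⟨e₁, e₂, he⟩ := pathClass_eq_of_apply (H.evalAt ⟨q j d, Or.inr ⟨j, d, hd, hd', rfl⟩⟩)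
        (r.map (q j).continuous) fun t => hMq j d (t, 0)
      have := conj_eqToHom_of rfl e₂ _
        (hQ.cell h.boundary_mem j hx (y := ⟨_⟩) (hone d hd) (n ≫ pathClass r))
      have he' : pathClass (H.evalAt ⟨q j d, Or.inr ⟨j, d, hd, hd', rfl⟩⟩) =
        CategoryTheory.eqToHom e₁ ≫ pathClass (r.map (q j).continuous) ≫
          CategoryTheory.eqToHom e₂ := he
      simp only [eqToHom_refl, Category.id_comp]
      simp only [eqToHom_refl, Category.id_comp, Functor.map_comp] at this
      erw [he', eqToHom_refl, Category.id_comp]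
      exact (congrArg (fun k => Q k) (Category.assoc _ _ _)).mp this
  have hz : z ∈ V := by
    have := hp 0
    rwa [p.source] at this
  have hz' : z' ∈ V := by
    have := hp 1
    rwa [p.target] at this
  obtain ⟨p', hp'⟩ : ∃ p' : Path (⟨z, hz⟩ : V) ⟨z', hz'⟩,
      ∀ t, (p' t).1 = p t :=
    ⟨⟨⟨fun t => ⟨p t, hp t⟩, by fun_prop⟩, Subtype.ext p.source, Subtype.ext p.target⟩,
      fun t => rfl⟩
  have hpp : pathClass p = pathClass (p'.map f.continuous) :=
    congrArg _ (Path.ext (funext fun t => (hp' t).symm))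
  -- after the motion the path lies in the discrete subspace `A`, hence it is constant
  have hconst : ∀ t, g (p' t) = g (p' 0) := by
    let k : C(unitInterval, W) := ⟨fun t => g (p' t), by fun_prop⟩
    have hkA : ∀ t, k t ∈ A := fun t => hM1 _ (p' t).2
    have hcl : IsClopen (k ⁻¹' {k 0}) := by
      refine ⟨(hA _ (by simpa using hkA 0)).preimage k.continuous, ?_⟩
      rw [← isClosed_compl_iff]
      refine isClosed_of_mem_iff ((hA (A \ {k 0}) Set.sdiff_subset).preimage k.continuous)
        fun t => ?_
      exact ⟨fun ht => ⟨hkA t, ht⟩, fun ht => ht.2⟩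
    rcases isClopen_iff.1 hcl with h0 | h0
    · exact absurd (show (0 : unitInterval) ∈ k ⁻¹' {k 0} from rfl)
        (by rw [h0]; exact Set.notMem_empty _)
    · intro t
      exact (show t ∈ k ⁻¹' {k 0} by rw [h0]; trivial)
  obtain ⟨e, he⟩ := exists_eqToHom_of_const (p'.map g.continuous) fun t =>
    (hconst t).trans (congrArg g p'.source)
  have hsq : pathClass p ≫ (pathClass (H.evalAt ⟨z', hz'⟩) :
      FundamentalGroupoid.mk z' ⟶ ⟨g ⟨z', hz'⟩⟩) =
      (pathClass (H.evalAt ⟨z, hz⟩) : FundamentalGroupoid.mk z ⟶ ⟨g ⟨z, hz⟩⟩) ≫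
        CategoryTheory.eqToHom e := by
    rw [hpp, ← he]
    exact Path.Homotopic.Quotient.eq.2 (Path.Homotopic.map_trans_evalAt H p')
  intro a a' m m' hm hm'
  have h1 := hQ.comp _ _ (hQ.comp _ _ (hray _ a m hm) (hQ.eqToHom e (hM1 _ hz)))
    (hQ.inv _ (hray _ a' m' hm'))
  simp only [Category.assoc, Groupoid.inv_eq_inv, IsIso.inv_comp] at h1
  rw [← reassoc_of% hsq] at h1
  simpa [Groupoid.inv_eq_inv] using h1

/-- Every class of paths in `Z` between points of `A` has the property `Q`. -/
theorem of_subset (hQ : IsEdgeClosed A q Q) (h : CellAttach A Z fun j => q j)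
    (hA : ∀ C ⊆ A, IsClosed C) {x y : W} (hx : x ∈ A) (hy : y ∈ A) (p : Path x y)
    (hp : ∀ t, p t ∈ Z) : Q (pathClass p) := by
  classical
  -- the norm of the coordinate in the cells, in all cells or in one cell only
  obtain ⟨r, hrA, hrq, hr⟩ := h.exists_extend (fun _ => (1 : ℝ)) continuousOn_const
    (fun _ d => ‖d.1‖) (fun _ => by fun_prop) fun _ _ hd => hd
  have hrj : ∀ j₀, ∃ r : W → ℝ, Set.EqOn r (fun _ => 1) A ∧
      (∀ j d, r (q j d) = if j = j₀ then ‖d.1‖ else 1) ∧ ContinuousOn r Z := fun j₀ =>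
    h.exists_extend (fun _ => (1 : ℝ)) continuousOn_const (fun j d => if j = j₀ then ‖d.1‖ else 1)
      (fun j => by split_ifs <;> fun_prop) fun j d hd => by split_ifs <;> simp [hd]
  choose s hsA hsq hs using hrj
  obtain ⟨V, hVA, hVq, hV⟩ := h.exists_extend (T := EuclideanSpace ℝ (Fin 1)) (fun _ => 0)
    continuousOn_const (fun _ d => min 1 (2 * (1 - ‖d.1‖)) • d.1) (fun _ => by fun_prop)
    (fun j d hd => by simp [hd])
  let c : Option J → Set unitInterval := fun o =>
    o.elim {t | 1 / 4 < r (p t)} fun j => {t | s j (p t) < 1 / 2}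
  have hc : ∀ o, IsOpen (c o) := by
    rintro (_ | j)
    · exact isOpen_lt continuous_const (hr.comp_continuous p.continuous hp)
    · exact isOpen_lt ((hs j).comp_continuous p.continuous hp) continuous_const
  have hcov : Set.univ ⊆ ⋃ o, c o := by
    intro t _
    rw [Set.mem_iUnion]
    by_cases ht : p t ∈ A
    · refine ⟨none, ?_⟩
      change 1 / 4 < r (p t)
      rw [hrA ht]
      norm_num
    · obtain ⟨j, d, hd, hjd⟩ := h.surj _ (hp t) ht
      rcases lt_or_ge ‖d.1‖ (1 / 2) with h2 | h2
      · refine ⟨some j, ?_⟩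
        change s j (p t) < 1 / 2
        rw [← hjd, hsq, if_pos rfl]
        exact h2
      · refine ⟨none, ?_⟩
        change 1 / 4 < r (p t)
        rw [← hjd, hrq]
        linarith
  obtain ⟨t, ht0, htm, ⟨N, hN⟩, htc⟩ := exists_monotone_Icc_subset_open_cover_unitInterval hc hcov
  have hpiece : ∀ k, Good A q Q (pathClass (p.subpath (t k) (t (k + 1)))) := by
    intro k
    obtain ⟨o, ho⟩ := htc k
    have hmem : ∀ u, ∃ v ∈ c o, p v = p.subpath (t k) (t (k + 1)) u := fun u => by
      have h1 : p.subpath (t k) (t (k + 1)) u ∈ Set.range (p.subpath (t k) (t (k + 1))) := ⟨u, rfl⟩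
      rw [Path.range_subpath_of_le _ _ _ (htm (Nat.le_succ k))] at h1
      obtain ⟨v, hv, e⟩ := h1
      exact ⟨v, ho hv, e⟩
    generalize p.subpath (t k) (t (k + 1)) = w at hmem
    rcases o with _ | j
    · refine hQ.good_radial h hA w fun u => ?_
      obtain ⟨v, hv, e⟩ := hmem u
      by_cases hA' : w u ∈ A
      · exact Or.inl hA'
      · obtain ⟨j, d, hd, hjd⟩ := h.surj _ (e ▸ hp v) hA'
        refine Or.inr ⟨j, d, ?_, hd, hjd⟩
        change 1 / 4 < r (p v) at hv
        rw [e, ← hjd, hrq] at hv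
        exact hv.le
    · have hd : ∀ u, ∃ d : Disk 1, ‖d.1‖ < 1 / 2 ∧ q j d = w u := fun u => by
        obtain ⟨v, hv, e⟩ := hmem u
        change s j (p v) < 1 / 2 at hv
        rw [e] at hv
        by_cases hA' : w u ∈ A
        · rw [hsA j hA'] at hv
          norm_num at hv
        · obtain ⟨j', d, hd, hjd⟩ := h.surj _ (e ▸ hp v) hA'
          rw [← hjd, hsq] at hv
          split_ifs at hv with hj
          · exact ⟨d, hv, hj ▸ hjd⟩
          · norm_num at hv
      choose d hd hqd using hd
      have hdc : Continuous d := by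
        refine continuous_induced_rng.2 ?_
        have h1 : (Subtype.val ∘ d : unitInterval → EuclideanSpace ℝ (Fin 1)) =
            fun u => V (w u) := by
          funext u
          rw [← hqd u, hVq, min_eq_left (by linarith [hd u]), one_smul]
          rfl
        rw [h1]
        exact hV.comp_continuous w.continuous fun u => by
          obtain ⟨v, -, e⟩ := hmem u
          exact e ▸ hp v
      obtain ⟨e₁, e₂, he⟩ := pathClass_eq_of_apply w
        ((⟨⟨d, hdc⟩, rfl, rfl⟩ : Path (d 0) (d 1)).map (q j).continuous) fun u => (hqd u).symm
      have h2 := hQ.good_cell h j (by linarith [hd 0]) (by linarith [hd 1])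
        (⟨⟨d, hdc⟩, rfl, rfl⟩ : Path (d 0) (d 1))
      rw [he]
      exact conj_eqToHom_of (Q := fun _ _ p => Good A q Q p) e₁ e₂ _ h2
  have hgood : ∀ k, Good A q Q (pathClass (p.subpath (t 0) (t k))) := by
    intro k
    induction k with
    | zero =>
      intro a a' m m' hm hm'
      have h0 : p (t 0) ∈ A := by
        rw [ht0, p.source]
        exact hx
      obtain ⟨rfl, rfl⟩ := isTail_of_mem h h0 hm
      obtain ⟨rfl, rfl⟩ := isTail_of_mem h h0 hm'
      rw [Path.subpath_self, pathClass_refl]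
      simpa [Groupoid.inv_eq_inv] using hQ.id _ h0
    | succ k ih =>
      have e : pathClass (p.subpath (t 0) (t (k + 1))) =
          pathClass (p.subpath (t 0) (t k)) ≫ pathClass (p.subpath (t k) (t (k + 1))) :=
        (Path.Homotopic.Quotient.eq.2 ⟨Path.Homotopy.subpathTransSubpath p _ _ _⟩).symm
      rw [e]
      exact hQ.good_comp h (hp _) ih (hpiece k)
  have h1 := hgood N
  rw [ht0, hN N le_rfl] at h1
  obtain ⟨e₁, e₂, he⟩ := pathClass_eq_of_apply p (p.subpath 0 1) fun u => by simp
  rw [he]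
  refine conj_eqToHom_of e₁ e₂ _ ?_
  have h2 := h1 (𝟙 _) (𝟙 _) (Or.inl ⟨rfl, by simpa using hx, rfl⟩)
    (Or.inl ⟨rfl, by simpa using hy, rfl⟩)
  simpa [Groupoid.inv_eq_inv] using h2

end IsEdgeClosed

/-- The fundamental groupoid of a space with a cellular filtration, on the points of the lowest
stage, is generated by the edges. -/
theorem IsCellFiltration.edge_induction {S : ℕ → Set W} (hS : IsCellFiltration S) {J : Type u}
    {q : J → C(Disk 1, W)} (h : CellAttach (S 0) (S 1) fun j => q j)
    {Q : ∀ ⦃x y : FundamentalGroupoid W⦄, (x ⟶ y) → Prop} (hQ : IsEdgeClosed (S 0) q Q)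
    {x y : FundamentalGroupoid W} (hx : x.as ∈ S 0) (hy : y.as ∈ S 0) (p : x ⟶ y) : Q p := by
  obtain ⟨p, rfl⟩ := Path.Homotopic.Quotient.mk_surjective p
  have hA : ∀ C ⊆ S 0, IsClosed C := by
    obtain ⟨J₀, q₀, h₀⟩ := hS.attach 0
    refine fun C hC => h₀.isClosed_of C hC ?_ fun j => ?_
    · rw [stageBelow, Set.inter_empty]
      exact isClosed_empty
    · exact Set.Subsingleton.isClosed fun d _ d' _ => Subtype.ext (Subsingleton.elim _ _)
  obtain ⟨k, ⟨hk⟩, hk1⟩ := hS.approx lowDim_unitInterval p.toContinuousMap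
  have hb : ∀ t : unitInterval, t = 0 ∨ t = 1 → t ∈ p.toContinuousMap ⁻¹' S 1 := by
    rintro t (rfl | rfl)
    · exact hS.mono zero_le_one (by simpa using hx)
    · exact hS.mono zero_le_one (by simpa using hy)
  have e : ∀ t : unitInterval, t = 0 ∨ t = 1 → k t = p t := fun t ht =>
    (hk.fst_eq_snd (hb t ht)).symm
  let k' : Path x.as y.as :=
    ⟨k, (e 0 (Or.inl rfl)).trans p.source, (e 1 (Or.inr rfl)).trans p.target⟩
  have h1 : Path.Homotopic.Quotient.mk p = Path.Homotopic.Quotient.mk k' :=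
    Path.Homotopic.Quotient.eq.2
      ⟨⟨hk.toHomotopy, fun t u hu => hk.prop t u (hb u (by simpa using hu))⟩⟩
  rw [h1]
  exact hQ.of_subset h hA hx hy k' hk1

end

end EquivariantCW

namespace EquivariantCW

/-! ### Morphisms of the orbit category -/

/-- The `G`-map `G ⧸ K → G ⧸ H` that sends the coset `K` to a coset that is fixed by `K`. -/
def orbitHom {G : Type u} [Group G] {K H : Subgroup G} (c : G ⧸ H)
    (hc : ∀ k ∈ K, k • c = c) : (G ⧸ K) →[G] (G ⧸ H) where
  toFun := Quotient.lift (fun a : G => a • c) (by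
    intro a b hab
    have h := hc (a⁻¹ * b) (QuotientGroup.leftRel_apply.1 hab)
    rw [mul_smul, inv_smul_eq_iff] at h
    exact h.symm)
  map_smul' g x := by
    induction x using Quotient.ind
    exact mul_smul g _ c

lemma orbitHom_base {G : Type u} [Group G] {K H : Subgroup G} (c : G ⧸ H)
    (hc : ∀ k ∈ K, k • c = c) : orbitHom c hc (baseCoset K) = c := one_smul G c

lemma smul_baseCoset_of_mem {G : Type u} [Group G] (K : Subgroup G) :
    ∀ k ∈ K, k • baseCoset K = baseCoset K :=
  fun k hk => smul_baseCoset K ⟨k, hk⟩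

variable {G : Type u} [Group G] [TopologicalSpace G]

/-! ### Skeleta as complexes of their own -/

/-- Attaching maps can be transported along an equivariant embedding that is compatible with the
filtrations. -/
theorem isAttachingMap_comp_iff {X' X : FilteredGSpace G} {n : ℕ} {ι : Type u}
    {H : ι → Subgroup G} (e : X'.carrier → X.carrier) (he : IsEmbedding e)
    (hsmul : ∀ (g : G) x, e (g • x) = g • e x) (hmem : ∀ m x, e x ∈ X.skel m ↔ x ∈ X'.skel m)
    (hr : X.skel n ⊆ Set.range e) (q : Cells H n → X'.carrier) :
    IsAttachingMap X n H (e ∘ q) ↔ IsAttachingMap X' n H q := by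
  have hbelow : ∀ x, e x ∈ X.skelBelow n ↔ x ∈ X'.skelBelow n := by
    cases n with
    | zero => exact fun x => Iff.rfl
    | succ n => exact hmem n
  let En : X'.skel n ≃ₜ X.skel n :=
    (show IsEmbedding (fun x : X'.skel n => (⟨e x.1, (hmem n _).2 x.2⟩ : X.skel n)) from
      IsEmbedding.of_comp (by have := he.continuous; fun_prop) continuous_subtype_val
        (he.comp IsEmbedding.subtypeVal)).toHomeomorphOfSurjective (by
      rintro ⟨x, hx⟩
      obtain ⟨y, rfl⟩ := hr hx
      exact ⟨⟨y, (hmem n _).1 hx⟩, rfl⟩)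
  let Eb : X'.skelBelow n ≃ₜ X.skelBelow n :=
    (show IsEmbedding (fun x : X'.skelBelow n => (⟨e x.1, (hbelow _).2 x.2⟩ : X.skelBelow n)) from
      IsEmbedding.of_comp (by have := he.continuous; fun_prop) continuous_subtype_val
        (he.comp IsEmbedding.subtypeVal)).toHomeomorphOfSurjective (by
      rintro ⟨x, hx⟩
      obtain ⟨y, rfl⟩ := hr (X.skelBelow_subset n hx)
      exact ⟨⟨y, (hbelow _).1 hx⟩, rfl⟩)
  have hquot : ∀ (m : ∀ z, q z ∈ X'.skel n) (m' : ∀ z, (e ∘ q) z ∈ X.skel n),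
      IsQuotientMap (Sum.elim (Set.inclusion (X.skelBelow_subset n))
        (fun z => (⟨(e ∘ q) z, m' z⟩ : X.skel n))) ↔
      IsQuotientMap (Sum.elim (Set.inclusion (X'.skelBelow_subset n))
        (fun z => (⟨q z, m z⟩ : X'.skel n))) := fun m m' => by
    have h1 : Sum.elim (Set.inclusion (X.skelBelow_subset n))
        (fun z => (⟨(e ∘ q) z, m' z⟩ : X.skel n)) ∘ (Eb.sumCongr (Homeomorph.refl (Cells H n))) =
        En ∘ Sum.elim (Set.inclusion (X'.skelBelow_subset n))
        (fun z => (⟨q z, m z⟩ : X'.skel n)) := by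
      funext z
      rcases z with z | z <;> rfl
    constructor
    · intro h
      have h2 := h.comp (Eb.sumCongr (Homeomorph.refl (Cells H n))).isQuotientMap
      rw [h1] at h2
      have h3 := En.symm.isQuotientMap.comp h2
      rwa [← Function.comp_assoc, En.symm_comp_self, Function.id_comp] at h3
    · intro h
      have h2 := En.isQuotientMap.comp h
      rw [← h1] at h2
      have h3 := h2.comp (Eb.sumCongr (Homeomorph.refl (Cells H n))).symm.isQuotientMap
      rwa [Function.comp_assoc, Homeomorph.self_comp_symm, Function.comp_id] at h3
  have hdiff : X.skel n \ X.skelBelow n = e '' (X'.skel n \ X'.skelBelow n) := by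
    ext x
    constructor
    · rintro ⟨hx, hx'⟩
      obtain ⟨y, rfl⟩ := hr hx
      exact ⟨y, ⟨(hmem n y).1 hx, fun h => hx' ((hbelow y).2 h)⟩, rfl⟩
    · rintro ⟨y, ⟨hy, hy'⟩, rfl⟩
      exact ⟨(hmem n y).2 hy, fun h => hy' ((hbelow y).1 h)⟩
  constructor
  · intro h
    have hm : ∀ z, q z ∈ X'.skel n := fun z => (hmem n _).1 (h.mem z)
    refine ⟨fun g i c d => he.injective ?_, fun z hz => (hbelow _).1 (h.boundary_mem hz),
      ⟨fun z hz => ?_, fun z hz z' hz' hzz => h.bijOn.injOn hz hz' (congrArg e hzz),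
        fun x hx => ?_⟩,
      hm, (hquot _ _).1 h.quotient⟩
    · rw [hsmul]
      exact h.equivariant g i c d
    · have := h.bijOn.mapsTo hz
      rw [hdiff] at this
      exact (he.injective.mem_set_image).1 this
    · have h1 : e x ∈ X.skel n \ X.skelBelow n := by
        rw [hdiff]
        exact ⟨x, hx, rfl⟩
      obtain ⟨z, hz, hzx⟩ := h.bijOn.surjOn h1
      exact ⟨z, hz, he.injective hzx⟩
  · intro h
    refine ⟨fun g i c d => ?_, fun z hz => (hbelow _).2 (h.boundary_mem hz), ?_,
      fun z => (hmem n _).2 (h.mem z), (hquot _ _).2 h.quotient⟩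
    · change e _ = g • e _
      rw [h.equivariant, hsmul]
    · rw [hdiff]
      exact he.injective.injOn.bijOn_image.comp h.bijOn

/-- Nothing has to be attached if two consecutive stages agree. -/
lemma isAttachingMap_of_isEmpty (X : FilteredGSpace G) {n : ℕ} (h : X.skel n ⊆ X.skelBelow n)
    {ι : Type u} [IsEmpty ι] (H : ι → Subgroup G) (q : Cells H n → X.carrier) :
    IsAttachingMap X n H q where
  equivariant _ i := isEmptyElim i
  boundary_mem z := isEmptyElim z.1
  bijOn := ⟨fun z => isEmptyElim z.1, fun z => isEmptyElim z.1, fun x hx => absurd (h hx.1) hx.2⟩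
  mem z := isEmptyElim z.1
  quotient := by
    have hf : Continuous fun x : X.skel n => (Sum.inl ⟨x.1, h x.2⟩ : X.skelBelow n ⊕ Cells H n) :=
      continuous_inl.comp (by fun_prop)
    refine IsQuotientMap.of_inverse hf ?_ fun x => rfl
    exact continuous_sum_dom.2 ⟨continuous_inclusion (X.skelBelow_subset n),
      continuous_iff_continuousAt.2 fun z => isEmptyElim z.1⟩

lemma IsAttachingMap.skeleton {X : FilteredGSpace G} {n : ℕ} {ι : Type u} {H : ι → Subgroup G}
    {q : Cells H n → X.carrier} (hq : IsAttachingMap X n H q) {k : ℕ} (h : n ≤ k) :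
    IsAttachingMap (X.skeleton k) n H fun z => (⟨q z, X.mono h (hq.mem z)⟩ : X.skel k) := by
  refine (isAttachingMap_comp_iff (X' := X.skeleton k) (X := X) Subtype.val IsEmbedding.subtypeVal
    (fun _ _ => rfl) (fun _ _ => Iff.rfl) ?_ _).1 hq
  intro x hx
  exact ⟨⟨x, X.mono h hx⟩, rfl⟩

lemma FilteredGSpace.IsCWComplex.skeleton {F : Set (Subgroup G)} {X : FilteredGSpace G}
    (hX : X.IsCWComplex F) (k : ℕ) : (X.skeleton k).IsCWComplex F where
  isClosed_iff C := by
    refine ⟨fun h n => h.preimage continuous_subtype_val, fun h => ?_⟩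
    exact isClosed_of_mem_iff ((h k).preimage
      (show Continuous fun x : (X.skeleton k).carrier => (⟨x, x.2⟩ : (X.skeleton k).skel k) from
        continuous_id.subtype_mk _)) fun x => Iff.rfl
  attach n := by
    rcases le_or_gt n k with hn | hn
    · obtain ⟨ι, H, q, hH, hq⟩ := hX.attach n
      exact ⟨ι, H, _, hH, hq.skeleton hn⟩
    · exact ⟨PEmpty, fun i => i.elim, fun z => z.1.elim, fun i => i.elim,
        isAttachingMap_of_isEmpty _ (fun x _ => (X.skeleton k).skelBelow_mono hn x.2) _ _⟩

/-! ### Natural transformations are determined on cells -/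

lemma map_heq_of_eq {C D : Type*} [Category C] [Category D] {f g : C ⥤ D} (h : f = g) {x y : C}
    (p : x ⟶ y) : HEq (f.map p) (g.map p) := by
  subst h
  rfl

lemma map_heq_of_heq {C D : Type*} [Category C] [Category D] (f : C ⥤ D) {x y x' y' : C}
    (hx : x = x') (hy : y = y') {p : x ⟶ y} {p' : x' ⟶ y'} (h : HEq p p') :
    HEq (f.map p) (f.map p') := by
  subst hx hy
  rw [eq_of_heq h]

lemma comp_heq_comp {C : Type*} [Category C] {x y z x' y' z' : C} (hx : x = x') (hy : y = y')
    (hz : z = z') {p : x ⟶ y} {q : y ⟶ z} {p' : x' ⟶ y'} {q' : y' ⟶ z'} (hp : HEq p p')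
    (hq : HEq q q') : HEq (p ≫ q) (p' ≫ q') := by
  subst hx hy hz
  rw [eq_of_heq hp, eq_of_heq hq]

lemma inv_heq_inv {C : Type*} [Groupoid C] {x y x' y' : C} (hx : x = x') (hy : y = y')
    {p : x ⟶ y} {p' : x' ⟶ y'} (hp : HEq p p') : HEq (Groupoid.inv p) (Groupoid.inv p') := by
  subst hx hy
  rw [eq_of_heq hp]

namespace IsAttachingMap

variable {X : FilteredGSpace G} {n : ℕ} {ι : Type u} {H : ι → Subgroup G}
  {q : Cells H n → X.carrier}

lemma coset (hq : IsAttachingMap X n H q) (i : ι) (a : G) (d : Disk n) :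
    q ⟨i, (a : G ⧸ H i), d⟩ = a • q ⟨i, baseCoset (H i), d⟩ := by
  rw [← hq.equivariant]
  congr 3
  change _ = ((a * 1 : G) : G ⧸ H i)
  rw [mul_one]

/-- The characteristic map of the representative of an equivariant cell. -/
def charMap (hq : IsAttachingMap X n H q) (i : ι) : C(Disk n, X.fix (H i)) :=
  ⟨fun d => ⟨q ⟨i, baseCoset (H i), d⟩, hq.fixed_of _ (smul_baseCoset_of_mem _) d⟩,
    (hq.continuous_cell i _).subtype_mk _⟩

lemma orbitMap_charMap (hq : IsAttachingMap X n H q) (i : ι) (d : Disk n) (c : G ⧸ H i) :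
    orbitMap X (H i) (hq.charMap i d) c = q ⟨i, c, d⟩ := by
  induction c using Quotient.ind with
  | _ a => exact (hq.coset i a d).symm

/-- The vertex that represents an equivariant cell of dimension zero. -/
noncomputable def vertex {q : Cells H 0 → X.carrier} (hq : IsAttachingMap X 0 H q) (i : ι) :
    (fixedPair X (H i)).Grpoid :=
  (⟨hq.charMap i 0, hq.mem _⟩ : (fixedPair X (H i)).pts)

/-- The path class of the edge that represents an equivariant cell of dimension one. -/
noncomputable def edge {q : Cells H 1 → X.carrier} (hq : IsAttachingMap X 1 H q) (i : ι) :
    (show (fixedPair X (H i)).Grpoid from (⟨hq.charMap i (segmentPoint 0),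
      hq.boundary_mem (show _ = _ from norm_segmentPoint_zero)⟩ : (fixedPair X (H i)).pts)) ⟶
    (show (fixedPair X (H i)).Grpoid from (⟨hq.charMap i (segmentPoint 1),
      hq.boundary_mem (show _ = _ from norm_segmentPoint_one)⟩ : (fixedPair X (H i)).pts)) :=
  InducedCategory.homMk (pathClass (segmentPath.map (hq.charMap i).continuous))

end IsAttachingMap

variable [DiscreteTopology G]

/-- A natural transformation on the fundamental functor of a `(G, F)`-CW-complex is determined by
its values on the representatives of the equivariant cells of dimension zero and one. -/
theorem transf_ext {F : Set (Subgroup G)} {Y : FilteredGSpace G} (hY : Y.IsCWComplex F)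
    {D : (OrbitCat F)ᵒᵖ ⥤ Grpd.{u, u}} (α β : fundamentalFunctor F Y ⟶ D)
    {ι₀ ι₁ : Type u} {H₀ : ι₀ → Subgroup G} {H₁ : ι₁ → Subgroup G} (hH₀ : ∀ i, H₀ i ∈ F)
    (hH₁ : ∀ i, H₁ i ∈ F) {q₀ : Cells H₀ 0 → Y.carrier} {q₁ : Cells H₁ 1 → Y.carrier}
    (hq₀ : IsAttachingMap Y 0 H₀ q₀) (hq₁ : IsAttachingMap Y 1 H₁ q₁)
    (h₀ : ∀ i, (α.app (op ⟨H₀ i, hH₀ i⟩)).obj (hq₀.vertex i) =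
      (β.app (op ⟨H₀ i, hH₀ i⟩)).obj (hq₀.vertex i))
    (h₁ : ∀ i, HEq ((α.app (op ⟨H₁ i, hH₁ i⟩)).map (hq₁.edge i))
      ((β.app (op ⟨H₁ i, hH₁ i⟩)).map (hq₁.edge i))) : α = β := by
  have hnat : ∀ (γ : fundamentalFunctor F Y ⟶ D) {K L : OrbitCat F} (f : K ⟶ L),
      (fixedPairMap Y f).grpoidMap ⋙ (show (fixedPair Y K.grp).Grpoid ⥤ D.obj (op K) from
        γ.app (op K)) = (show (fixedPair Y L.grp).Grpoid ⥤ D.obj (op L) from γ.app (op L)) ⋙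
        (show D.obj (op L) ⥤ D.obj (op K) from D.map f.op) := fun γ K L f => γ.naturality f.op
  have hobj : ∀ (K : OrbitCat F) (x : (fixedPair Y K.grp).Grpoid),
      (show (fixedPair Y K.grp).Grpoid ⥤ D.obj (op K) from α.app (op K)).obj x =
        (show (fixedPair Y K.grp).Grpoid ⥤ D.obj (op K) from β.app (op K)).obj x := by
    rintro K ⟨y, hy⟩
    obtain ⟨i, c, d, hd, e⟩ := hq₀.surj hy (by exact id)
    obtain rfl : d = 0 := Subtype.ext (Subsingleton.elim _ _)
    have hc := (hq₀.fixed_iff K.grp hd).1 (by rw [e]; exact y.2)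
    let f : K ⟶ (⟨H₀ i, hH₀ i⟩ : OrbitCat F) := orbitHom c hc
    have hv : (fixedPairMap Y f).grpoidMap.obj (hq₀.vertex i) =
        (⟨y, hy⟩ : (fixedPair Y K.grp).pts) := by
      refine Subtype.ext (Subtype.ext ?_)
      change orbitMap Y (H₀ i) (hq₀.charMap i 0) (orbitHom c hc (baseCoset K.grp)) = y.1
      rw [orbitHom_base, hq₀.orbitMap_charMap, e]
    rw [← hv]
    refine (congrArg (fun k => k.obj (hq₀.vertex i)) (hnat α f)).trans
      (Eq.trans ?_ (congrArg (fun k => k.obj (hq₀.vertex i)) (hnat β f)).symm)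
    exact congrArg (fun k => (D.map f.op).obj k) (h₀ i)
  refine NatTrans.ext (funext fun K => ?_)
  obtain ⟨K⟩ := K
  let A : (fixedPair Y K.grp).Grpoid ⥤ D.obj (op K) := α.app (op K)
  let B : (fixedPair Y K.grp).Grpoid ⥤ D.obj (op K) := β.app (op K)
  have hAB : ∀ x, A.obj x = B.obj x := hobj K
  let pt : (x : Y.fix K.grp) → x.1 ∈ Y.skel 0 → (fixedPair Y K.grp).Grpoid :=
    fun x hx => (⟨x, hx⟩ : (fixedPair Y K.grp).pts)
  -- morphisms of the whole fundamental groupoid on which the two functors agree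
  let Q : ∀ ⦃x y : FundamentalGroupoid (Y.fix K.grp)⦄, (x ⟶ y) → Prop := fun x y p =>
    ∃ (hx : x.as.1 ∈ Y.skel 0) (hy : y.as.1 ∈ Y.skel 0),
      HEq (A.map (InducedCategory.homMk p : pt x.as hx ⟶ pt y.as hy))
        (B.map (InducedCategory.homMk p : pt x.as hx ⟶ pt y.as hy))
  let q : {j : Σ i, G ⧸ H₁ i // ∀ k ∈ K.grp, k • j.2 = j.2} → C(Disk 1, Y.fix K.grp) := fun j =>
    ⟨fun d => ⟨q₁ ⟨j.1.1, j.1.2, d⟩, hq₁.fixed_of K.grp j.2 d⟩,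
      (hq₁.continuous_cell j.1.1 j.1.2).subtype_mk _⟩
  have hQ : IsEdgeClosed {x : Y.fix K.grp | x.1 ∈ Y.skel 0} q Q := by
    refine ⟨fun x hx => ⟨hx, hx, ?_⟩, ?_, ?_, ?_⟩
    · have h1 := (A.map_id (pt x.as hx)).heq
      refine h1.trans (HEq.trans ?_ (B.map_id (pt x.as hx)).heq.symm)
      rw [hAB]
    · rintro x y z p p' ⟨hx, hy, h⟩ ⟨_, hz, h'⟩
      refine ⟨hx, hz, ?_⟩
      have e : (InducedCategory.homMk (p ≫ p') : pt x.as hx ⟶ pt z.as hz) =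
        (InducedCategory.homMk p : pt x.as hx ⟶ pt y.as hy) ≫
          (InducedCategory.homMk p' : pt y.as hy ⟶ pt z.as hz) := rfl
      rw [e, A.map_comp, B.map_comp]
      exact comp_heq_comp (hAB _) (hAB _) (hAB _) h h'
    · rintro x y p ⟨hx, hy, h⟩
      refine ⟨hy, hx, ?_⟩
      have e : (InducedCategory.homMk (Groupoid.inv p) : pt y.as hy ⟶ pt x.as hx) =
        Groupoid.inv (InducedCategory.homMk p : pt x.as hx ⟶ pt y.as hy) := rfl
      rw [e, functor_map_groupoidInv, functor_map_groupoidInv]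
      exact inv_heq_inv (hAB _) (hAB _) h
    · rintro ⟨⟨i, c⟩, hc⟩
      let f : K ⟶ (⟨H₁ i, hH₁ i⟩ : OrbitCat F) := orbitHom c hc
      obtain ⟨e₁, e₂, he⟩ := pathClass_eq_of_apply (segmentPath.map (q ⟨⟨i, c⟩, hc⟩).continuous)
        ((segmentPath.map (hq₁.charMap i).continuous).map (fixedPairMap Y f).toMap.continuous)
        fun t => Subtype.ext (by
          change q₁ ⟨i, c, segmentPoint t⟩ =
            orbitMap Y (H₁ i) (hq₁.charMap i (segmentPoint t)) (orbitHom c hc (baseCoset K.grp))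
          rw [orbitHom_base, hq₁.orbitMap_charMap])
      rw [he]
      refine conj_eqToHom_of (Q := Q) e₁ e₂ _ ⟨?_, ?_, ?_⟩
      · exact (fixedPairMap Y f).mapsTo _
          (hq₁.boundary_mem (show _ = _ from norm_segmentPoint_zero))
      · exact (fixedPairMap Y f).mapsTo _
          (hq₁.boundary_mem (show _ = _ from norm_segmentPoint_one))
      · refine (map_heq_of_eq (hnat α f) (hq₁.edge i)).trans
          (HEq.trans ?_ (map_heq_of_eq (hnat β f) (hq₁.edge i)).symm)
        exact map_heq_of_heq (D.map f.op) (hobj _ _) (hobj _ _) (h₁ i)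
  refine CategoryTheory.Functor.hext hAB fun x y p => ?_
  obtain ⟨hx, hy, h⟩ := (hY.isCellFiltration K.grp).edge_induction
    (hY.cellAttach_fix K.grp hq₁) (q := q) hQ (x := ⟨x.1⟩) (y := ⟨y.1⟩) x.2 y.2 p.hom
  exact h

end EquivariantCW

namespace EquivariantCW

/-! ### Extension of equivariant maps over cells -/

variable {G : Type u} [Group G] [TopologicalSpace G]

/-- `g` is a `G`-map on the invariant subset `S` (and arbitrary elsewhere) whose values are
constrained by the relation `R`. -/
structure IsPartialGMap (Y : FilteredGSpace G) {T : Type u} [TopologicalSpace T] [MulAction G T]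
    (R : Y.carrier → T → Prop) (S : Set Y.carrier) (g : Y.carrier → T) : Prop where
  cont : ContinuousOn g S
  map_smul : ∀ (a : G), ∀ x ∈ S, g (a • x) = a • g x
  rel : ∀ x ∈ S, R x (g x)

section

variable [DiscreteTopology G] {Y : FilteredGSpace G} {F : Set (Subgroup G)} {T : Type u}
  [TopologicalSpace T] [MulAction G T] [ContinuousConstSMul G T] {R : Y.carrier → T → Prop}

/-- A `G`-map extends over equivariant cells as soon as its restrictions to the boundaries of
representatives extend to maps into the fixed points of the isotropy groups. -/
theorem IsPartialGMap.exists_extend (hY : Y.IsCWComplex F)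
    (hR : ∀ (a : G) x t, R x t → R (a • x) (a • t)) {n : ℕ} {ι : Type u} {H : ι → Subgroup G}
    {q : Cells H n → Y.carrier} (hq : IsAttachingMap Y n H q) {g : Y.carrier → T}
    (hg : IsPartialGMap Y R (Y.skelBelow n) g) (U : ι → C(Disk n, T))
    (hfix : ∀ i, ∀ h ∈ H i, ∀ d, h • U i d = U i d)
    (hU : ∀ i d, ‖d.1‖ = 1 → U i d = g (q ⟨i, baseCoset (H i), d⟩))
    (hUR : ∀ i d, R (q ⟨i, baseCoset (H i), d⟩) (U i d)) :
    ∃ g' : Y.carrier → T, IsPartialGMap Y R (Y.skel n) g' ∧ Set.EqOn g' g (Y.skelBelow n) ∧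
      ∀ i d, g' (q ⟨i, baseCoset (H i), d⟩) = U i d := by
  -- the translates of the given maps on the representatives
  let V : (j : Σ i, G ⧸ H i) → Disk n → T := fun j d =>
    Quotient.lift (fun a : G => a • U j.1 d) (by
      intro a b hab
      have h := hfix j.1 (a⁻¹ * b) (QuotientGroup.leftRel_apply.1 hab) d
      rw [mul_smul, inv_smul_eq_iff] at h
      exact h.symm) j.2
  have hVa : ∀ i (a : G) d, V ⟨i, (a : G ⧸ H i)⟩ d = a • U i d := fun i a d => rfl
  have hV : ∀ j, Continuous (V j) := by
    rintro ⟨i, c⟩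
    induction c using Quotient.ind with
    | _ a => exact (U i).continuous.const_smul a
  obtain ⟨g', hg', hg'q, hc⟩ := (hY.cellAttach hq).exists_extend g hg.cont V hV (by
    rintro ⟨i, c⟩ d hd
    induction c using Quotient.ind with
    | _ a =>
      refine (hVa i a d).trans ?_
      change _ = g (q ⟨i, (a : G ⧸ H i), d⟩)
      have hb : q ⟨i, baseCoset (H i), d⟩ ∈ Y.skelBelow n := hq.boundary_mem hd
      rw [hU i d hd, hq.coset i a d, hg.map_smul a _ hb])
  have hcell : ∀ i (a : G) d, g' (a • q ⟨i, baseCoset (H i), d⟩) = a • U i d := fun i a d => by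
    rw [← hq.coset, ← hVa]
    exact hg'q ⟨i, (a : G ⧸ H i)⟩ d
  refine ⟨g', ⟨hc, fun a x hx => ?_, fun x hx => ?_⟩, hg', fun i d => ?_⟩
  · by_cases hx' : x ∈ Y.skelBelow n
    · rw [hg' hx', hg' (Y.smul_mem_skelBelow hx'), hg.map_smul a x hx']
    · obtain ⟨i, c, d, -, rfl⟩ := hq.surj hx hx'
      induction c using Quotient.ind with
      | _ b =>
        change g' (a • q ⟨i, (b : G ⧸ H i), d⟩) = a • g' (q ⟨i, (b : G ⧸ H i), d⟩)
        rw [hq.coset, smul_smul, hcell, hcell, mul_smul]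
  · by_cases hx' : x ∈ Y.skelBelow n
    · rw [hg' hx']
      exact hg.rel x hx'
    · obtain ⟨i, c, d, -, rfl⟩ := hq.surj hx hx'
      induction c using Quotient.ind with
      | _ b =>
        change R (q ⟨i, (b : G ⧸ H i), d⟩) (g' (q ⟨i, (b : G ⧸ H i), d⟩))
        rw [hq.coset, hcell]
        exact hR b _ _ (hUR i d)
  · simpa using hcell i 1 d

/-- A partial `G`-map on a skeleton extends to the whole complex if it can be extended over the
representatives of the equivariant cells, one dimension after the other. -/
theorem IsPartialGMap.exists_extend_all (hY : Y.IsCWComplex F)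
    (hR : ∀ (a : G) x t, R x t → R (a • x) (a • t)) (n₀ : ℕ) {g₀ : Y.carrier → T}
    (hg₀ : IsPartialGMap Y R (Y.skelBelow n₀) g₀)
    (step : ∀ n, n₀ ≤ n → ∀ (ι : Type u) (H : ι → Subgroup G) (q : Cells H n → Y.carrier),
      (∀ i, H i ∈ F) → IsAttachingMap Y n H q → ∀ g : Y.carrier → T,
      IsPartialGMap Y R (Y.skelBelow n) g → Set.EqOn g g₀ (Y.skelBelow n₀) →
      ∀ i, ∃ U : C(Disk n, T), (∀ h ∈ H i, ∀ d, h • U d = U d) ∧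
        (∀ d, ‖d.1‖ = 1 → U d = g (q ⟨i, baseCoset (H i), d⟩)) ∧
        ∀ d, R (q ⟨i, baseCoset (H i), d⟩) (U d)) :
    ∃ g : C(Y.carrier, T), (∀ (a : G) x, g (a • x) = a • g x) ∧ (∀ x, R x (g x)) ∧
      Set.EqOn g g₀ (Y.skelBelow n₀) := by
  have hmono : ∀ {m n}, m ≤ n → Y.skelBelow m ⊆ Y.skelBelow n := fun {m n} h => by
    rcases h.eq_or_lt with rfl | h
    · exact subset_rfl
    · exact (Y.skelBelow_subset m).trans (Y.skelBelow_mono h)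
  let Good : ℕ → Type u := fun k => {g : Y.carrier → T //
    IsPartialGMap Y R (Y.skelBelow (n₀ + k)) g ∧ Set.EqOn g g₀ (Y.skelBelow n₀)}
  have next : ∀ k (g : Good k), ∃ g' : Good (k + 1), Set.EqOn g'.1 g.1 (Y.skelBelow (n₀ + k)) := by
    rintro k ⟨g, hg, hgg⟩
    obtain ⟨ι, H, q, hH, hq⟩ := hY.attach (n₀ + k)
    choose U h1 h2 h3 using step (n₀ + k) (by omega) ι H q hH hq g hg hgg
    obtain ⟨g', hg', he, -⟩ := hg.exists_extend hY hR hq U h1 h2 h3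
    exact ⟨⟨g', hg', (he.mono (hmono (by omega))).trans hgg⟩, he⟩
  choose nxt hnxt using next
  let s : ∀ k, Good k := fun k => Nat.rec ⟨g₀, hg₀, fun _ _ => rfl⟩ (fun k g => nxt k g) k
  have hs : ∀ k, Set.EqOn (s (k + 1)).1 (s k).1 (Y.skelBelow (n₀ + k)) := fun k => hnxt k (s k)
  have hs' : ∀ k j, Set.EqOn (s (k + j)).1 (s k).1 (Y.skelBelow (n₀ + k)) := by
    intro k j
    induction j with
    | zero => exact fun _ _ => rfl
    | succ j ih => exact ((hs (k + j)).mono (hmono (by omega))).trans ih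
  have hex : ∀ x, ∃ k, x ∈ Y.skelBelow (n₀ + k) := fun x => by
    obtain ⟨n, hn⟩ := Y.exhaust x
    exact ⟨n + 1, Y.skelBelow_mono (by omega) hn⟩
  choose k hk using hex
  let g : Y.carrier → T := fun x => (s (k x)).1 x
  have hg : ∀ j, Set.EqOn g (s j).1 (Y.skelBelow (n₀ + j)) := fun j x hx => by
    rcases le_total j (k x) with h | h
    · obtain ⟨i, hi⟩ := Nat.exists_eq_add_of_le h
      change (s (k x)).1 x = _
      rw [hi]
      exact hs' j i hx
    · obtain ⟨i, hi⟩ := Nat.exists_eq_add_of_le h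
      rw [hi]
      exact (hs' (k x) i (hk x)).symm
  have hcont : Continuous g := by
    refine continuous_iff_isClosed.2 fun C hC => (hY.isClosed_iff _).2 fun n => ?_
    have h1 : ContinuousOn g (Y.skel n) := by
      have h2 : Y.skel n ⊆ Y.skelBelow (n₀ + (n + 1)) := Y.skelBelow_mono (by omega)
      exact ((s (n + 1)).2.1.cont.congr (hg (n + 1))).mono h2
    exact hC.preimage (continuousOn_iff_continuous_domRestrict.1 h1)
  refine ⟨⟨g, hcont⟩, fun a x => ?_, fun x => ?_, fun x hx => ?_⟩
  · change g (a • x) = a • g x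
    rw [hg (k x) (hk x), hg (k x) (Y.smul_mem_skelBelow (hk x))]
    exact (s (k x)).2.1.map_smul a x (hk x)
  · change R x (g x)
    rw [hg (k x) (hk x)]
    exact (s (k x)).2.1.rel x (hk x)
  · exact hg 0 hx

end

end EquivariantCW

namespace EquivariantCW

/-! ### Paths as maps on the one-dimensional disk -/

/-- The inverse of `segmentPoint`. -/
noncomputable def segmentCoord : C(Disk 1, unitInterval) where
  toFun d := ⟨(d.1 0 + 1) / 2, by
    have h : |d.1 0| ≤ 1 := by
      have := (PiLp.norm_apply_le d.1 0).trans d.norm_le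
      rwa [Real.norm_eq_abs] at this
    rw [abs_le] at h
    constructor <;> linarith [h.1, h.2]⟩
  continuous_toFun := by fun_prop

lemma segmentCoord_segmentPoint (t : unitInterval) : segmentCoord (segmentPoint t) = t := by
  ext
  change ((segmentPoint t).1 0 + 1) / 2 = t.1
  simp [segmentPoint]

lemma segmentPoint_segmentCoord (d : Disk 1) : segmentPoint (segmentCoord d) = d := by
  ext i
  rw [Subsingleton.elim i 0]
  change (EuclideanSpace.single 0 (2 * ((d.1 0 + 1) / 2) - 1) : EuclideanSpace ℝ (Fin 1)) 0 = d.1 0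
  simp
  ring

section

variable {P : BasedSpace.{u}} {x y x' y' : P.pts}

/-- The class of a path between base points, as a morphism of the restricted groupoid. -/
noncomputable abbrev basedClass (p : Path x.1 y.1) :
    (show P.Grpoid from x) ⟶ (show P.Grpoid from y) :=
  InducedCategory.homMk (pathClass p)

lemma basedClass_heq (hx : x = x') (hy : y = y') (p : Path x.1 y.1) (p' : Path x'.1 y'.1)
    (h : ∀ t, p t = p' t) : HEq (basedClass p) (basedClass p') := by
  subst hx hy
  rw [Path.ext (funext h)]

/-- Paths that represent the same morphism are connected by a homotopy with fixed end points. -/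
lemma exists_homotopy_of_heq (hx : x = x') (hy : y = y') (p : Path x.1 y.1) (p' : Path x'.1 y'.1)
    (h : HEq (basedClass p) (basedClass p')) : ∃ K : C(unitInterval × unitInterval, P.carrier),
      (∀ t, K (0, t) = p t) ∧ (∀ t, K (1, t) = p' t) ∧ (∀ s, K (s, 0) = x.1) ∧
        ∀ s, K (s, 1) = y.1 := by
  subst hx hy
  obtain ⟨K⟩ := Path.Homotopic.Quotient.exact (p := p) (q := p')
    (congrArg InducedCategory.Hom.hom (eq_of_heq h))
  exact ⟨K.toContinuousMap, fun t => K.apply_zero t, fun t => K.apply_one t,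
    fun s => K.source s, fun s => K.target s⟩

end

/-! ### Homotopies between maps with the same effect on fundamental functors -/

variable {G : Type u} [Group G] [TopologicalSpace G]

/-- The extension property for all dimensions from three on that expresses the vanishing of the
homotopy groups from degree two on. -/
lemma diskExtends_of_trivial {W : Type u} [TopologicalSpace W]
    (h : ∀ m : ℕ, 2 ≤ m → ∀ x : W, Subsingleton (π_ m W x)) {n : ℕ} (hn : 3 ≤ n) :
    DiskExtends W n := by
  obtain ⟨n, rfl⟩ : ∃ m, n = m + 1 := ⟨n - 1, by omega⟩
  exact diskExtends_of_homotopyGroup (by omega) (h n (by omega))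

/-- A version of the extension over a prism, with separate data on the bottom, the top and the
lateral surface. -/
lemma DiskExtends.cylinder {W : Type u} [TopologicalSpace W] {n : ℕ} (hW : DiskExtends W (n + 1))
    (a b : C(Disk n, W)) (s : C(unitInterval × Sph n, W)) (h₀ : ∀ z, s (0, z) = a (Sph.toDisk n z))
    (h₁ : ∀ z, s (1, z) = b (Sph.toDisk n z)) : ∃ k : C(unitInterval × Disk n, W),
      (∀ d, k (0, d) = a d) ∧ (∀ d, k (1, d) = b d) ∧ ∀ t z, k (t, Sph.toDisk n z) = s (t, z) := by
  classical
  let g : unitInterval × Disk n → W := fun x =>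
    if h : ‖x.2.1‖ = 1 then s (x.1, ⟨x.2.1, mem_sphere_zero_iff_norm.2 h⟩)
    else if x.1 = 0 then a x.2 else b x.2
  have g0 : ∀ x, x.1 = 0 → g x = a x.2 := by
    rintro ⟨t, d⟩ rfl
    by_cases h : ‖d.1‖ = 1
    · exact (dif_pos h).trans (h₀ _)
    · exact (dif_neg h).trans (if_pos rfl)
  have g1 : ∀ x, x.1 = 1 → g x = b x.2 := by
    rintro ⟨t, d⟩ rfl
    by_cases h : ‖d.1‖ = 1
    · exact (dif_pos h).trans (h₁ _)
    · exact (dif_neg h).trans (if_neg one_ne_zero)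
  have gs : ∀ x (h : ‖x.2.1‖ = 1), g x = s (x.1, ⟨x.2.1, mem_sphere_zero_iff_norm.2 h⟩) :=
    fun x h => dif_pos h
  have hc : ContinuousOn g {x | x.1 = 0 ∨ x.1 = 1 ∨ ‖x.2.1‖ = 1} := by
    have c0 : ContinuousOn g {x | x.1 = 0} :=
      (show Continuous fun x : unitInterval × Disk n => a x.2 by fun_prop).continuousOn.congr
        fun x hx => g0 x hx
    have c1 : ContinuousOn g {x | x.1 = 1} :=
      (show Continuous fun x : unitInterval × Disk n => b x.2 by fun_prop).continuousOn.congr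
        fun x hx => g1 x hx
    have cs : ContinuousOn g {x | ‖x.2.1‖ = 1} := by
      rw [continuousOn_iff_continuous_domRestrict]
      have : Continuous fun x : {x : unitInterval × Disk n | ‖x.2.1‖ = 1} =>
          s (x.1.1, ⟨x.1.2.1, mem_sphere_zero_iff_norm.2 x.2⟩) := by fun_prop
      exact this.congr fun x => (gs x.1 x.2).symm
    exact c0.union_of_isClosed (c1.union_of_isClosed cs (isClosed_eq (by fun_prop) (by fun_prop))
      (isClosed_eq (by fun_prop) (by fun_prop))) (isClosed_eq (by fun_prop) (by fun_prop))
      (IsClosed.union (isClosed_eq (by fun_prop) (by fun_prop))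
        (isClosed_eq (by fun_prop) (by fun_prop)))
  obtain ⟨k, hk⟩ := hW.prism g hc
  refine ⟨k, fun d => ?_, fun d => ?_, fun t z => ?_⟩
  · rw [hk _ (Or.inl rfl), g0 _ rfl]
  · rw [hk _ (Or.inr (Or.inl rfl)), g1 _ rfl]
  · have hz : ‖(t, Sph.toDisk n z).2.1‖ = 1 := Sph.norm_toDisk z
    exact (hk _ (Or.inr (Or.inr hz))).trans (gs (t, Sph.toDisk n z) hz)

variable [DiscreteTopology G]

/-- Two cellular maps that induce the same transformation of fundamental functors are
`G`-homotopic. The homotopy is constant on vertices; it exists on edges since corresponding path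
classes agree, and on the remaining cells since the target has no homotopy in the relevant
degrees. It is encoded as a `G`-map into the space of paths of the target. -/
theorem gHomotopic_of_inducedTransf_eq {F : Set (Subgroup G)} {Y B : FilteredGSpace G}
    (hY : Y.IsCWComplex F)
    (hB : ∀ H ∈ F, ∀ m : ℕ, 2 ≤ m → ∀ x : B.fix H, Subsingleton (π_ m (B.fix H) x))
    (φ φ' : Y ⟶ B) (h : inducedTransf F φ = inducedTransf F φ') : GHomotopic φ φ' := by
  let f : CellularMap Y B := φ
  let f' : CellularMap Y B := φ'
  have hobj : ∀ {K : Subgroup G}, K ∈ F → ∀ y : (fixedPair Y K).pts,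
      f.toMap y.1.1 = f'.toMap y.1.1 :=
    fun {K} hK y => by
      have h1 := congrArg (fun α =>
        ((α.app (op ⟨K, hK⟩)).obj (show (fixedPair Y K).Grpoid from y))) h
      exact congrArg Subtype.val (congrArg Subtype.val h1)
  obtain ⟨ι₀, H₀, q₀, hH₀, hq₀⟩ := hY.attach 0
  have hvert : ∀ y ∈ Y.skel 0, f.toMap y = f'.toMap y := fun y hy => by
    obtain ⟨i, c, d, -, rfl⟩ := hq₀.surj hy (by exact id)
    obtain rfl : d = 0 := Subtype.ext (Subsingleton.elim _ _)
    induction c using Quotient.ind with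
    | _ a =>
      have h1 := hobj (hH₀ i) ⟨hq₀.charMap i 0, hq₀.mem _⟩
      change f.toMap (q₀ ⟨i, (a : G ⧸ H₀ i), 0⟩) = f'.toMap (q₀ ⟨i, (a : G ⧸ H₀ i), 0⟩)
      rw [hq₀.coset, f.map_smul, f'.map_smul]
      exact congrArg _ h1
  let R : Y.carrier → C(unitInterval, B.carrier) → Prop := fun y γ =>
    γ 0 = f.toMap y ∧ γ 1 = f'.toMap y ∧ (y ∈ Y.skel 0 → ∀ t, γ t = f.toMap y)
  have hR : ∀ (a : G) x t, R x t → R (a • x) (a • t) := by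
    rintro a x γ ⟨h0, h1, h2⟩
    refine ⟨?_, ?_, fun hx t => ?_⟩
    · rw [f.map_smul, ← h0]
      rfl
    · rw [f'.map_smul, ← h1]
      rfl
    · rw [f.map_smul, ← h2 (Y.smul_mem_iff.1 hx) t]
      rfl
  -- a prism in a fixed point space gives a map into the space of paths
  have of_prism : ∀ {n : ℕ} {K : Subgroup G} (k : C(unitInterval × Disk n, B.fix K)),
      ∃ U : C(Disk n, C(unitInterval, B.carrier)), (∀ a ∈ K, ∀ d, a • U d = U d) ∧
        ∀ d t, U d t = (k (t, d)).1 := fun {n K} k => by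
    let k' : C(Disk n × unitInterval, B.carrier) :=
      ⟨fun x => (k (x.2, x.1)).1,
        continuous_subtype_val.comp (k.continuous.comp continuous_swap)⟩
    refine ⟨k'.curry, fun a ha d => ?_, fun d t => rfl⟩
    ext t
    exact (k (t, d)).2 ⟨a, ha⟩
  obtain ⟨g, hga, hgR, -⟩ := IsPartialGMap.exists_extend_all hY hR 0
    (g₀ := fun y => ContinuousMap.const _ (f.toMap y))
    ⟨continuousOn_empty _, fun a x hx => hx.elim, fun x hx => hx.elim⟩
    (by
      intro n _ ι H q hH hq g hg _ i
      have hbd : ∀ d : Disk n, ‖d.1‖ = 1 → q ⟨i, baseCoset (H i), d⟩ ∈ Y.skelBelow n :=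
        fun d hd => hq.boundary_mem hd
      let e : C(Disk n, B.fix (H i)) := (fixMap f (H i)).toMap.comp (hq.charMap i)
      let e' : C(Disk n, B.fix (H i)) := (fixMap f' (H i)).toMap.comp (hq.charMap i)
      have he : ∀ d, f.toMap (q ⟨i, baseCoset (H i), d⟩) = (e d).1 := fun d => rfl
      have he' : ∀ d, f'.toMap (q ⟨i, baseCoset (H i), d⟩) = (e' d).1 := fun d => rfl
      rcases Nat.lt_or_ge n 2 with hn | hn
      · obtain rfl | rfl : n = 0 ∨ n = 1 := by omega
        · obtain ⟨U, hU, hUk⟩ := of_prism (K := H i) (e.comp ContinuousMap.snd)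
          refine ⟨U, hU, fun d hd => ?_, fun d => ⟨hUk d 0, ?_, fun _ t => hUk d t⟩⟩
          · rw [Subsingleton.elim d.1 0, norm_zero] at hd
            exact absurd hd zero_ne_one
          · rw [hUk]
            exact hvert _ (hq.mem _)
        · have hpts : ∀ d : Disk 1, ‖d.1‖ = 1 → e d = e' d := fun d hd =>
            Subtype.ext (hvert _ (hbd d hd))
          have hgb : ∀ d : Disk 1, ‖d.1‖ = 1 → ∀ t, g (q ⟨i, baseCoset (H i), d⟩) t = (e d).1 :=
            fun d hd t => (hg.rel _ (hbd d hd)).2.2 (hbd d hd) t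
          have hm : ∀ d : Disk 1, ‖d.1‖ = 1 → (e d).1 ∈ B.skel 0 := fun d hd =>
            f.map_skel 0 _ (hbd d hd)
          have hm' : ∀ d : Disk 1, ‖d.1‖ = 1 → (e' d).1 ∈ B.skel 0 := fun d hd =>
            f'.map_skel 0 _ (hbd d hd)
          obtain ⟨k, hk0, hk1, hks, hkt⟩ := exists_homotopy_of_heq
            (P := fixedPair B (H i))
            (x := ⟨e (segmentPoint 0), hm _ norm_segmentPoint_zero⟩)
            (y := ⟨e (segmentPoint 1), hm _ norm_segmentPoint_one⟩)
            (x' := ⟨e' (segmentPoint 0), hm' _ norm_segmentPoint_zero⟩)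
            (y' := ⟨e' (segmentPoint 1), hm' _ norm_segmentPoint_one⟩)
            (Subtype.ext (hpts _ norm_segmentPoint_zero))
            (Subtype.ext (hpts _ norm_segmentPoint_one))
            (segmentPath.map e.continuous) (segmentPath.map e'.continuous) (by
              have h1 := congrArg (fun α => α.app (op ⟨H i, hH i⟩)) h
              exact map_heq_of_eq (C := (fixedPair Y (H i)).Grpoid)
                (D := (fixedPair B (H i)).Grpoid) h1 (hq.edge i))
          obtain ⟨U, hU, hUk⟩ := of_prism (K := H i)
            (k.comp (ContinuousMap.prodMap (ContinuousMap.id _) segmentCoord))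
          have hUk' : ∀ s t, U (segmentPoint t) s = (k (s, t)).1 := fun s t => by
            rw [hUk]
            change (k (s, segmentCoord (segmentPoint t))).1 = _
            rw [segmentCoord_segmentPoint]
          have hUb : ∀ d : Disk 1, ‖d.1‖ = 1 → ∀ t, U d t = (e d).1 := fun d hd t => by
            rcases eq_segmentPoint_of_norm hd with rfl | rfl
            · rw [hUk', hks]
            · rw [hUk', hkt]
          refine ⟨U, hU, fun d hd => ?_, fun d => ⟨?_, ?_, fun hd t => ?_⟩⟩
          · ext t
            rw [hUb d hd, hgb d hd]
          · rw [he, ← segmentPoint_segmentCoord d, hUk', hk0]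
            rfl
          · rw [he', ← segmentPoint_segmentCoord d, hUk', hk1]
            rfl
          · refine hUb d (d.norm_lt_or_eq.resolve_left fun hd' => ?_) t
            exact (hq.interior_mem hd').2 hd
      · let s : C(unitInterval × Sph n, B.fix (H i)) :=
          ⟨fun x => ⟨g (q ⟨i, baseCoset (H i), Sph.toDisk n x.2⟩) x.1, fun k => by
            have h1 := hg.map_smul k _ (hbd _ (Sph.norm_toDisk x.2))
            rw [← hq.equivariant, smul_baseCoset] at h1
            exact (congrArg (fun γ : C(unitInterval, B.carrier) => γ x.1) h1).symm⟩, by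
            have h1 : Continuous fun z : Sph n => g (q ⟨i, baseCoset (H i), Sph.toDisk n z⟩) :=
              hg.cont.comp_continuous ((hq.continuous_cell i _).comp (Sph.toDisk n).continuous)
                fun z => hbd _ (Sph.norm_toDisk z)
            refine Continuous.subtype_mk ?_ _
            exact (h1.comp continuous_snd).eval continuous_fst⟩
        obtain ⟨k, hk0, hk1, hks⟩ := (diskExtends_of_trivial (hB (H i) (hH i))
          (n := n + 1) (by omega)).cylinder e e' s
          (fun z => Subtype.ext (hg.rel _ (hbd _ (Sph.norm_toDisk z))).1)
          (fun z => Subtype.ext (hg.rel _ (hbd _ (Sph.norm_toDisk z))).2.1)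
        obtain ⟨U, hU, hUk⟩ := of_prism (K := H i) k
        refine ⟨U, hU, fun d hd => ?_, fun d => ⟨?_, ?_, fun hd => ?_⟩⟩
        · ext t
          rw [hUk]
          exact congrArg Subtype.val (hks t ⟨d.1, mem_sphere_zero_iff_norm.2 hd⟩)
        · rw [hUk, hk0]
          rfl
        · rw [hUk, hk1]
          rfl
        · intro t
          have hd' : ‖d.1‖ = 1 := d.norm_lt_or_eq.resolve_left fun hd' =>
            (hq.interior_mem hd').2 (Y.skelBelow_mono (by omega) hd)
          have h1 := congrArg Subtype.val (hks t ⟨d.1, mem_sphere_zero_iff_norm.2 hd'⟩)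
          rw [hUk]
          exact h1.trans ((hg.rel _ (hbd d hd')).2.2 hd t))
  refine ⟨⟨⟨fun x => g x.2 x.1, (g.continuous.comp continuous_snd).eval continuous_fst⟩,
    fun x => (hgR x).1, fun x => (hgR x).2.1⟩,
    fun t a x => ?_⟩
  exact congrArg (fun γ : C(unitInterval, B.carrier) => γ t) (hga a x)

end EquivariantCW

namespace EquivariantCW

/-! ### Realization of transformations of fundamental functors -/

variable {G : Type u} [Group G] [TopologicalSpace G]

/-- The relation that expresses that a map is cellular. -/
def SkelRel (Y B : FilteredGSpace G) (y : Y.carrier) (b : B.carrier) : Prop :=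
  ∀ n, y ∈ Y.skel n → b ∈ B.skel n

variable {Y B : FilteredGSpace G}

lemma SkelRel.smul (a : G) (y : Y.carrier) (b : B.carrier) (h : SkelRel Y B y b) :
    SkelRel Y B (a • y) (a • b) :=
  fun n hn => B.smul_mem n a b (h n (Y.smul_mem_iff.1 hn))

/-- The restriction of a partial map to a skeleton. -/
def IsPartialGMap.toCellularMap {k : ℕ} {g : Y.carrier → B.carrier}
    (hg : IsPartialGMap Y (SkelRel Y B) (Y.skel k) g) : Y.skeleton k ⟶ B :=
  CellularMap.mk (X := Y.skeleton k) (Y := B)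
    ⟨fun x => g x.1, hg.cont.comp_continuous continuous_subtype_val fun x => x.2⟩
    (fun a x => hg.map_smul a x.1 x.2) fun n x hx => hg.rel x.1 x.2 n hx

/-- For an extension of a cellular map over a cell of dimension `n` to be cellular it suffices that
the cell is mapped to the stage `n`. -/
lemma IsAttachingMap.skelRel {n : ℕ} {ι : Type u} {H : ι → Subgroup G} {q : Cells H n → Y.carrier}
    (hq : IsAttachingMap Y n H q) {g : Y.carrier → B.carrier}
    (hg : IsPartialGMap Y (SkelRel Y B) (Y.skelBelow n) g) (i : ι) (U : Disk n → B.carrier)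
    (hU : ∀ d, ‖d.1‖ = 1 → U d = g (q ⟨i, baseCoset (H i), d⟩)) (hUn : ∀ d, U d ∈ B.skel n)
    (d : Disk n) : SkelRel Y B (q ⟨i, baseCoset (H i), d⟩) (U d) := by
  intro m hm
  rcases d.norm_lt_or_eq with hd | hd
  · rcases le_or_gt n m with h | h
    · exact B.mono h (hUn d)
    · exact absurd (Y.skelBelow_mono h hm) (hq.interior_mem hd).2
  · rw [hU d hd]
    exact hg.rel _ (hq.mem_skelBelow hd) m hm

variable {F : Set (Subgroup G)}

/-- A non-empty complex has a vertex. -/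
lemma FilteredGSpace.IsCWComplex.exists_mem_skel_zero (hY : Y.IsCWComplex F) (y : Y.carrier) :
    ∃ v, v ∈ Y.skel 0 := by
  obtain ⟨n, hn⟩ := Y.exhaust y
  induction n generalizing y with
  | zero => exact ⟨y, hn⟩
  | succ n ih =>
    by_cases hy : y ∈ Y.skel n
    · exact ih y hy
    · obtain ⟨ι, H, q, -, hq⟩ := hY.attach (n + 1)
      obtain ⟨i, c, -⟩ := hq.surj hn hy
      exact ih _ (hq.mem_skelBelow (i := i) (c := c)
        (d := ⟨EuclideanSpace.single 0 1, by simp⟩) (by simp))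

variable [DiscreteTopology G]

/-- A disk in a fixed point space whose boundary lies in the stage of its dimension can be replaced
by one that lies entirely in that stage. -/
lemma exists_disk_mem_skel (hB : B.IsCWComplex F) {K : Subgroup G} {n : ℕ} (u : C(Sph n, B.fix K))
    (hu : ∀ s, (u s).1 ∈ B.skel n) (hU : ∃ U : C(Disk n, B.fix K), U.comp (Sph.toDisk n) = u) :
    ∃ U : C(Disk n, B.fix K), (∀ d, (U d).1 ∈ B.skel n) ∧ ∀ s, U (Sph.toDisk n s) = u s := by
  obtain ⟨U, rfl⟩ := hU
  obtain ⟨U', ⟨hUU⟩, hU'⟩ := (hB.isCellFiltration K).approx (lowDim_disk n) U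
  exact ⟨U', hU', fun s => (hUU.fst_eq_snd (hu s)).symm⟩

/-- Loops in a fixed point space of the one-skeleton that are null homotopic in the whole complex
are mapped to null homotopic loops by a map on the one-skeleton that realizes a transformation of
fundamental functors. -/
lemma map_eq_id_of_transf (hY : Y.IsCWComplex F)
    (Ψ : fundamentalFunctor F Y ⟶ fundamentalFunctor F B) (φ : Y.skeleton 1 ⟶ B)
    (hφ : inducedTransf F φ = inducedTransf F (Y.skeletonIncl 1) ≫ Ψ) {K : Subgroup G}
    (hK : K ∈ F) (v : (Y.skeleton 1).fix K) (b : (⟨v⟩ : FundamentalGroupoid _) ⟶ ⟨v⟩)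
    (hb : (FundamentalGroupoid.map (fixMap (Y.skeletonIncl 1) K).toMap).map b = 𝟙 _) :
    (FundamentalGroupoid.map (fixMap φ K).toMap).map b = 𝟙 _ := by
  -- a path that connects the base point of the loop with a vertex
  obtain ⟨v₀, hv₀, ⟨a⟩⟩ : ∃ v₀ : (Y.skeleton 1).fix K,
      v₀.1.1 ∈ Y.skel 0 ∧ Nonempty (Path v₀ v) := by
    by_cases hv : v.1.1 ∈ Y.skel 0
    · exact ⟨v, hv, ⟨Path.refl v⟩⟩
    · obtain ⟨ι, H, q, -, hq⟩ := (hY.skeleton 1).attach 1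
      have hC := (hY.skeleton 1).cellAttach_fix K hq
      obtain ⟨j, d, -, rfl⟩ := hC.surj v v.1.2 hv
      obtain ⟨p⟩ := PathConnectedSpace.joined (segmentPoint 0) d
      exact ⟨_, hC.boundary_mem j _ norm_segmentPoint_zero, ⟨p.map (hC.cont j)⟩⟩
  let f := FundamentalGroupoid.map (fixMap φ K).toMap
  let i := FundamentalGroupoid.map (fixMap (Y.skeletonIncl 1) K).toMap
  let l : (⟨v₀⟩ : FundamentalGroupoid _) ⟶ ⟨v₀⟩ := pathClass a ≫ b ≫ Groupoid.inv (pathClass a)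
  have hl : i.map l = 𝟙 _ := by
    rw [CategoryTheory.Functor.map_comp, CategoryTheory.Functor.map_comp, functor_map_groupoidInv,
      hb, Category.id_comp, Groupoid.comp_inv]
  let x : (fixedPair (Y.skeleton 1) K).pts := ⟨v₀, hv₀⟩
  let l' : (show (fixedPair (Y.skeleton 1) K).Grpoid from x) ⟶ x := InducedCategory.homMk l
  have h1 : HEq ((fixMap φ K).grpoidMap.map l') ((show (fixedPair Y K).Grpoid ⥤
      (fixedPair B K).Grpoid from Ψ.app (op ⟨K, hK⟩)).map
        ((fixMap (Y.skeletonIncl 1) K).grpoidMap.map l')) :=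
    map_heq_of_eq (C := (fixedPair (Y.skeleton 1) K).Grpoid) (D := (fixedPair B K).Grpoid)
      (congrArg (fun α => α.app (op ⟨K, hK⟩)) hφ) l'
  have h2 : (fixMap (Y.skeletonIncl 1) K).grpoidMap.map l' = 𝟙 _ :=
    InducedCategory.hom_ext hl
  rw [h2, CategoryTheory.Functor.map_id] at h1
  have h3 : (fixMap φ K).grpoidMap.map l' = 𝟙 _ := by
    have hx : (fixMap φ K).grpoidMap.obj x = (show (fixedPair Y K).Grpoid ⥤
      (fixedPair B K).Grpoid from Ψ.app (op ⟨K, hK⟩)).obj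
        ((fixMap (Y.skeletonIncl 1) K).grpoidMap.obj x) :=
      congrArg (fun α => (show (fixedPair (Y.skeleton 1) K).Grpoid ⥤ (fixedPair B K).Grpoid from
        α.app (op ⟨K, hK⟩)).obj x) hφ
    refine eq_of_heq (h1.trans ?_)
    rw [hx]
  have h4 := congrArg (fun p => InducedCategory.Hom.hom p) h3
  change f.map l = 𝟙 _ at h4
  rw [CategoryTheory.Functor.map_comp, CategoryTheory.Functor.map_comp,
    functor_map_groupoidInv] at h4
  have h5 : f.map (pathClass a) ≫ f.map b = f.map (pathClass a) := by
    have := congrArg (· ≫ f.map (pathClass a)) h4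
    simpa using this
  have h6 := congrArg (Groupoid.inv (f.map (pathClass a)) ≫ ·) h5
  rw [← Category.assoc, Groupoid.inv_comp, Category.id_comp] at h6
  exact h6

/-- Every transformation of fundamental functors with values in a complex whose fixed point spaces
have no homotopy from degree two on is induced by a cellular map. -/
theorem exists_inducedTransf_eq (hY : Y.IsCWComplex F) (hB : B.IsCWComplex F)
    (hB' : ∀ H ∈ F, ∀ m : ℕ, 2 ≤ m → ∀ x : B.fix H, Subsingleton (π_ m (B.fix H) x))
    (Ψ : fundamentalFunctor F Y ⟶ fundamentalFunctor F B) :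
    ∃ φ : Y ⟶ B, inducedTransf F φ = Ψ := by
  let Ψ' : ∀ {K : Subgroup G}, K ∈ F → (fixedPair Y K).Grpoid ⥤ (fixedPair B K).Grpoid :=
    fun {K} hK => Ψ.app (op ⟨K, hK⟩)
  obtain ⟨ι₀, H₀, q₀, hH₀, hq₀⟩ := hY.attach 0
  obtain ⟨ι₁, H₁, q₁, hH₁, hq₁⟩ := hY.attach 1
  have hcomp : ∀ {P : FilteredGSpace G} (α : P ⟶ Y) {K : Subgroup G} (hK : K ∈ F),
      (show (fixedPair P K).Grpoid ⥤ (fixedPair B K).Grpoid from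
        (inducedTransf F α ≫ Ψ).app (op ⟨K, hK⟩)) = (fixMap α K).grpoidMap ⋙ Ψ' hK :=
    fun _ _ _ => rfl
  -- vertices
  let w : ∀ i, (fixedPair B (H₀ i)).pts := fun i => (Ψ' (hH₀ i)).obj (hq₀.vertex i)
  have hno : ∀ (d : Disk 0), ‖d.1‖ ≠ 1 := fun d hd => by
    rw [Subsingleton.elim d.1 0, norm_zero] at hd
    exact zero_ne_one hd
  -- the zero-skeleton
  obtain ⟨g₀, hg₀, hg₀q⟩ : ∃ g₀ : Y.carrier → B.carrier,
      IsPartialGMap Y (SkelRel Y B) (Y.skel 0) g₀ ∧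
        ∀ i d, g₀ (q₀ ⟨i, baseCoset (H₀ i), d⟩) = (w i).1.1 := by
    obtain ⟨g, hg⟩ : ∃ g : Y.carrier → B.carrier,
        IsPartialGMap Y (SkelRel Y B) (Y.skelBelow 0) g := by
      have hne : ∀ y : Y.carrier, Nonempty B.carrier := fun y => by
        obtain ⟨v, hv⟩ := hY.exists_mem_skel_zero y
        obtain ⟨i, -⟩ := hq₀.surj hv (by exact id)
        exact ⟨(w i).1.1⟩
      exact ⟨fun y => (hne y).some, continuousOn_empty _, fun a x hx => hx.elim,
        fun x hx => hx.elim⟩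
    obtain ⟨g₀, h1, -, h2⟩ := hg.exists_extend hY SkelRel.smul hq₀
      (fun i => ContinuousMap.const _ (w i).1.1) (fun i a ha d => (w i).1.2 ⟨a, ha⟩)
      (fun i d hd => absurd hd (hno d))
      (fun i => hq₀.skelRel hg i _ (fun d hd => absurd hd (hno d)) fun d => (w i).2)
    exact ⟨g₀, h1, h2⟩
  have hφ₀ : inducedTransf F hg₀.toCellularMap = inducedTransf F (Y.skeletonIncl 0) ≫ Ψ := by
    refine transf_ext (hY.skeleton 0) _ _ hH₀ (ι₁ := PEmpty) (fun i => i.elim)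
      (hq₀.skeleton le_rfl) (isAttachingMap_of_isEmpty (Y.skeleton 0) (n := 1)
        (fun (x : Y.skel 0) _ => x.2) (fun i => i.elim)
        fun z => z.1.elim) (fun i => ?_) (fun i => i.elim)
    exact Subtype.ext (Subtype.ext (hg₀q i 0))
  have hobj : ∀ {K : Subgroup G} (hK : K ∈ F) (y : (fixedPair Y K).pts),
      g₀ y.1.1 = (show (fixedPair B K).pts from (Ψ' hK).obj y).1.1 := fun {K} hK y => by
    let y' : (fixedPair (Y.skeleton 0) K).pts :=
      ⟨⟨⟨y.1.1, y.2⟩, fun k => Subtype.ext (y.1.2 k)⟩, y.2⟩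
    have h1 := congrArg (fun α => (show (fixedPair (Y.skeleton 0) K).Grpoid ⥤
      (fixedPair B K).Grpoid from α.app (op ⟨K, hK⟩)).obj y') hφ₀
    exact congrArg Subtype.val (congrArg Subtype.val h1)
  -- edges
  have hedge : ∀ i, ∃ p : C(Disk 1, B.fix (H₁ i)), (∀ d, (p d).1 ∈ B.skel 1) ∧
      (∀ d, ‖d.1‖ = 1 → (p d).1 = g₀ (q₁ ⟨i, baseCoset (H₁ i), d⟩)) ∧
      ∀ (e : C(Disk 1, B.fix (H₁ i))) (h₀ : (e (segmentPoint 0)).1 ∈ B.skel 0)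
        (h₁ : (e (segmentPoint 1)).1 ∈ B.skel 0), (∀ d, (e d).1 = (p d).1) →
        HEq (basedClass (P := fixedPair B (H₁ i)) (x := ⟨_, h₀⟩) (y := ⟨_, h₁⟩)
          (segmentPath.map e.continuous)) ((Ψ' (hH₁ i)).map (hq₁.edge i)) := fun i => by
    let K := H₁ i
    let v₀ : (fixedPair Y K).pts :=
      ⟨hq₁.charMap i (segmentPoint 0), hq₁.mem_skelBelow norm_segmentPoint_zero⟩
    let v₁ : (fixedPair Y K).pts :=
      ⟨hq₁.charMap i (segmentPoint 1), hq₁.mem_skelBelow norm_segmentPoint_one⟩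
    let x₀ : (fixedPair B K).pts := (Ψ' (hH₁ i)).obj v₀
    let x₁ : (fixedPair B K).pts := (Ψ' (hH₁ i)).obj v₁
    let m : (show (fixedPair B K).Grpoid from x₀) ⟶ x₁ := (Ψ' (hH₁ i)).map (hq₁.edge i)
    obtain ⟨r, hr⟩ := Path.Homotopic.Quotient.mk_surjective (x₀ := x₀.1) (x₁ := x₁.1) m.hom
    obtain ⟨r', ⟨hrr⟩, hr'⟩ := (hB.isCellFiltration K).approx lowDim_unitInterval r.toContinuousMap
    have h0 : (0 : unitInterval) ∈ r.toContinuousMap ⁻¹' {x | x.1 ∈ B.skel 1} := by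
      change (r 0).1 ∈ B.skel 1
      rw [r.source]
      exact B.mono zero_le_one x₀.2
    have h1 : (1 : unitInterval) ∈ r.toContinuousMap ⁻¹' {x | x.1 ∈ B.skel 1} := by
      change (r 1).1 ∈ B.skel 1
      rw [r.target]
      exact B.mono zero_le_one x₁.2
    let r'' : Path x₀.1 x₁.1 := ⟨r', (hrr.fst_eq_snd h0).symm.trans r.source,
      (hrr.fst_eq_snd h1).symm.trans r.target⟩
    have hclass : basedClass r'' = m := by
      apply InducedCategory.hom_ext
      rw [← hr]
      refine (Path.Homotopic.Quotient.eq.2 ⟨⟨hrr.toHomotopy, fun t s hs => hrr.prop t s ?_⟩⟩).symm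
      rcases hs with rfl | rfl
      · exact h0
      · exact h1
    refine ⟨r'.comp segmentCoord, fun d => hr' _, fun d hd => ?_, fun e h₀ h₁ he => ?_⟩
    · rcases eq_segmentPoint_of_norm hd with rfl | rfl
      · change (r' (segmentCoord (segmentPoint 0))).1 = _
        rw [segmentCoord_segmentPoint]
        exact (congrArg Subtype.val r''.source).trans (hobj (hH₁ i) v₀).symm
      · change (r' (segmentCoord (segmentPoint 1))).1 = _
        rw [segmentCoord_segmentPoint]
        exact (congrArg Subtype.val r''.target).trans (hobj (hH₁ i) v₁).symm
    · have hp : ∀ t, e (segmentPoint t) = r'' t := fun t => by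
        refine (Subtype.ext (he _)).trans ?_
        change r' (segmentCoord (segmentPoint t)) = _
        rw [segmentCoord_segmentPoint]
        rfl
      exact (basedClass_heq (x' := x₀) (y' := x₁) (Subtype.ext ((hp 0).trans r''.source))
        (Subtype.ext ((hp 1).trans r''.target)) _ r'' hp).trans hclass.heq
  choose p hp₁ hpb hpe using hedge
  obtain ⟨g₁, hg₁, hg₁₀, hg₁q⟩ := hg₀.exists_extend (n := 1) hY SkelRel.smul hq₁
    (fun i => ⟨fun d => (p i d).1, by fun_prop⟩) (fun i a ha d => (p i d).2 ⟨a, ha⟩)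
    (fun i d hd => hpb i d hd) (fun i => hq₁.skelRel hg₀ i _ (hpb i) (hp₁ i))
  have hφ₁ : inducedTransf F hg₁.toCellularMap = inducedTransf F (Y.skeletonIncl 1) ≫ Ψ := by
    refine transf_ext (hY.skeleton 1) _ _ hH₀ hH₁
      (hq₀.skeleton zero_le_one) (hq₁.skeleton le_rfl) (fun i => ?_) (fun i => ?_)
    · exact Subtype.ext (Subtype.ext ((hg₁₀ (hq₀.mem _)).trans (hg₀q i 0)))
    · exact hpe i ((fixMap hg₁.toCellularMap (H₁ i)).toMap.comp
        ((hq₁.skeleton le_rfl).charMap i)) _ _ fun d => hg₁q i d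
  -- cells of higher dimension
  obtain ⟨φ, hφs, hφR, hφg⟩ := IsPartialGMap.exists_extend_all hY SkelRel.smul 2 (g₀ := g₁) hg₁ (by
    intro n hn ι H q hH hq g hg hgg i
    let u : C(Sph n, B.fix (H i)) :=
      ⟨fun z => ⟨g (q ⟨i, baseCoset (H i), Sph.toDisk n z⟩), fun k => by
        have h1 := hg.map_smul k _ (hq.mem_skelBelow (i := i) (c := baseCoset (H i))
          (Sph.norm_toDisk z))
        rw [← hq.equivariant, smul_baseCoset] at h1
        exact h1.symm⟩,
        (hg.cont.comp_continuous ((hq.continuous_cell i _).comp (Sph.toDisk n).continuous)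
          fun z => hq.mem_skelBelow (Sph.norm_toDisk z)).subtype_mk _⟩
    have hU : ∃ U : C(Disk n, B.fix (H i)), U.comp (Sph.toDisk n) = u := by
      rcases hn.eq_or_lt with rfl | hn
      · let f : C((Y.skeleton 1).fix (H i), B.fix (H i)) := (fixMap hg₁.toCellularMap (H i)).toMap
        let v : C(Sph 2, (Y.skeleton 1).fix (H i)) :=
          ⟨fun z => ⟨⟨q ⟨i, baseCoset (H i), Sph.toDisk 2 z⟩, hq.mem_skelBelow (Sph.norm_toDisk z)⟩,
            fun k => Subtype.ext ((hq.charMap i (Sph.toDisk 2 z)).2 k)⟩,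
            (((hq.continuous_cell i _).comp (Sph.toDisk 2).continuous).subtype_mk _).subtype_mk _⟩
        have huv : u = f.comp v := ContinuousMap.ext fun z =>
          Subtype.ext (hgg (hq.mem_skelBelow (Sph.norm_toDisk z)))
        rw [huv]
        obtain ⟨e, l, hl⟩ := exists_loop_extends
        refine hl (f.comp v) (Path.Homotopic.Quotient.exact ?_)
        refine map_eq_id_of_transf hY Ψ hg₁.toCellularMap hφ₁ (hH i) (v e)
          (pathClass (l.map v.continuous)) ?_
        have hsub : pathClass (l.map (Sph.toDisk 2).continuous) = 𝟙 _ :=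
          @Subsingleton.elim (Path.Homotopic.Quotient _ _) _ _ _
        exact congrArg (FundamentalGroupoid.map (hq.charMap i)).map hsub
      · exact diskExtends_of_trivial (hB' (H i) (hH i)) hn u
    obtain ⟨U, hUn, hUu⟩ := exists_disk_mem_skel hB u (fun z => B.mono le_rfl (by
      have hz := hq.mem_skelBelow (i := i) (c := baseCoset (H i)) (Sph.norm_toDisk z)
      exact hg.rel _ hz n (Y.skelBelow_subset n hz))) hU
    have hUb : ∀ d : Disk n, ‖d.1‖ = 1 → (U d).1 = g (q ⟨i, baseCoset (H i), d⟩) := fun d hd =>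
      congrArg Subtype.val (hUu ⟨d.1, mem_sphere_zero_iff_norm.2 hd⟩)
    exact ⟨⟨fun d => (U d).1, by fun_prop⟩, fun a ha d => (U d).2 ⟨a, ha⟩, hUb,
      hq.skelRel hg i _ hUb hUn⟩)
  let f : Y ⟶ B := CellularMap.mk φ hφs fun n x hx => hφR x n hx
  refine ⟨f, transf_ext hY _ _ hH₀ hH₁ hq₀ hq₁ (fun i => ?_) (fun i => ?_)⟩
  · exact Subtype.ext (Subtype.ext ((hφg (Y.mono zero_le_one (hq₀.mem _))).trans
      ((hg₁₀ (hq₀.mem _)).trans (hg₀q i 0))))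
  · exact hpe i ((fixMap f (H₁ i)).toMap.comp (hq₁.charMap i)) _ _
      fun d => (hφg (hq₁.mem _)).trans (hg₁q i d)

end EquivariantCW

namespace EquivariantCW

/-! ### Attaching equivariant cells -/

section

variable {G : Type u} [Group G] [TopologicalSpace G]

/-- The set that underlies the result of attaching equivariant cells to `Z`: the points of `Z` and
the points in the interior of the new cells. -/
def Attached (Z : FilteredGSpace G) (n : ℕ) {ι : Type u} (H : ι → Subgroup G) : Type u :=
  Z.carrier ⊕ Σ p : ι × {d : Disk n // ‖d.1‖ < 1}, G ⧸ H p.1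

variable {Z : FilteredGSpace G} {n : ℕ} {ι : Type u} {H : ι → Subgroup G}

instance : MulAction G (Attached Z n H) :=
  inferInstanceAs (MulAction G (Z.carrier ⊕ Σ p : ι × {d : Disk n // ‖d.1‖ < 1}, G ⧸ H p.1))

variable (u : ∀ i, C(Sph n, Z.fix (H i)))

open Classical in
/-- The characteristic maps of the new cells, which are attached along the maps given by `u`. -/
noncomputable def attachCell (z : Cells H n) : Attached Z n H :=
  if h : ‖z.2.2.1‖ = 1 then
    Sum.inl (orbitMap Z (H z.1) (u z.1 ⟨z.2.2.1, mem_sphere_zero_iff_norm.2 h⟩) z.2.1)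
  else Sum.inr ⟨(z.1, ⟨z.2.2, z.2.2.norm_lt_or_eq.resolve_right h⟩), z.2.1⟩

lemma attachCell_boundary (i : ι) (c : G ⧸ H i) (s : Sph n) :
    attachCell u ⟨i, c, Sph.toDisk n s⟩ = Sum.inl (orbitMap Z (H i) (u i s) c) :=
  dif_pos s.norm_eq

lemma attachCell_interior (i : ι) (c : G ⧸ H i) (d : Disk n) (hd : ‖d.1‖ < 1) :
    attachCell u ⟨i, c, d⟩ = Sum.inr ⟨(i, ⟨d, hd⟩), c⟩ :=
  dif_neg hd.ne

lemma attachCell_smul (g : G) (i : ι) (c : G ⧸ H i) (d : Disk n) :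
    attachCell u ⟨i, g • c, d⟩ = g • attachCell u ⟨i, c, d⟩ := by
  rcases d.norm_lt_or_eq with hd | hd
  · rw [attachCell_interior u i _ d hd, attachCell_interior u i _ d hd]
    rfl
  · obtain ⟨s, rfl⟩ : ∃ s : Sph n, Sph.toDisk n s = d := ⟨⟨d.1, mem_sphere_zero_iff_norm.2 hd⟩, rfl⟩
    rw [attachCell_boundary, attachCell_boundary, orbitMap_smul]
    rfl

/-- The projection from the disjoint union of `Z` and the closed cells. -/
noncomputable def attachProj : Z.carrier ⊕ Cells H n → Attached Z n H :=
  Sum.elim Sum.inl (attachCell u)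

/-- The quotient topology on the result of attaching cells. -/
@[reducible]
noncomputable def attachTop : TopologicalSpace (Attached Z n H) :=
  TopologicalSpace.coinduced (attachProj u) inferInstance

lemma isQuotientMap_attachProj : @IsQuotientMap _ _ _ (attachTop u) (attachProj u) := by
  let _ := attachTop u
  refine ⟨⟨rfl⟩, fun x => ?_⟩
  rcases x with z | ⟨⟨i, d, hd⟩, c⟩
  · exact ⟨Sum.inl z, rfl⟩
  · exact ⟨Sum.inr ⟨i, c, d⟩, attachCell_interior u i c d hd⟩

lemma isClosed_attached_iff [DiscreteTopology G] (A : Set (Attached Z n H)) :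
    IsClosed[attachTop u] A ↔ IsClosed {z : Z.carrier | (Sum.inl z : Attached Z n H) ∈ A} ∧
      ∀ i c, IsClosed {d : Disk n | attachCell u ⟨i, c, d⟩ ∈ A} := by
  let _ := attachTop u
  rw [← (isQuotientMap_attachProj u).isClosed_preimage, isClosed_sum_iff, isClosed_sigma_iff]
  refine and_congr Iff.rfl (forall_congr' fun i => ⟨fun h c => ?_, fun h => ?_⟩)
  · exact h.preimage (show Continuous fun d : Disk n => (c, d) by fun_prop)
  · rw [← isOpen_compl_iff, isOpen_iff_continuous_mem]
    refine continuous_prod_of_discrete_left.2 fun c => ?_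
    have := (h c).isOpen_compl
    rw [isOpen_iff_continuous_mem] at this
    exact this

lemma isClosedEmbedding_attached_inl [DiscreteTopology G] :
    @IsClosedEmbedding _ _ _ (attachTop u) (Sum.inl : Z.carrier → Attached Z n H) := by
  let _ := attachTop u
  refine .of_continuous_injective_isClosedMap
    ((isQuotientMap_attachProj u).continuous.comp continuous_inl) Sum.inl_injective fun A hA => ?_
  refine (isClosed_attached_iff u _).2 ⟨?_, fun i c => ?_⟩
  · exact isClosed_of_mem_iff hA fun z => Sum.inl_injective.mem_set_image
  · have hb : IsClosed {d : Disk n | ‖d.1‖ = 1} := isClosed_eq (by fun_prop) (by fun_prop)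
    have hs : IsClosedEmbedding (Sph.toDisk n) := by
      refine (Sph.toDisk n).continuous.isClosedEmbedding fun s t h => ?_
      exact Subtype.ext (congrArg (fun d : Disk n => d.1) h)
    refine isClosed_of_mem_iff (hs.isClosedMap _ (hA.preimage
      ((continuous_orbitMap Z (H i) c).comp (u i).continuous))) fun d => ?_
    constructor
    · rintro ⟨z, hz, hzd⟩
      rcases d.norm_lt_or_eq with hd | hd
      · rw [attachCell_interior u i c d hd] at hzd
        exact absurd hzd Sum.inl_ne_inr
      · obtain ⟨s, rfl⟩ : ∃ s : Sph n, Sph.toDisk n s = d :=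
          ⟨⟨d.1, mem_sphere_zero_iff_norm.2 hd⟩, rfl⟩
        rw [attachCell_boundary] at hzd
        obtain rfl := Sum.inl_injective hzd
        exact ⟨s, hz, rfl⟩
    · rintro ⟨s, hs, rfl⟩
      exact ⟨_, hs, (attachCell_boundary u i c s).symm⟩

end

section

variable {G : Type u} [Group G] [TopologicalSpace G] [DiscreteTopology G] {Z : FilteredGSpace G}
  {n : ℕ} {ι : Type u} {H : ι → Subgroup G} (u : ∀ i, C(Sph (n + 1), Z.fix (H i)))

/-- The filtered space obtained by attaching cells of dimension `n + 1`. Its stages up to `n` are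
those of `Z`, and the stages from `n + 1` on are everything. -/
noncomputable def attach : FilteredGSpace G where
  carrier := Attached Z (n + 1) H
  top := attachTop u
  cont := by
    let _ := attachTop u
    refine ⟨continuous_prod_of_discrete_left.2 fun g => ?_⟩
    refine (isQuotientMap_attachProj u).continuous_iff.2 (continuous_sum_dom.2 ⟨?_, ?_⟩)
    · exact (isClosedEmbedding_attached_inl u).continuous.comp (continuous_const_smul g)
    · have h : Continuous fun z : Cells H (n + 1) =>
          attachCell u (⟨z.1, g • z.2.1, z.2.2⟩ : Cells H (n + 1)) := by
        refine ((isQuotientMap_attachProj u).continuous.comp continuous_inr).comp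
          (continuous_sigma fun i => continuous_sigmaMk.comp ?_)
        exact ((continuous_of_discreteTopology (f := fun c : G ⧸ H i => g • c)).comp
          continuous_fst).prodMk continuous_snd
      exact h.congr fun z => attachCell_smul u g z.1 z.2.1 z.2.2
  skel m := {x | (∃ z ∈ Z.skel m, (Sum.inl z : Attached Z (n + 1) H) = x) ∨ n < m}
  smul_mem m g x := by
    rintro (⟨z, hz, rfl⟩ | h)
    · exact Or.inl ⟨g • z, Z.smul_mem m g z hz, rfl⟩
    · exact Or.inr h
  mono m k hmk := by
    rintro x (⟨z, hz, rfl⟩ | h)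
    · exact Or.inl ⟨z, Z.mono hmk hz, rfl⟩
    · exact Or.inr (h.trans_le hmk)
  exhaust x := ⟨n + 1, Or.inr (Nat.lt_succ_self n)⟩

/-- The inclusion into the result of attaching cells. -/
noncomputable def attachInl (z : Z.carrier) : (attach u).carrier :=
  (Sum.inl z : Attached Z (n + 1) H)

lemma isClosedEmbedding_attachInl : IsClosedEmbedding (attachInl u) :=
  isClosedEmbedding_attached_inl u

/-- The inclusion into the result of attaching cells, as a cellular map. -/
noncomputable def attachIncl : Z ⟶ attach u :=
  CellularMap.mk (X := Z) (Y := attach u)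
    ⟨attachInl u, (isClosedEmbedding_attachInl u).continuous⟩ (fun _ _ => rfl)
    fun _ z hz => Or.inl ⟨z, hz, rfl⟩

lemma attach_inl_mem_iff (hZ : Z.skel n = Set.univ) (m : ℕ) (z : Z.carrier) :
    attachInl u z ∈ (attach u).skel m ↔ z ∈ Z.skel m := by
  constructor
  · rintro (⟨z', hz', h⟩ | h)
    · rwa [← Sum.inl_injective h]
    · exact Z.mono h.le (hZ ▸ Set.mem_univ z)
  · exact fun h => Or.inl ⟨z, h, rfl⟩

lemma attach_skel_subset_range {m : ℕ} (hm : m ≤ n) :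
    (attach u).skel m ⊆ Set.range (attachInl u) := by
  rintro x (⟨z, hz, rfl⟩ | h)
  · exact ⟨z, rfl⟩
  · omega

lemma isAttachingMap_attach (hZ : Z.skel n = Set.univ) :
    IsAttachingMap (attach u) (n + 1) H (attachCell u) where
  equivariant := attachCell_smul u
  boundary_mem := by
    rintro ⟨i, c, d⟩ hd
    refine Or.inl ⟨_, hZ ▸ Set.mem_univ _, (attachCell_boundary u i c ⟨d.1,
      mem_sphere_zero_iff_norm.2 hd⟩).symm⟩
  bijOn := by
    refine ⟨?_, ?_, ?_⟩
    · rintro ⟨i, c, d⟩ hd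
      rw [attachCell_interior u i c d (d.norm_lt_or_eq.resolve_right hd)]
      refine ⟨Or.inr (Nat.lt_succ_self n), ?_⟩
      rintro (⟨z, -, h⟩ | h)
      · exact Sum.inl_ne_inr h
      · exact lt_irrefl _ h
    · rintro ⟨i, c, d⟩ hd ⟨i', c', d'⟩ hd' h
      rw [attachCell_interior u i c d (d.norm_lt_or_eq.resolve_right hd),
        attachCell_interior u i' c' d' (d'.norm_lt_or_eq.resolve_right hd')] at h
      have h1 := Sum.inr_injective h
      obtain ⟨h2, h3⟩ := Sigma.mk.inj h1
      obtain ⟨rfl, h4⟩ := Prod.mk.inj h2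
      obtain rfl : d = d' := congrArg Subtype.val h4
      obtain rfl := eq_of_heq h3
      rfl
    · rintro (z | ⟨⟨i, d, hd⟩, c⟩) ⟨-, h⟩
      · exact absurd (Or.inl ⟨z, hZ ▸ Set.mem_univ z, rfl⟩) h
      · exact ⟨⟨i, c, d⟩, hd.ne, attachCell_interior u i c d hd⟩
  mem z := Or.inr (Nat.lt_succ_self n)
  quotient := by
    let _ := attachTop u
    have huniv : ∀ x : Attached Z (n + 1) H, x ∈ (attach u).skel (n + 1) :=
      fun x => Or.inr (Nat.lt_succ_self n)
    let f : Z.carrier ⊕ Cells H (n + 1) → (attach u).skel n ⊕ Cells H (n + 1) :=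
      Sum.map (fun z => ⟨Sum.inl z, Or.inl ⟨z, hZ ▸ Set.mem_univ z, rfl⟩⟩) id
    have hf : Continuous f := by
      refine Continuous.sumMap ?_ continuous_id
      exact (isClosedEmbedding_attached_inl u).continuous.subtype_mk _
    have hπ := (isQuotientMap_attachProj u).continuous
    let e : (attach u).carrier ≃ₜ (attach u).skel (n + 1) :=
      { toFun := fun x => ⟨x, huniv x⟩
        invFun := Subtype.val
        left_inv := fun x => rfl
        right_inv := fun x => rfl
        continuous_toFun := continuous_id.subtype_mk _
        continuous_invFun := continuous_subtype_val }
    have he : IsQuotientMap (e ∘ attachProj u) := e.isQuotientMap.comp (isQuotientMap_attachProj u)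
    refine IsQuotientMap.of_comp hf ?_ (?_ : IsQuotientMap (_ ∘ f))
    · refine continuous_sum_dom.2 ⟨continuous_inclusion ((attach u).skelBelow_subset (n + 1)), ?_⟩
      exact (hπ.comp continuous_inr).subtype_mk _
    · convert he using 1
      funext z
      rcases z with z | z <;> rfl

lemma isCWComplex_attach {F : Set (Subgroup G)} (hZ : Z.IsCWComplex F) (hn : Z.skel n = Set.univ)
    (hH : ∀ i, H i ∈ F) : (attach u).IsCWComplex F where
  isClosed_iff A := by
    refine ⟨fun h m => h.preimage continuous_subtype_val, fun h => ?_⟩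
    exact isClosed_of_mem_iff ((h (n + 1)).preimage (show Continuous fun x : (attach u).carrier =>
      (⟨x, Or.inr (Nat.lt_succ_self n)⟩ : (attach u).skel (n + 1)) from continuous_id.subtype_mk _))
      fun x => Iff.rfl
  attach m := by
    rcases lt_trichotomy m (n + 1) with hm | rfl | hm
    · obtain ⟨κ, K, q, hK, hq⟩ := hZ.attach m
      exact ⟨κ, K, _, hK, (isAttachingMap_comp_iff (X := attach u) (X' := Z)
        (attachInl u) (isClosedEmbedding_attachInl u).isEmbedding (fun _ _ => rfl)
        (attach_inl_mem_iff u hn)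
        (attach_skel_subset_range u (by omega)) q).2 hq⟩
    · exact ⟨ι, H, _, hH, isAttachingMap_attach u hn⟩
    · refine ⟨PEmpty, fun i => i.elim, fun z => z.1.elim, fun i => i.elim,
        isAttachingMap_of_isEmpty _ (fun x _ => ?_) _ _⟩
      exact (attach u).skelBelow_mono hm (Or.inr (Nat.lt_succ_self n))

/-- Cells of dimension `n + 1` can be attached in such a way that all maps from spheres of dimension
`n` to fixed point spaces extend to disks: one cell is attached for every such map. -/
theorem exists_attach_all {F : Set (Subgroup G)} (hZ : Z.IsCWComplex F)
    (hn : Z.skel n = Set.univ) : ∃ (Z' : FilteredGSpace G) (e : CellularMap Z Z'),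
      Z'.IsCWComplex F ∧ Z'.skel (n + 1) = Set.univ ∧ IsClosedEmbedding e.toMap ∧
      (∀ m z, e.toMap z ∈ Z'.skel m ↔ z ∈ Z.skel m) ∧
      (∀ m ≤ n, Z'.skel m ⊆ Set.range e.toMap) ∧
      ∀ K ∈ F, ∀ v : C(Sph (n + 1), Z.fix K), ∃ U : C(Disk (n + 1), Z'.fix K),
        ∀ s, (U (Sph.toDisk (n + 1) s)).1 = e.toMap (v s).1 := by
  let w : ∀ i : Σ K : F, C(Sph (n + 1), Z.fix K.1), C(Sph (n + 1), Z.fix i.1.1) := fun i => i.2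
  refine ⟨attach w, attachIncl w, isCWComplex_attach w hZ hn fun i => i.1.2,
    Set.eq_univ_of_forall fun x => Or.inr (Nat.lt_succ_self n), isClosedEmbedding_attachInl w,
    attach_inl_mem_iff w hn, fun m hm => attach_skel_subset_range w hm, fun K hK v => ?_⟩
  refine ⟨(isAttachingMap_attach w hn).charMap ⟨⟨K, hK⟩, v⟩, fun s => ?_⟩
  refine (attachCell_boundary w ⟨⟨K, hK⟩, v⟩ _ s).trans ?_
  exact congrArg (attachInl w) (one_smul G (v s).1)

end

end EquivariantCW

namespace EquivariantCW

/-! ### The colimit of a sequence of closed embeddings -/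

section

variable {G : Type u} [Group G] [TopologicalSpace G]
  {Z : ℕ → FilteredGSpace G} (e : ∀ k, CellularMap (Z k) (Z (k + 1)))

/-- The composite maps of a sequence. -/
def towerMap (i j : ℕ) (h : i ≤ j) : (Z i).carrier →[G] (Z j).carrier where
  toFun := Nat.leRecOn (C := fun k => (Z k).carrier) h fun {k} => (e k).toMap
  map_smul' g x := by
    induction j, h using Nat.le_induction with
    | base => rw [Nat.leRecOn_self, Nat.leRecOn_self]; rfl
    | succ j h ih =>
      rw [Nat.leRecOn_succ h, Nat.leRecOn_succ h, ih]
      exact (e j).map_smul g _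

lemma towerMap_self (i : ℕ) (x : (Z i).carrier) : towerMap e i i le_rfl x = x :=
  Nat.leRecOn_self (C := fun k => (Z k).carrier) x

lemma towerMap_succ {i j : ℕ} (h : i ≤ j) (x : (Z i).carrier) :
    towerMap e i (j + 1) (h.trans (Nat.le_succ j)) x = (e j).toMap (towerMap e i j h x) :=
  Nat.leRecOn_succ (C := fun k => (Z k).carrier) h x

instance : DirectedSystem (fun k => (Z k).carrier) (towerMap e · · ·) where
  map_self i x := towerMap_self e i x
  map_map _ _ _ hij hjk x := (Nat.leRecOn_trans (C := fun k => (Z k).carrier) hij hjk x).symm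

/-- The points of the colimit of a sequence, with the colimit topology. -/
abbrev TowerLimit : Type u := DirectLimit (fun k => (Z k).carrier) (towerMap e)

/-- The canonical map to the colimit. -/
def toLimit (k : ℕ) (x : (Z k).carrier) : TowerLimit e := ⟦⟨k, x⟩⟧

lemma toLimit_towerMap {i j : ℕ} (h : i ≤ j) (x : (Z i).carrier) :
    toLimit e j (towerMap e i j h x) = toLimit e i x :=
  DirectLimit.mk_apply (F := fun k => (Z k).carrier) i j x h

lemma toLimit_succ (k : ℕ) (x : (Z k).carrier) :
    toLimit e (k + 1) ((e k).toMap x) = toLimit e k x := by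
  rw [← toLimit_towerMap e (Nat.le_succ k) x, towerMap_succ e le_rfl, towerMap_self]

lemma toLimit_smul (k : ℕ) (g : G) (x : (Z k).carrier) :
    toLimit e k (g • x) = g • toLimit e k x := rfl

lemma exists_toLimit (x : TowerLimit e) : ∃ k y, toLimit e k y = x := by
  obtain ⟨k, y, h⟩ := DirectLimit.exists_eq_mk (towerMap e) x
  exact ⟨k, y, h.symm⟩

lemma isClosed_towerLimit_iff (A : Set (TowerLimit e)) :
    IsClosed A ↔ ∀ k, IsClosed (toLimit e k ⁻¹' A) := by
  rw [← isQuotientMap_quotient_mk'.isClosed_preimage, isClosed_sigma_iff]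
  rfl

lemma continuous_toLimit (k : ℕ) : Continuous (toLimit e k) :=
  continuous_iff_isClosed.2 fun A hA => (isClosed_towerLimit_iff e A).1 hA k

variable {e}

lemma isClosedEmbedding_towerMap (he : ∀ k, IsClosedEmbedding (e k).toMap) {i j : ℕ} (h : i ≤ j) :
    IsClosedEmbedding (towerMap e i j h) := by
  induction j, h using Nat.le_induction with
  | base => rw [show ⇑(towerMap e i i le_rfl) = id from funext (towerMap_self e i)]; exact .id
  | succ j h ih =>
    rw [show ⇑(towerMap e i (j + 1) (h.trans (Nat.le_succ j))) = (e j).toMap ∘ towerMap e i j h from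
      funext (towerMap_succ e h)]
    exact (he j).comp ih

lemma toLimit_injective (he : ∀ k, IsClosedEmbedding (e k).toMap) (k : ℕ) :
    Function.Injective (toLimit e k) :=
  DirectLimit.mk_injective (towerMap e) (fun _ _ h => (isClosedEmbedding_towerMap he h).injective) k

lemma isClosedEmbedding_toLimit (he : ∀ k, IsClosedEmbedding (e k).toMap) (k : ℕ) :
    IsClosedEmbedding (toLimit e k) := by
  refine .of_continuous_injective_isClosedMap (continuous_toLimit e k) (toLimit_injective he k)
    fun A hA => (isClosed_towerLimit_iff e _).2 fun j => ?_
  rcases le_total k j with h | h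
  · refine isClosed_of_mem_iff ((isClosedEmbedding_towerMap he h).isClosedMap A hA) fun x => ?_
    constructor
    · rintro ⟨a, ha, hax⟩
      rw [← toLimit_towerMap e h] at hax
      exact ⟨a, ha, toLimit_injective he j hax⟩
    · rintro ⟨a, ha, rfl⟩
      exact ⟨a, ha, (toLimit_towerMap e h a).symm⟩
  · refine isClosed_of_mem_iff (hA.preimage (isClosedEmbedding_towerMap he h).continuous)
      fun x => ?_
    rw [Set.mem_preimage, Set.mem_preimage, ← toLimit_towerMap e h,
      (toLimit_injective he k).mem_set_image]

lemma towerMap_mem_iff (hmem : ∀ k m z, (e k).toMap z ∈ (Z (k + 1)).skel m ↔ z ∈ (Z k).skel m)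
    {i j : ℕ} (h : i ≤ j) (m : ℕ) (z : (Z i).carrier) :
    towerMap e i j h z ∈ (Z j).skel m ↔ z ∈ (Z i).skel m := by
  induction j, h using Nat.le_induction with
  | base => rw [towerMap_self]
  | succ j h ih => rw [towerMap_succ e h, hmem, ih]

/-- If the `k`-th map of the sequence adds no points to the skeleta of dimension at most `n k`, then
these skeleta do not change any more from the `k`-th term on. -/
lemma mem_range_towerMap {n : ℕ → ℕ} (hn : Monotone n)
    (hrange : ∀ k, ∀ m ≤ n k, (Z (k + 1)).skel m ⊆ Set.range (e k).toMap)
    (hmem : ∀ k m z, (e k).toMap z ∈ (Z (k + 1)).skel m ↔ z ∈ (Z k).skel m)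
    {i j : ℕ} (h : i ≤ j) {m : ℕ} (hm : m ≤ n i) (x : (Z j).carrier) (hx : x ∈ (Z j).skel m) :
    ∃ y ∈ (Z i).skel m, towerMap e i j h y = x := by
  induction j, h using Nat.le_induction with
  | base => exact ⟨x, hx, towerMap_self e i x⟩
  | succ j h ih =>
    obtain ⟨z, rfl⟩ := hrange j m (hm.trans (hn h)) hx
    obtain ⟨y, hy, rfl⟩ := ih z ((hmem j m z).1 hx)
    exact ⟨y, hy, towerMap_succ e h y⟩

/-- The points of the colimit that come from a given stage of the filtrations. -/
def limitSkel (e : ∀ k, CellularMap (Z k) (Z (k + 1))) (m : ℕ) : Set (TowerLimit e) :=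
  {x | ∃ k, ∃ y ∈ (Z k).skel m, toLimit e k y = x}

lemma toLimit_mem_iff (he : ∀ k, IsClosedEmbedding (e k).toMap)
    (hmem : ∀ k m z, (e k).toMap z ∈ (Z (k + 1)).skel m ↔ z ∈ (Z k).skel m) (k m : ℕ)
    (x : (Z k).carrier) : toLimit e k x ∈ limitSkel e m ↔ x ∈ (Z k).skel m := by
  refine ⟨?_, fun h => ⟨k, x, h, rfl⟩⟩
  rintro ⟨j, y, hy, h⟩
  rw [← toLimit_towerMap e (le_max_left j k), ← toLimit_towerMap e (le_max_right j k)] at h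
  have h1 := toLimit_injective he _ h
  rwa [← towerMap_mem_iff hmem (le_max_right j k), ← h1, towerMap_mem_iff hmem]

lemma limitSkel_subset_range {n : ℕ → ℕ} (hn : Monotone n)
    (hrange : ∀ k, ∀ m ≤ n k, (Z (k + 1)).skel m ⊆ Set.range (e k).toMap)
    (hmem : ∀ k m z, (e k).toMap z ∈ (Z (k + 1)).skel m ↔ z ∈ (Z k).skel m) {k m : ℕ}
    (hm : m ≤ n k) : limitSkel e m ⊆ Set.range (toLimit e k) := by
  rintro x ⟨j, y, hy, rfl⟩
  rcases le_total k j with h | h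
  · obtain ⟨z, -, rfl⟩ := mem_range_towerMap hn hrange hmem h hm y hy
    exact ⟨z, (toLimit_towerMap e h z).symm⟩
  · exact ⟨_, toLimit_towerMap e h y⟩

end

section

variable {G : Type u} [Group G] [TopologicalSpace G] [DiscreteTopology G]
  {Z : ℕ → FilteredGSpace G}

/-- The colimit of a sequence of filtered `G`-spaces. -/
noncomputable def towerSpace (e : ∀ k, CellularMap (Z k) (Z (k + 1))) : FilteredGSpace G where
  carrier := TowerLimit e
  cont := by
    refine ⟨continuous_prod_of_discrete_left.2 fun g => continuous_iff_isClosed.2 fun A hA =>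
      (isClosed_towerLimit_iff e _).2 fun k => ?_⟩
    exact ((isClosed_towerLimit_iff e A).1 hA k).preimage (continuous_const_smul g)
  skel := limitSkel e
  smul_mem m g x := by
    rintro ⟨k, y, hy, rfl⟩
    exact ⟨k, g • y, (Z k).smul_mem m g y hy, rfl⟩
  mono m m' h := by
    rintro x ⟨k, y, hy, rfl⟩
    exact ⟨k, y, (Z k).mono h hy, rfl⟩
  exhaust x := by
    obtain ⟨k, y, rfl⟩ := exists_toLimit e x
    obtain ⟨m, hm⟩ := (Z k).exhaust y
    exact ⟨m, k, y, hm, rfl⟩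

/-- The colimit of a sequence in which each skeleton changes only finitely many times is a complex:
its cells of a given dimension are those of a term late enough in the sequence. -/
theorem isCWComplex_towerSpace {e : ∀ k, CellularMap (Z k) (Z (k + 1))} {F : Set (Subgroup G)}
    (hZ : ∀ k, (Z k).IsCWComplex F) (he : ∀ k, IsClosedEmbedding (e k).toMap)
    (hmem : ∀ k m z, (e k).toMap z ∈ (Z (k + 1)).skel m ↔ z ∈ (Z k).skel m) {n : ℕ → ℕ}
    (hn : Monotone n) (hn' : ∀ m, ∃ k, m ≤ n k)
    (hrange : ∀ k, ∀ m ≤ n k, (Z (k + 1)).skel m ⊆ Set.range (e k).toMap) :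
    (towerSpace e).IsCWComplex F where
  isClosed_iff A := by
    refine ⟨fun h m => h.preimage continuous_subtype_val, fun h => ?_⟩
    refine (isClosed_towerLimit_iff e A).2 fun k => ((hZ k).isClosed_iff _).2 fun m => ?_
    have hc : Continuous fun x : (Z k).skel m =>
        (⟨toLimit e k x.1, k, x.1, x.2, rfl⟩ : (towerSpace e).skel m) :=
      ((continuous_toLimit e k).comp continuous_subtype_val).subtype_mk _
    exact (h m).preimage hc
  attach m := by
    obtain ⟨k, hk⟩ := hn' m
    obtain ⟨ι, H, q, hH, hq⟩ := (hZ k).attach m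
    exact ⟨ι, H, _, hH, (isAttachingMap_comp_iff (X := towerSpace e) (X' := Z k) (toLimit e k)
      (isClosedEmbedding_toLimit he k).isEmbedding (fun _ _ => rfl) (toLimit_mem_iff he hmem k)
      (limitSkel_subset_range hn hrange hmem hk) q).2 hq⟩

end

end EquivariantCW

namespace EquivariantCW

/-! ### Construction of the universal space -/

variable {G : Type u} [Group G] [TopologicalSpace G]

/-- A cellular map that identifies the filtrations homeomorphically is an isomorphism. -/
lemma nonempty_iso_of_isEmbedding {P Q : FilteredGSpace G} (f : CellularMap P Q)
    (hf : IsEmbedding f.toMap) (hs : Function.Surjective f.toMap)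
    (hm : ∀ m x, f.toMap x ∈ Q.skel m → x ∈ P.skel m) : Nonempty (P ≅ Q) := by
  let h := hf.toHomeomorphOfSurjective hs
  have hh : ∀ y, f.toMap (h.symm y) = y := h.apply_symm_apply
  have hh' : ∀ x, h.symm (f.toMap x) = x := h.symm_apply_apply
  let g : CellularMap Q P :=
    ⟨⟨h.symm, h.symm.continuous⟩, fun a y => hf.injective (by
      change f.toMap (h.symm (a • y)) = f.toMap (a • h.symm y)
      rw [f.map_smul, hh, hh]), fun m y hy => hm m _ (by
      change f.toMap (h.symm y) ∈ _
      rwa [hh])⟩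
  exact ⟨⟨f, g, CellularMap.ext (ContinuousMap.ext hh'), CellularMap.ext (ContinuousMap.ext hh)⟩⟩

variable [DiscreteTopology G] {F : Set (Subgroup G)} {X : FilteredGSpace G}

/-- The universal space exists: starting from the `2`-skeleton, attach cells of dimension `k + 3`
for `k = 0, 1, 2, ...` along all maps from spheres of dimension `k + 2` to fixed point spaces. Since
a sphere in the fixed points of the colimit can be deformed into a finite stage, all homotopy from
degree two on gets killed. -/
theorem nonempty_universalSpace (hX : X.IsCWComplex F) : Nonempty (UniversalSpace F X) := by
  let Stage : ℕ → Type (u + 1) := fun k =>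
    {Z : FilteredGSpace G // Z.IsCWComplex F ∧ Z.skel (k + 2) = Set.univ}
  choose next e₀ hCW huniv he₀ hmem₀ hrange₀ hext₀ using
    fun (k : ℕ) (Z : Stage k) => exists_attach_all Z.2.1 Z.2.2
  let s : ∀ k, Stage k := fun k => Nat.rec (motive := Stage)
    ⟨X.skeleton 2, hX.skeleton 2, Set.eq_univ_of_forall fun x => x.2⟩
    (fun k Z => ⟨next k Z, hCW k Z, huniv k Z⟩) k
  let Z : ℕ → FilteredGSpace G := fun k => (s k).1
  let e : ∀ k, CellularMap (Z k) (Z (k + 1)) := fun k => e₀ k (s k)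
  have he : ∀ k, IsClosedEmbedding (e k).toMap := fun k => he₀ k (s k)
  have hmem : ∀ k m z, (e k).toMap z ∈ (Z (k + 1)).skel m ↔ z ∈ (Z k).skel m :=
    fun k => hmem₀ k (s k)
  have hn : Monotone fun k => k + 2 := fun a b h => Nat.add_le_add_right h 2
  have hrange : ∀ k, ∀ m ≤ k + 2, (Z (k + 1)).skel m ⊆ Set.range (e k).toMap :=
    fun k => hrange₀ k (s k)
  have hB : (towerSpace e).IsCWComplex F := isCWComplex_towerSpace (fun k => (s k).2.1) he hmem hn
    (fun m => ⟨m, Nat.le_add_right m 2⟩) hrange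
  have hsub : ∀ {k m : ℕ}, m ≤ k + 2 → limitSkel e m ⊆ Set.range (toLimit e k) :=
    fun {k m} h => limitSkel_subset_range hn hrange hmem h
  obtain ⟨iso⟩ : Nonempty (X.skeleton 2 ≅ (towerSpace e).skeleton 2) := by
    let f : CellularMap (X.skeleton 2) ((towerSpace e).skeleton 2) :=
      ⟨⟨fun x => ⟨toLimit e 0 x, 0, x, x.2, rfl⟩, (continuous_toLimit e 0).subtype_mk _⟩,
        fun a x => rfl, fun m x hx => ⟨0, x, hx, rfl⟩⟩
    refine nonempty_iso_of_isEmbedding f ?_ ?_ fun m x hx => (toLimit_mem_iff he hmem 0 m x).1 hx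
    · exact IsEmbedding.of_comp f.toMap.continuous continuous_subtype_val
        (isClosedEmbedding_toLimit he 0).isEmbedding
    · rintro ⟨x, hx⟩
      obtain ⟨y, rfl⟩ := hsub (k := 0) le_rfl hx
      exact ⟨y, rfl⟩
  refine ⟨⟨towerSpace e, hB, iso, fun K hK m hm => ?_⟩⟩
  refine homotopyGroup_of_diskExtends (by omega) fun u => ?_
  obtain ⟨u', ⟨hu⟩, hu'⟩ := (hB.isCellFiltration K).approx (lowDim_sphere m) u
  obtain ⟨k, rfl⟩ : ∃ k, m = k + 2 := ⟨m - 2, by omega⟩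
  let c : C((Z k).fix K, (towerSpace e).fix K) :=
    ⟨fun x => ⟨toLimit e k x.1, fun a => congrArg (toLimit e k) (x.2 a)⟩,
      ((continuous_toLimit e k).comp continuous_subtype_val).subtype_mk _⟩
  have hc : IsEmbedding c := IsEmbedding.of_comp c.continuous continuous_subtype_val
    ((isClosedEmbedding_toLimit he k).isEmbedding.comp IsEmbedding.subtypeVal)
  obtain ⟨v, hv⟩ := exists_lift_of_isEmbedding hc u' fun x => by
    obtain ⟨y, hy⟩ := hsub (k := k) le_rfl (hu' x)
    refine ⟨⟨y, fun a => toLimit_injective he k ?_⟩, Subtype.ext hy⟩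
    change toLimit e k (a.1 • y) = _
    rw [toLimit_smul, hy]
    exact (u' x).2 a
  obtain ⟨U, hU⟩ := hext₀ k (s k) K hK v
  let c' : C((Z (k + 1)).fix K, (towerSpace e).fix K) :=
    ⟨fun x => ⟨toLimit e (k + 1) x.1, fun a => congrArg (toLimit e (k + 1)) (x.2 a)⟩,
      ((continuous_toLimit e (k + 1)).comp continuous_subtype_val).subtype_mk _⟩
  have hcU : u' = (c'.comp U).comp (Sph.toDisk (k + 3)) := ContinuousMap.ext fun x => by
    rw [← hv x]
    refine Subtype.ext ?_
    change toLimit e k (v x).1 = toLimit e (k + 1) (U (Sph.toDisk (k + 3) x)).1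
    rw [hU, ← toLimit_succ]
  have hh : u.Homotopic u' := ⟨hu.toHomotopy⟩
  rw [hcU] at hh
  exact extends_of_homotopic hh

end EquivariantCW

open EquivariantCW in
theorem proposition3 {G : Type u} [Group G] [TopologicalSpace G] [DiscreteTopology G]
    (F : Set (Subgroup G)) (hF : IsFamily F)
    (X : FilteredGSpace G) (hX : X.IsCWComplex F) :
    -- the construction of the universal space can be carried out
    Nonempty (UniversalSpace F X) ∧
    -- and every outcome `B` of it has the universal property
    ∀ B : UniversalSpace F X,
      -- the common `2`-skeleton identifies the fundamental functors of `B` and `X`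
      ∃ (_ : IsIso (inducedTransf F (X.skeletonIncl 2))) (_ : IsIso (inducedTransf F B.incl)),
        ∀ Y : FilteredGSpace G, Y.IsCWComplex F →
          ∀ Φ : fundamentalFunctor F Y ⟶ fundamentalFunctor F X,
            (∃ φ : Y ⟶ B.space,
              inducedTransf F φ ≫ inv (inducedTransf F B.incl) ≫
                inducedTransf F (X.skeletonIncl 2) = Φ) ∧
            (∀ φ φ' : Y ⟶ B.space,
              inducedTransf F φ ≫ inv (inducedTransf F B.incl) ≫
                inducedTransf F (X.skeletonIncl 2) = Φ →
              inducedTransf F φ' ≫ inv (inducedTransf F B.incl) ≫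
                inducedTransf F (X.skeletonIncl 2) = Φ →
              GHomotopic φ φ') := by
  refine ⟨nonempty_universalSpace hX, fun B => ?_⟩
  have hi : IsIso (inducedTransf F (X.skeletonIncl 2)) := isIso_inducedTransf_skeletonIncl hX
  have hj : IsIso (inducedTransf F B.incl) := isIso_inducedTransf_incl B
  refine ⟨hi, hj, fun Y hY Φ => ⟨?_, fun φ φ' h h' => ?_⟩⟩
  · obtain ⟨φ, hφ⟩ := exists_inducedTransf_eq hY B.isCWComplex B.homotopy_trivial
      (Φ ≫ inv (inducedTransf F (X.skeletonIncl 2)) ≫ inducedTransf F B.incl)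
    exact ⟨φ, by simp [hφ]⟩
  · exact gHomotopic_of_inducedTransf_eq hY B.homotopy_trivial φ φ'
      ((cancel_mono _).1 (h.trans h'.symm))
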